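/- Let $(M^3,g)$ and $(N^2,h)$ be smooth Riemannian manifolds of dimensions 3 and 2 and let $\pi:(M^3,g)\to(N^2,h)$ be a Riemannian submersion. Let $\{e_1,e_2,e_3\}$ be a smooth local orthonormal frame adapted to $\pi$, defined on an open set $U\subseteq M$: $e_3$ is vertical, and $e_1,e_2$ are horizontal and $\pi$-related to a smooth orthonormal frame $\varepsilon_1,\varepsilon_2$ defined on an open set $V\supseteq\pi(U)$ of $N$. Then there are functions $f_1,f_2,\kappa_1,\kappa_2,\sigma$ (the integrability data of the frame) such that $[\varepsilon_1,\varepsilon_2]=F_1\varepsilon_1+F_2\varepsilon_2$ on $V$, $f_i=F_i\circ\pi$, and on $U$ $$[e_1,e_3]=\kappa_1e_3,\qquad [e_2,e_3]=\kappa_2e_3,\qquad [e_1,e_2]=f_1e_1+f_2e_2-2\sigma e_3 .$$ For the integrability data the following hold on $U$. 1. The tension field $\tau(\pi)=\mathrm{Trace}_g\nabla d\pi$ is $\tau(\pi)=-\kappa_1\varepsilon_1-\kappa_2\varepsilon_2$ (with $\varepsilon_i$ taken along $\pi$). 2. The Gauss curvature $K^N$ of $(N,h)$, composed with $\pi$,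 is $K^N=-[e_2(f_1)-e_1(f_2)+f_1^2+f_2^2]$. 3. $\pi$ is biharmonic on $U$ (that is, a critical point of the bienergy $\frac12\int_\Omega|\tau(\varphi)|^2\,dv_g$ for every compact $\Omega\subseteq U$, with respect to smooth variations of $\pi$ supported in $\Omega$) if and only if, on $U$, $$\begin{cases} -\Delta^M\kappa_1-f_1e_1(\kappa_2)-e_1(\kappa_2f_1)-f_2e_2(\kappa_2)-e_2(\kappa_2f_2)+\kappa_1\kappa_2f_1+\kappa_2^2f_2+\kappa_1\{-K^N+f_1^2+f_2^2\}=0,\\ -\Delta^M\kappa_2+f_1e_1(\kappa_1)+e_1(\kappa_1f_1)+f_2e_2(\kappa_1)+e_2(\kappa_1f_2)-\kappa_1\kappa_2f_2-\kappa_1^2f_1+\kappa_2\{-K^N+f_1^2+f_2^2\}=0, \end{cases}$$ where $\Delta^M$ is the Laplace–Beltrami operator (the trace of the Hessian). -/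

import Mathlib

open scoped Manifold ContDiff

noncomputable section

namespace BiharmonicSubmersion

/-- Smooth Riemannian metrics on an `n`-dimensional manifold (modelled on `ℝⁿ`, no boundary). -/
abbrev SmoothMetric (n : ℕ) (M : Type*) [TopologicalSpace M]
    [ChartedSpace (EuclideanSpace ℝ (Fin n)) M] [IsManifold (𝓡 n) ∞ M] :=
  Bundle.ContMDiffRiemannianMetric (𝓡 n) ∞ (EuclideanSpace ℝ (Fin n))
    (TangentSpace (𝓡 n) : M → Type)

/-! ### Local coordinates

For a point `x₀` the chart used is the preferred chart `extChartAt (𝓡 n) x₀`; `u` denotes a point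
of its target. -/

/-- Partial derivative `∂ᵢ f` of a function on `ℝⁿ`. -/
def partialDeriv {n : ℕ} {F : Type*} [NormedAddCommGroup F] [NormedSpace ℝ F] (i : Fin n)
    (f : EuclideanSpace ℝ (Fin n) → F) (u : EuclideanSpace ℝ (Fin n)) : F :=
  fderiv ℝ f u (EuclideanSpace.single i 1)

/-- The coordinate vector field `∂ᵢ` of the chart at `x₀`, at the point with coordinates `u`. -/
def coordVec (n : ℕ) {M : Type*} [TopologicalSpace M]
    [ChartedSpace (EuclideanSpace ℝ (Fin n)) M] (x₀ : M) (i : Fin n)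
    (u : EuclideanSpace ℝ (Fin n)) : TangentSpace (𝓡 n) ((extChartAt (𝓡 n) x₀).symm u) :=
  mfderiv 𝓘(ℝ, EuclideanSpace ℝ (Fin n)) (𝓡 n) (extChartAt (𝓡 n) x₀).symm u
    (EuclideanSpace.single i (1 : ℝ) : EuclideanSpace ℝ (Fin n))

section Metric

variable {n : ℕ} {M : Type*} [TopologicalSpace M] [ChartedSpace (EuclideanSpace ℝ (Fin n)) M]
  [IsManifold (𝓡 n) ∞ M]

/-- The matrix `g_{ij}` of the metric in the chart at `x₀`. -/
def gram (g : SmoothMetric n M) (x₀ : M) (u : EuclideanSpace ℝ (Fin n)) :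
    Matrix (Fin n) (Fin n) ℝ :=
  Matrix.of fun i j ↦
    g.inner ((extChartAt (𝓡 n) x₀).symm u) (coordVec n x₀ i u) (coordVec n x₀ j u)

/-- The Christoffel symbol `Γᵏ_{ij}` of the Levi-Civita connection in the chart at `x₀`. -/
def christoffel (g : SmoothMetric n M) (x₀ : M) (k i j : Fin n)
    (u : EuclideanSpace ℝ (Fin n)) : ℝ :=
  (1 / 2) * ∑ l, (gram g x₀ u)⁻¹ k l *
    (partialDeriv i (fun v ↦ gram g x₀ v j l) u + partialDeriv j (fun v ↦ gram g x₀ v i l) u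
      - partialDeriv l (fun v ↦ gram g x₀ v i j) u)

/-- The Laplace–Beltrami operator (trace of the Hessian),
`Δf = g^{ij} (∂ᵢ∂ⱼ f - Γᵏ_{ij} ∂ₖ f)`. -/
def laplacian (g : SmoothMetric n M) (f : M → ℝ) (x : M) : ℝ :=
  let u := extChartAt (𝓡 n) x x
  let fc : EuclideanSpace ℝ (Fin n) → ℝ := fun v ↦ f ((extChartAt (𝓡 n) x).symm v)
  ∑ i, ∑ j, (gram g x u)⁻¹ i j *
    (partialDeriv i (partialDeriv j fc) u - ∑ k, christoffel g x k i j u * partialDeriv k fc u)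

/-- Components of the curvature tensor in the chart at `x₀`:
`R(∂ᵢ, ∂ⱼ) ∂ₖ = Rˡ_{kij} ∂ₗ`, where `R(X, Y) = [∇_X, ∇_Y] - ∇_{[X, Y]}`. -/
def curvatureComp (g : SmoothMetric n M) (x₀ : M) (l k i j : Fin n)
    (u : EuclideanSpace ℝ (Fin n)) : ℝ :=
  partialDeriv i (christoffel g x₀ l j k) u - partialDeriv j (christoffel g x₀ l i k) u
    + ∑ m, (christoffel g x₀ l i m u * christoffel g x₀ m j k u
      - christoffel g x₀ l j m u * christoffel g x₀ m i k u)

/-- The part of the Riemannian volume measure carried by the domain of the chart at `x₀`: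
`√(det g_{ij}) du`, transported to `M`. -/
def chartVolume [MeasurableSpace M] (g : SmoothMetric n M) (x₀ : M) : MeasureTheory.Measure M :=
  ((MeasureTheory.volume.restrict (extChartAt (𝓡 n) x₀).target).withDensity
    (fun u ↦ ENNReal.ofReal (Real.sqrt (gram g x₀ u).det))).map (extChartAt (𝓡 n) x₀).symm

/-- The Riemannian volume measure. By the change of variables formula any two of the local measures
`√(det g_{ij}) du` agree where both charts are defined, so the measure they glue to is the smallest
measure that is at least each of them. -/
def riemannianVolume [MeasurableSpace M] (g : SmoothMetric n M) : MeasureTheory.Measure M :=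
  ⨆ x₀ : M, chartVolume g x₀

end Metric

/-- The Gauss curvature `⟨R(∂₁, ∂₂)∂₂, ∂₁⟩ / det g_{ij}` of a Riemannian surface. -/
def gaussCurvature {N : Type*} [TopologicalSpace N] [ChartedSpace (EuclideanSpace ℝ (Fin 2)) N]
    [IsManifold (𝓡 2) ∞ N] (h : SmoothMetric 2 N) (y : N) : ℝ :=
  let u := extChartAt (𝓡 2) y y
  (∑ l, gram h y u 0 l * curvatureComp h y l 1 0 1 u) / (gram h y u).det

section Maps

variable {m n : ℕ} {M N : Type*}
  [TopologicalSpace M] [ChartedSpace (EuclideanSpace ℝ (Fin m)) M] [IsManifold (𝓡 m) ∞ M]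
  [TopologicalSpace N] [ChartedSpace (EuclideanSpace ℝ (Fin n)) N] [IsManifold (𝓡 n) ∞ N]

/-- The tension field `τ(φ) = Trace_g ∇dφ`, whose components in local coordinates are
`τᶜ = g^{ij} (∂ᵢ∂ⱼ φᶜ - Γᵏ_{ij} ∂ₖ φᶜ + Γᶜ_{ab}(φ) ∂ᵢφᵃ ∂ⱼφᵇ)`.
(The tangent space at `φ x` is `ℝⁿ` through the preferred chart at `φ x`, so the vector of
components in that chart is the tangent vector.) -/
def tension (g : SmoothMetric m M) (h : SmoothMetric n N) (φ : M → N) (x : M) :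
    TangentSpace (𝓡 n) (φ x) :=
  let u := extChartAt (𝓡 m) x x
  let φc : EuclideanSpace ℝ (Fin m) → EuclideanSpace ℝ (Fin n) :=
    fun v ↦ extChartAt (𝓡 n) (φ x) (φ ((extChartAt (𝓡 m) x).symm v))
  (WithLp.toLp 2 fun c ↦ ∑ i, ∑ j, (gram g x u)⁻¹ i j *
    ((partialDeriv i (partialDeriv j φc) u) c
      - ∑ k, christoffel g x k i j u * (partialDeriv k φc u) c
      + ∑ a, ∑ b, christoffel h (φ x) c a b (φc u) *
          (partialDeriv i φc u) a * (partialDeriv j φc u) b) : EuclideanSpace ℝ (Fin n))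

/-- The bienergy `E²(φ, Ω) = ½ ∫_Ω |τ(φ)|²`. -/
def bienergy [MeasurableSpace M] (g : SmoothMetric m M) (h : SmoothMetric n N) (Ω : Set M)
    (φ : M → N) : ℝ :=
  (1 / 2) * ∫ x in Ω, h.inner (φ x) (tension g h φ x) (tension g h φ x) ∂(riemannianVolume g)

/-- A map is biharmonic on the open set `U` if it is a critical point of the bienergy on every
compact `Ω ⊆ U`, with respect to smooth variations that are supported in `Ω`. -/
def IsBiharmonicOn [MeasurableSpace M] (g : SmoothMetric m M) (h : SmoothMetric n N)
    (φ : M → N) (U : Set M) : Prop :=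
  ∀ Ω : Set M, IsCompact Ω → Ω ⊆ U →
    ∀ Φ : ℝ → M → N,
      ContMDiff (𝓘(ℝ, ℝ).prod (𝓡 m)) (𝓡 n) ∞ (fun q : ℝ × M ↦ Φ q.1 q.2) →
      Φ 0 = φ →
      (∀ t, ∀ x ∉ Ω, Φ t x = φ x) →
      HasDerivAt (fun t ↦ bienergy g h Ω (Φ t)) 0 0

/-- Riemannian submersions: smooth maps whose differential is onto and is isometric on the
orthogonal complement of its kernel (the horizontal space). -/
structure IsRiemannianSubmersion (g : SmoothMetric m M) (h : SmoothMetric n N) (π : M → N) :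
    Prop where
  smooth : ContMDiff (𝓡 m) (𝓡 n) ∞ π
  surjective : ∀ p, Function.Surjective (mfderiv (𝓡 m) (𝓡 n) π p)
  isometric : ∀ (p : M) (v w : TangentSpace (𝓡 m) p),
    (∀ z : TangentSpace (𝓡 m) p, mfderiv (𝓡 m) (𝓡 n) π p z = 0 → g.inner p v z = 0) →
    (∀ z : TangentSpace (𝓡 m) p, mfderiv (𝓡 m) (𝓡 n) π p z = 0 → g.inner p w z = 0) →
    h.inner (π p) (mfderiv (𝓡 m) (𝓡 n) π p v) (mfderiv (𝓡 m) (𝓡 n) π p w) = g.inner p v w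

/-- `X(f)`: the derivative of the function `f` in the direction of the vector field `X`. -/
def dirDeriv (X : (p : M) → TangentSpace (𝓡 m) p) (f : M → ℝ) (p : M) : ℝ :=
  mfderiv (𝓡 m) 𝓘(ℝ, ℝ) f p (X p)

/-- `X₁, …, X_r` are smooth on `U` and orthonormal at each point of `U`. -/
structure IsOrthonormalOn {r : ℕ} (g : SmoothMetric m M) (U : Set M)
    (X : Fin r → (p : M) → TangentSpace (𝓡 m) p) : Prop where
  smooth : ∀ i, ContMDiffOn (𝓡 m) (𝓡 m).tangent ∞
    (fun p ↦ (⟨p, X i p⟩ : TangentBundle (𝓡 m) M)) U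
  orthonormal : ∀ p ∈ U, ∀ i j, g.inner p (X i p) (X j p) = if i = j then 1 else 0

end Maps

section Frame

variable {M N : Type*}
  [TopologicalSpace M] [ChartedSpace (EuclideanSpace ℝ (Fin 3)) M] [IsManifold (𝓡 3) ∞ M]
  [TopologicalSpace N] [ChartedSpace (EuclideanSpace ℝ (Fin 2)) N] [IsManifold (𝓡 2) ∞ N]

/-- `e₁, e₂, e₃` is an orthonormal frame on the open set `U ⊆ M`, adapted to `π`: `e₃` is vertical,
and `e₁`, `e₂` are horizontal (being orthogonal to `e₃`) and `π`-related to the orthonormal frame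
`ε₁, ε₂` on the open set `V ⊇ π(U)` of the base. -/
structure IsAdaptedFrame (g : SmoothMetric 3 M) (h : SmoothMetric 2 N) (π : M → N)
    (U : Set M) (V : Set N) (e₁ e₂ e₃ : (p : M) → TangentSpace (𝓡 3) p)
    (ε₁ ε₂ : (y : N) → TangentSpace (𝓡 2) y) : Prop where
  isOpen_source : IsOpen U
  isOpen_target : IsOpen V
  mapsTo : Set.MapsTo π U V
  frame : IsOrthonormalOn g U ![e₁, e₂, e₃]
  baseFrame : IsOrthonormalOn h V ![ε₁, ε₂]
  related₁ : ∀ p ∈ U, mfderiv (𝓡 3) (𝓡 2) π p (e₁ p) = ε₁ (π p)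
  related₂ : ∀ p ∈ U, mfderiv (𝓡 3) (𝓡 2) π p (e₂ p) = ε₂ (π p)
  vertical : ∀ p ∈ U, mfderiv (𝓡 3) (𝓡 2) π p (e₃ p) = 0

/-- `f₁, f₂, κ₁, κ₂, σ` are the integrability data of the adapted frame on `U`: there are `F₁, F₂`
with `fᵢ = Fᵢ ∘ π` and `[ε₁, ε₂] = F₁ ε₁ + F₂ ε₂`, and `[e₁, e₃] = κ₁ e₃`, `[e₂, e₃] = κ₂ e₃`,
`[e₁, e₂] = f₁ e₁ + f₂ e₂ - 2 σ e₃`. -/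
structure IsIntegrabilityData (π : M → N) (U : Set M) (V : Set N)
    (e₁ e₂ e₃ : (p : M) → TangentSpace (𝓡 3) p) (ε₁ ε₂ : (y : N) → TangentSpace (𝓡 2) y)
    (f₁ f₂ κ₁ κ₂ σ : M → ℝ) : Prop where
  base : ∃ F₁ F₂ : N → ℝ,
    (∀ y ∈ V, VectorField.mlieBracket (𝓡 2) ε₁ ε₂ y = F₁ y • ε₁ y + F₂ y • ε₂ y) ∧
    (∀ p ∈ U, f₁ p = F₁ (π p)) ∧ (∀ p ∈ U, f₂ p = F₂ (π p))
  bracket₁₃ : ∀ p ∈ U, VectorField.mlieBracket (𝓡 3) e₁ e₃ p = κ₁ p • e₃ p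
  bracket₂₃ : ∀ p ∈ U, VectorField.mlieBracket (𝓡 3) e₂ e₃ p = κ₂ p • e₃ p
  bracket₁₂ : ∀ p ∈ U, VectorField.mlieBracket (𝓡 3) e₁ e₂ p
    = f₁ p • e₁ p + f₂ p • e₂ p - (2 * σ p) • e₃ p

end Frame

end BiharmonicSubmersion

end

set_option linter.unusedSectionVars false

open scoped Manifold ContDiff
noncomputable section
namespace BiharmonicSubmersion

/-! ### Riemannian geometry of a metric on an open subset of `ℝⁿ` -/

/-! Everything is computed in orthonormal frames, where the geometry is encoded by Lie brackets
alone. Inner products of frame fields are constant, so the Koszul formula expresses the Levi-Civita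
connection through bracket components (`koszul`, `IsLocalFrame.bil_cov`). For any map `φ` with
coefficients `A i a = ⟨dφ(eᵢ), ε_a⟩`, the tension field then has components `∑ᵢ (eᵢ(A i a) - cᵢ A i
a + ∑ A i b * A i d * ⟨∇_{ε_b} ε_d, ε_a⟩)`, where `cᵢ = ∑ⱼ ⟨[eᵢ, eⱼ], eⱼ⟩ = -div eᵢ`
(`tension_eq_frame`); the Laplacian is treated in the same way (`laplacian_eq_frame`).

Integrability data exist because brackets of `π`-related fields are `π`-related
(`mfderiv_mlieBracket_of_related`). For `π` itself the matrix `A` is constant, with entries 0 and 1,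
so only brackets survive and the components of the tension field are `-κ₁, -κ₂`.

The curvature formula is Cartan's. On the base, with frame indices starting at 0, let `ω = -(F₀ θ⁰ +
F₁ θ¹)` be the connection form. Differentiating the equations for `dε₀, dε₁` once more, and using
symmetry of second derivatives, identifies the curvature operator with `dω`, and the structure
equations of the coframe evaluate `dω` (`curvOp_frame`, `fderiv_connForm_sub`).

For biharmonicity, let `Φ` be a variation with components `W a = ⟨∂ₜΦ, ε_a⟩` at time 0. Pulling back
`dθ^a = -F_a θ⁰ ∧ θ¹` and evaluating on `∂ₜ` and `eᵢ` gives the time derivative of every `A i a`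
(`hasDerivAt_frameDiff`), hence that of the tension components (`hasDerivAt_tensionCoeff`).
Multiplying by the tension components `-κ_a` yields the derivative of the bienergy density. It
equals the pairing of the Euler-Lagrange expressions with `W` plus the divergence of an explicit
flux (`first_variation_density`); the curvature enters through the derivatives of `f₁, f₂`. The flux
is supported in `Ω`, so the divergence theorem (`integral_divergence`) removes it and
`hasDerivAt_bienergy` follows.

One direction of the equivalence is then immediate. For the other, if the Euler-Lagrange expressions
do not both vanish at `p`, a bump variation at `p` in their direction (`exists_variation`) makes the
first variation strictly positive. -/

lemma two_le_infty : (2 : WithTop ℕ∞) ≤ ∞ := ENat.LEInfty.out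

section Euclidean

variable {n : ℕ}

/-- Christoffel symbols of a matrix-valued function on `ℝⁿ`. -/
def chr (G : EuclideanSpace ℝ (Fin n) → Matrix (Fin n) (Fin n) ℝ) (k i j : Fin n)
    (u : EuclideanSpace ℝ (Fin n)) : ℝ :=
  (1 / 2) * ∑ l, (G u)⁻¹ k l *
    (partialDeriv i (fun v ↦ G v j l) u + partialDeriv j (fun v ↦ G v i l) u
      - partialDeriv l (fun v ↦ G v i j) u)

/-- The bilinear form of a matrix. -/
def bil (A : Matrix (Fin n) (Fin n) ℝ) :
    EuclideanSpace ℝ (Fin n) →ₗ[ℝ] EuclideanSpace ℝ (Fin n) →ₗ[ℝ] ℝ :=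
  LinearMap.mk₂ ℝ (fun X Y ↦ ∑ i, ∑ j, A i j * X i * Y j)
    (fun X X' Y ↦ by simp [← Finset.sum_add_distrib, mul_add, add_mul])
    (fun c X Y ↦ by simp [Finset.mul_sum, mul_assoc, mul_left_comm])
    (fun X Y Y' ↦ by simp [← Finset.sum_add_distrib, mul_add])
    (fun c X Y ↦ by simp [Finset.mul_sum, mul_left_comm])

lemma bil_apply (A : Matrix (Fin n) (Fin n) ℝ) (X Y : EuclideanSpace ℝ (Fin n)) :
    bil A X Y = ∑ i, ∑ j, A i j * X i * Y j := rfl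

lemma bil_comm {A : Matrix (Fin n) (Fin n) ℝ} (hA : A.IsSymm) (X Y : EuclideanSpace ℝ (Fin n)) :
    bil A X Y = bil A Y X := by
  rw [bil_apply, bil_apply, Finset.sum_comm]
  refine Finset.sum_congr rfl fun i _ ↦ Finset.sum_congr rfl fun j _ ↦ ?_
  rw [← hA.apply i j]; ring

/-- The derivative of a matrix-valued function in the direction `X`, as a bilinear form. -/
def dbil (G : EuclideanSpace ℝ (Fin n) → Matrix (Fin n) (Fin n) ℝ)
    (u X Y Z : EuclideanSpace ℝ (Fin n)) : ℝ :=
  ∑ k, ∑ i, ∑ j, X k * partialDeriv k (fun v ↦ G v i j) u * Y i * Z j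

lemma euclidean_eq_sum (w : EuclideanSpace ℝ (Fin n)) :
    w = ∑ i, w i • EuclideanSpace.single i (1 : ℝ) := by
  ext j
  simp [Finset.sum_apply, Pi.single_apply]

lemma fderiv_apply_eq_sum {F : Type*} [NormedAddCommGroup F] [NormedSpace ℝ F]
    (f : EuclideanSpace ℝ (Fin n) → F) (u w : EuclideanSpace ℝ (Fin n)) :
    fderiv ℝ f u w = ∑ i, w i • partialDeriv i f u := by
  conv_lhs => rw [euclidean_eq_sum w]
  simp [partialDeriv]

/-- Product rule for a differential evaluated on a moving vector. The last term is the one that the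
connection later completes to a covariant derivative. -/
lemma fderiv_fderiv_apply {F E : Type*} [NormedAddCommGroup F] [NormedSpace ℝ F]
    [NormedAddCommGroup E] [NormedSpace ℝ E] {f : E → F} {X : E → E} {u : E}
    (hf : ContDiffAt ℝ 2 f u) (hX : DifferentiableAt ℝ X u) (w : E) :
    fderiv ℝ (fun v ↦ fderiv ℝ f v (X v)) u w
      = fderiv ℝ (fderiv ℝ f) u w (X u) + fderiv ℝ f u (fderiv ℝ X u w) := by
  have h1 : DifferentiableAt ℝ (fderiv ℝ f) u :=
    (hf.fderiv_right (m := 1) (by norm_num)).differentiableAt (by norm_num)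
  rw [(h1.hasFDerivAt.clm_apply hX.hasFDerivAt).fderiv]
  simp [add_comm]

/-- Coordinate expression of the Levi-Civita connection. -/
def cov (G : EuclideanSpace ℝ (Fin n) → Matrix (Fin n) (Fin n) ℝ)
    (X Y : EuclideanSpace ℝ (Fin n) → EuclideanSpace ℝ (Fin n)) (u : EuclideanSpace ℝ (Fin n)) :
    EuclideanSpace ℝ (Fin n) :=
  fderiv ℝ Y u (X u) + WithLp.toLp 2 (fun k ↦ ∑ i, ∑ j, chr G k i j u * X u i * Y u j)

/-- The metric cancels its inverse in the definition of `chr`, leaving the Christoffel symbols of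
the first kind. -/
lemma sum_mul_chr {G : EuclideanSpace ℝ (Fin n) → Matrix (Fin n) (Fin n) ℝ}
    {u : EuclideanSpace ℝ (Fin n)} (hs : (G u).IsSymm) (hd : (G u).det ≠ 0) (l i j : Fin n) :
    ∑ k, G u k l * chr G k i j u = (1 / 2) * (partialDeriv i (fun v ↦ G v j l) u
      + partialDeriv j (fun v ↦ G v i l) u - partialDeriv l (fun v ↦ G v i j) u) := by
  have h1 : G u * (G u)⁻¹ = 1 := Matrix.mul_nonsing_inv _ (isUnit_iff_ne_zero.2 hd)
  have h2 : ∀ m, ∑ k, G u k l * (G u)⁻¹ k m = if l = m then 1 else 0 := fun m ↦ by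
    rw [← Matrix.one_apply, ← h1, Matrix.mul_apply]
    exact Finset.sum_congr rfl fun k _ ↦ by rw [hs.apply]
  have h3 : ∀ k, G u k l * chr G k i j u = ∑ m, (1 / 2) * ((G u k l * (G u)⁻¹ k m) *
      (partialDeriv i (fun v ↦ G v j m) u + partialDeriv j (fun v ↦ G v i m) u
      - partialDeriv m (fun v ↦ G v i j) u)) := fun k ↦ by
    rw [chr, Finset.mul_sum, Finset.mul_sum]
    exact Finset.sum_congr rfl fun m _ ↦ by ring
  simp_rw [h3]
  rw [Finset.sum_comm]
  simp_rw [← Finset.mul_sum, ← Finset.sum_mul, h2]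
  simp

/-- Lowering the upper index leaves three permuted derivatives of the metric. These are exactly the
terms of the Koszul formula in which no vector field is differentiated. -/
lemma bil_chr {G : EuclideanSpace ℝ (Fin n) → Matrix (Fin n) (Fin n) ℝ}
    {u : EuclideanSpace ℝ (Fin n)} (hs : (G u).IsSymm) (hd : (G u).det ≠ 0)
    (X Y Z : EuclideanSpace ℝ (Fin n)) :
    bil (G u) (WithLp.toLp 2 (fun k ↦ ∑ i, ∑ j, chr G k i j u * X i * Y j)) Z
      = (1 / 2) * (dbil G u X Y Z + dbil G u Y X Z - dbil G u Z X Y) := by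
  have h1 : bil (G u) (WithLp.toLp 2 (fun k ↦ ∑ i, ∑ j, chr G k i j u * X i * Y j)) Z
      = ∑ l, ∑ i, ∑ j, (∑ k, G u k l * chr G k i j u) * X i * Y j * Z l := by
    rw [bil_apply, Finset.sum_comm]
    refine Finset.sum_congr rfl fun l _ ↦ ?_
    simp only [Finset.mul_sum, Finset.sum_mul]
    rw [Finset.sum_comm]
    refine Finset.sum_congr rfl fun i _ ↦ ?_
    rw [Finset.sum_comm]
    exact Finset.sum_congr rfl fun j _ ↦ Finset.sum_congr rfl fun k _ ↦ by ring
  have e1 : dbil G u X Y Z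
      = ∑ l, ∑ i, ∑ j, partialDeriv i (fun v ↦ G v j l) u * X i * Y j * Z l := by
    rw [dbil, Finset.sum_congr rfl fun k _ ↦ Finset.sum_comm, Finset.sum_comm]
    exact Finset.sum_congr rfl fun l _ ↦ Finset.sum_congr rfl fun i _ ↦
      Finset.sum_congr rfl fun j _ ↦ by ring
  have e2 : dbil G u Y X Z
      = ∑ l, ∑ i, ∑ j, partialDeriv j (fun v ↦ G v i l) u * X i * Y j * Z l := by
    rw [dbil, Finset.sum_comm, Finset.sum_congr rfl fun i _ ↦ Finset.sum_comm, Finset.sum_comm]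
    exact Finset.sum_congr rfl fun l _ ↦ Finset.sum_congr rfl fun i _ ↦
      Finset.sum_congr rfl fun j _ ↦ by ring
  have e3 : dbil G u Z X Y
      = ∑ l, ∑ i, ∑ j, partialDeriv l (fun v ↦ G v i j) u * X i * Y j * Z l :=
    Finset.sum_congr rfl fun l _ ↦ Finset.sum_congr rfl fun i _ ↦
      Finset.sum_congr rfl fun j _ ↦ by ring
  rw [h1, e1, e2, e3]
  simp_rw [sum_mul_chr hs hd, ← Finset.sum_add_distrib, ← Finset.sum_sub_distrib, Finset.mul_sum]
  exact Finset.sum_congr rfl fun l _ ↦ Finset.sum_congr rfl fun i _ ↦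
      Finset.sum_congr rfl fun j _ ↦ by ring

lemma fderiv_bil
    {G : EuclideanSpace ℝ (Fin n) → Matrix (Fin n) (Fin n) ℝ}
    {Y Z : EuclideanSpace ℝ (Fin n) → EuclideanSpace ℝ (Fin n)}
    {u : EuclideanSpace ℝ (Fin n)} (hG : ∀ i j, DifferentiableAt ℝ (fun v ↦ G v i j) u)
    (hY : DifferentiableAt ℝ Y u) (hZ : DifferentiableAt ℝ Z u) (X : EuclideanSpace ℝ (Fin n)) :
    fderiv ℝ (fun v ↦ bil (G v) (Y v) (Z v)) u X = dbil G u X (Y u) (Z u)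
      + bil (G u) (fderiv ℝ Y u X) (Z u) + bil (G u) (Y u) (fderiv ℝ Z u X) := by
  have hYi : ∀ i, HasFDerivAt (fun v ↦ Y v i) ((EuclideanSpace.proj i).comp (fderiv ℝ Y u)) u :=
    fun i ↦ (EuclideanSpace.proj i : EuclideanSpace ℝ (Fin n) →L[ℝ] ℝ).hasFDerivAt.comp u
      hY.hasFDerivAt
  have hZi : ∀ i, HasFDerivAt (fun v ↦ Z v i) ((EuclideanSpace.proj i).comp (fderiv ℝ Z u)) u :=
    fun i ↦ (EuclideanSpace.proj i : EuclideanSpace ℝ (Fin n) →L[ℝ] ℝ).hasFDerivAt.comp u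
      hZ.hasFDerivAt
  have := HasFDerivAt.fun_sum (u := Finset.univ) fun i _ ↦ HasFDerivAt.fun_sum (u := Finset.univ)
    fun j _ ↦ (((hG i j).hasFDerivAt.mul (hYi i)).mul (hZi j))
  simp only [bil_apply]
  erw [this.fderiv]
  have e1 : dbil G u X (Y u) (Z u)
      = ∑ i, ∑ j, fderiv ℝ (fun v ↦ G v i j) u X * Y u i * Z u j := by
    rw [dbil, Finset.sum_comm]
    refine Finset.sum_congr rfl fun i _ ↦ ?_
    rw [Finset.sum_comm]
    refine Finset.sum_congr rfl fun j _ ↦ ?_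
    rw [fderiv_apply_eq_sum, Finset.sum_mul, Finset.sum_mul]
    simp
  rw [e1]
  simp only [_root_.sum_apply, ← Finset.sum_add_distrib]
  refine Finset.sum_congr rfl fun i _ ↦ Finset.sum_congr rfl fun j _ ↦ ?_
  simp
  ring

open VectorField in
/-- The Koszul formula. -/
lemma koszul {G : EuclideanSpace ℝ (Fin n) → Matrix (Fin n) (Fin n) ℝ}
    {X Y Z : EuclideanSpace ℝ (Fin n) → EuclideanSpace ℝ (Fin n)}
    {u : EuclideanSpace ℝ (Fin n)} (hG : ∀ i j, DifferentiableAt ℝ (fun v ↦ G v i j) u)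
    (hs : ∀ v, (G v).IsSymm) (hd : (G u).det ≠ 0)
    (hX : DifferentiableAt ℝ X u) (hY : DifferentiableAt ℝ Y u) (hZ : DifferentiableAt ℝ Z u) :
    2 * bil (G u) (cov G X Y u) (Z u)
      = fderiv ℝ (fun v ↦ bil (G v) (Y v) (Z v)) u (X u)
      + fderiv ℝ (fun v ↦ bil (G v) (X v) (Z v)) u (Y u)
      - fderiv ℝ (fun v ↦ bil (G v) (X v) (Y v)) u (Z u)
      + bil (G u) (lieBracket ℝ X Y u) (Z u) - bil (G u) (lieBracket ℝ X Z u) (Y u)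
      - bil (G u) (lieBracket ℝ Y Z u) (X u) := by
  have e (a b) := bil_comm (hs u) a b
  rw [fderiv_bil hG hY hZ, fderiv_bil hG hX hZ, fderiv_bil hG hX hY, cov, map_add,
    LinearMap.add_apply, bil_chr (hs u) hd]
  simp only [lieBracket, map_sub, LinearMap.sub_apply]
  rw [e (Y u), e (X u) (fderiv ℝ Z u (Y u)), e (X u) (fderiv ℝ Y u (Z u))]
  ring

/-- The data of a local orthonormal frame near the point `u` of `ℝⁿ`. -/
structure IsLocalFrame (G : EuclideanSpace ℝ (Fin n) → Matrix (Fin n) (Fin n) ℝ)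
    (E : Fin n → EuclideanSpace ℝ (Fin n) → EuclideanSpace ℝ (Fin n))
    (u : EuclideanSpace ℝ (Fin n)) : Prop where
  symm : ∀ v, (G v).IsSymm
  eventually_metric : ∀ᶠ v in nhds u, ∀ i j, ContDiffAt ℝ ∞ (fun v ↦ G v i j) v
  eventually_frame : ∀ᶠ v in nhds u, ∀ a, ContDiffAt ℝ ∞ (E a) v
  orthonormal : ∀ᶠ v in nhds u, ∀ a b, bil (G v) (E a v) (E b v) = if a = b then 1 else 0

namespace IsLocalFrame

variable {G : EuclideanSpace ℝ (Fin n) → Matrix (Fin n) (Fin n) ℝ}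
    {E : Fin n → EuclideanSpace ℝ (Fin n) → EuclideanSpace ℝ (Fin n)}
    {u : EuclideanSpace ℝ (Fin n)}

lemma eventually (h : IsLocalFrame G E u) : ∀ᶠ v in nhds u, IsLocalFrame G E v := by
  filter_upwards [h.eventually_metric.eventually_nhds, h.eventually_frame.eventually_nhds,
    h.orthonormal.eventually_nhds] with v a b c using ⟨h.symm, a, b, c⟩

lemma metric (h : IsLocalFrame G E u) (i j : Fin n) : ContDiffAt ℝ ∞ (fun v ↦ G v i j) u :=
  h.eventually_metric.self_of_nhds i j

lemma frame (h : IsLocalFrame G E u) (a : Fin n) : ContDiffAt ℝ ∞ (E a) u :=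
  h.eventually_frame.self_of_nhds a

/-- The matrix whose columns are the frame vectors. -/
def mat (E : Fin n → EuclideanSpace ℝ (Fin n) → EuclideanSpace ℝ (Fin n))
    (u : EuclideanSpace ℝ (Fin n)) : Matrix (Fin n) (Fin n) ℝ :=
  Matrix.of fun i a ↦ E a u i

/-- Orthonormality in matrix form. The inverse metric, the determinant relation and the frame
expansion below are all read off from this identity. -/
lemma mat_mul (h : IsLocalFrame G E u) : (mat E u).transpose * G u * mat E u = 1 := by
  ext a b
  rw [Matrix.one_apply, ← h.orthonormal.self_of_nhds a b, bil_apply, Finset.sum_comm,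
    Matrix.mul_apply]
  refine Finset.sum_congr rfl fun j _ ↦ ?_
  rw [Matrix.mul_apply, Finset.sum_mul]
  exact Finset.sum_congr rfl fun i _ ↦ by
    simp only [mat, Matrix.transpose_apply, Matrix.of_apply]; ring

lemma mat_mul_transpose_mul (h : IsLocalFrame G E u) :
    mat E u * (mat E u).transpose * G u = 1 := by
  rw [Matrix.mul_assoc]; exact mul_eq_one_comm.1 h.mat_mul

lemma inv_eq (h : IsLocalFrame G E u) : (G u)⁻¹ = mat E u * (mat E u).transpose :=
  Matrix.inv_eq_left_inv h.mat_mul_transpose_mul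

lemma det_ne_zero (h : IsLocalFrame G E u) : (G u).det ≠ 0 := fun h0 ↦ by
  simpa [Matrix.det_mul, h0] using congrArg Matrix.det h.mat_mul

lemma det_mul_sq (h : IsLocalFrame G E u) : (G u).det * (mat E u).det ^ 2 = 1 := by
  have := congrArg Matrix.det h.mat_mul
  simp only [Matrix.det_mul, Matrix.det_transpose, Matrix.det_one] at this
  linarith

/-- This is the identity `E Eᵀ G = 1` applied to a vector, with `E` the frame matrix. -/
lemma eq_sum (h : IsLocalFrame G E u) (w : EuclideanSpace ℝ (Fin n)) :
    w = ∑ a, bil (G u) w (E a u) • E a u := by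
  ext i
  have h1 : w i = ∑ j, (mat E u * (mat E u).transpose * G u) i j * w j := by
    rw [h.mat_mul_transpose_mul]; simp [Matrix.one_apply]
  rw [h1]
  simp only [Matrix.mul_apply, Finset.sum_mul, bil_apply, WithLp.ofLp_sum, Finset.sum_apply,
    WithLp.ofLp_smul, Pi.smul_apply, smul_eq_mul, mat, Matrix.of_apply, Matrix.transpose_apply]
  rw [Finset.sum_comm, Finset.sum_congr rfl fun k _ ↦ Finset.sum_comm, Finset.sum_comm]
  refine Finset.sum_congr rfl fun a _ ↦ ?_
  rw [Finset.sum_comm]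
  refine Finset.sum_congr rfl fun j _ ↦ Finset.sum_congr rfl fun k _ ↦ ?_
  rw [(h.symm u).apply]; ring

open VectorField

/-- Inner products of frame fields are locally constant, so the three derivative terms of `koszul`
drop out. -/
lemma bil_cov (h : IsLocalFrame G E u) (a b c : Fin n) :
    bil (G u) (cov G (E a) (E b) u) (E c u)
      = (1 / 2) * (bil (G u) (lieBracket ℝ (E a) (E b) u) (E c u)
        - bil (G u) (lieBracket ℝ (E a) (E c) u) (E b u)
        - bil (G u) (lieBracket ℝ (E b) (E c) u) (E a u)) := by
  have hd (a) : DifferentiableAt ℝ (E a) u := (h.frame a).differentiableAt (by simp)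
  have h0 : ∀ a b, fderiv ℝ (fun v ↦ bil (G v) (E a v) (E b v)) u = 0 := fun a b ↦ by
    have : (fun v ↦ bil (G v) (E a v) (E b v)) =ᶠ[nhds u] fun _ ↦ if a = b then 1 else 0 := by
      filter_upwards [h.orthonormal] with v hv using hv a b
    rw [this.fderiv_eq]; simp
  have := koszul (fun i j ↦ (h.metric i j).differentiableAt (by simp)) h.symm h.det_ne_zero
    (hd a) (hd b) (hd c)
  simp only [h0, _root_.zero_apply] at this
  linarith

/-- When the differentiated field equals the direction, one bracket in `bil_cov` vanishes and the
other two coincide by antisymmetry, which absorbs the factor one half. -/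
lemma sum_cov (h : IsLocalFrame G E u) : ∑ a, cov G (E a) (E a) u
    = ∑ a, (∑ b, bil (G u) (lieBracket ℝ (E a) (E b) u) (E b u)) • E a u := by
  rw [Finset.sum_congr rfl fun a _ ↦ h.eq_sum (cov G (E a) (E a) u), Finset.sum_comm]
  refine Finset.sum_congr rfl fun c _ ↦ ?_
  rw [← Finset.sum_smul]
  congr 1
  refine Finset.sum_congr rfl fun b _ ↦ ?_
  rw [h.bil_cov, lieBracket_swap (V := E c)]
  simp
  ring

lemma sum_inv_mul (h : IsLocalFrame G E u) (B : Fin n → Fin n → ℝ) :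
    ∑ i, ∑ j, (G u)⁻¹ i j * B i j = ∑ a, ∑ i, ∑ j, E a u i * E a u j * B i j := by
  rw [h.inv_eq]
  simp only [Matrix.mul_apply, Finset.sum_mul, mat, Matrix.of_apply, Matrix.transpose_apply]
  rw [Finset.sum_congr rfl fun k _ ↦ Finset.sum_comm, Finset.sum_comm]

/-- The Laplacian in terms of an orthonormal frame. -/
lemma laplacian_eq (h : IsLocalFrame G E u) {f : EuclideanSpace ℝ (Fin n) → ℝ}
    (hf : ContDiffAt ℝ 2 f u) :
    ∑ i, ∑ j, (G u)⁻¹ i j *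
        (partialDeriv i (partialDeriv j f) u - ∑ k, chr G k i j u * partialDeriv k f u)
      = ∑ a, (fderiv ℝ (fun v ↦ fderiv ℝ f v (E a v)) u (E a u)
          - (∑ b, bil (G u) (lieBracket ℝ (E a) (E b) u) (E b u)) * fderiv ℝ f u (E a u)) := by
  -- The trace of the Hessian is `∑ (E_a (E_a f) - df (∇_{E_a} E_a))`; `sum_cov` rewrites the
  -- correction through brackets.
  have h2 : ∑ a, (∑ b, bil (G u) (lieBracket ℝ (E a) (E b) u) (E b u)) * fderiv ℝ f u (E a u)
      = fderiv ℝ f u (∑ a, cov G (E a) (E a) u) := by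
    rw [h.sum_cov, map_sum]
    simp
  rw [h.sum_inv_mul, Finset.sum_sub_distrib, h2, map_sum, ← Finset.sum_sub_distrib]
  refine Finset.sum_congr rfl fun a _ ↦ ?_
  rw [fderiv_fderiv_apply hf ((h.frame a).differentiableAt (by simp)), cov, map_add]
  have h3 : fderiv ℝ (fderiv ℝ f) u (E a u) (E a u)
      = ∑ i, ∑ j, E a u i * E a u j * partialDeriv i (partialDeriv j f) u := by
    rw [fderiv_apply_eq_sum, _root_.sum_apply]
    refine Finset.sum_congr rfl fun i _ ↦ ?_
    rw [_root_.smul_apply, smul_eq_mul]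
    simp_rw [mul_assoc, ← Finset.mul_sum]
    congr 1
    have h1 : DifferentiableAt ℝ (fderiv ℝ f) u :=
      (hf.fderiv_right (m := 1) (by norm_num)).differentiableAt (by norm_num)
    have h4 : ∀ j, partialDeriv i (partialDeriv j f) u
        = partialDeriv i (fderiv ℝ f) u (EuclideanSpace.single j 1) := fun j ↦ by
      change fderiv ℝ (fun v ↦ fderiv ℝ f v (EuclideanSpace.single j 1)) u _ = _
      rw [(h1.hasFDerivAt.clm_apply (hasFDerivAt_const _ _)).fderiv]
      simp [partialDeriv]
    simp_rw [h4]
    conv_lhs => rw [euclidean_eq_sum (E a u)]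
    simp
  have h5 : fderiv ℝ f u (WithLp.toLp 2 (fun k ↦ ∑ i, ∑ j, chr G k i j u * E a u i * E a u j))
      = ∑ i, ∑ j, E a u i * E a u j * ∑ k, chr G k i j u * partialDeriv k f u := by
    rw [fderiv_apply_eq_sum]
    simp only [smul_eq_mul, Finset.sum_mul, Finset.mul_sum]
    rw [Finset.sum_comm]
    refine Finset.sum_congr rfl fun i _ ↦ ?_
    rw [Finset.sum_comm]
    exact Finset.sum_congr rfl fun j _ ↦ Finset.sum_congr rfl fun k _ ↦ by ring
  rw [h3, h5]
  simp_rw [mul_sub, Finset.sum_sub_distrib]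
  ring

end IsLocalFrame

end Euclidean
end BiharmonicSubmersion
end

open scoped Manifold ContDiff
noncomputable section
namespace BiharmonicSubmersion

/-! ### Smooth sections along maps -/

section Sections

/-- Partial differentials of a smooth family of maps, applied to a smooth family of tangent
vectors, form a smooth family of tangent vectors. -/
lemma ContMDiffAt.mfderiv_section {EP HP P EM HM M EN HN N : Type*}
    [NormedAddCommGroup EP] [NormedSpace ℝ EP] [TopologicalSpace HP] [TopologicalSpace P]
    [ChartedSpace HP P] {J : ModelWithCorners ℝ EP HP}
    [NormedAddCommGroup EM] [NormedSpace ℝ EM] [TopologicalSpace HM] [TopologicalSpace M]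
    [ChartedSpace HM M] {I : ModelWithCorners ℝ EM HM} [IsManifold I ∞ M]
    [NormedAddCommGroup EN] [NormedSpace ℝ EN] [TopologicalSpace HN] [TopologicalSpace N]
    [ChartedSpace HN N] {I' : ModelWithCorners ℝ EN HN} [IsManifold I' ∞ N] [IsManifold J ∞ P]
    {f : P → M → N} {c : P → M} {v : (p : P) → TangentSpace I (c p)} {p₀ : P}
    (hf : ContMDiffAt (J.prod I) I' ∞ (Function.uncurry f) (p₀, c p₀))
    (hv : ContMDiffAt J I.tangent ∞ (fun p ↦ (⟨c p, v p⟩ : TangentBundle I M)) p₀) :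
    ContMDiffAt J I'.tangent ∞
      (fun p ↦ (⟨f p (c p), mfderiv I I' (f p) (c p) (v p)⟩ : TangentBundle I' N)) p₀ := by
  have hc : ContMDiffAt J I ∞ c p₀ := by
    rw [Bundle.contMDiffAt_totalSpace] at hv
    exact hv.1
  refine ContMDiffAt.clm_apply_of_inCoordinates (b₁ := c) (b₂ := fun p ↦ f p (c p))
    (ϕ := fun p ↦ mfderiv I I' (f p) (c p)) ?_ hv ?_
  · exact ContMDiffAt.mfderiv f c hf hc (by simp)
  · exact hf.comp p₀ (contMDiffAt_id.prodMk hc)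

lemma contMDiffAt_section_vectorSpace {EP HP P E : Type*}
    [NormedAddCommGroup EP] [NormedSpace ℝ EP] [TopologicalSpace HP] [TopologicalSpace P]
    [ChartedSpace HP P] {J : ModelWithCorners ℝ EP HP} [NormedAddCommGroup E] [NormedSpace ℝ E]
    {b : P → E} {v : P → E} {p₀ : P} :
    ContMDiffAt J (𝓘(ℝ, E)).tangent ∞ (fun p ↦ (⟨b p, v p⟩ : TangentBundle 𝓘(ℝ, E) E)) p₀ ↔
      ContMDiffAt J 𝓘(ℝ, E) ∞ b p₀ ∧ ContMDiffAt J 𝓘(ℝ, E) ∞ v p₀ := by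
  rw [Bundle.contMDiffAt_totalSpace]
  simp only [TangentBundle.trivializationAt_apply]
  refine and_congr Iff.rfl (iff_of_eq ?_)
  congr 1
  ext p
  simp [chartAt_self_eq]

end Sections

section Metric

variable {n : ℕ} {M : Type*} [TopologicalSpace M] [ChartedSpace (EuclideanSpace ℝ (Fin n)) M]
  [IsManifold (𝓡 n) ∞ M]

/-- The vector fields are taken along a map `b`, because the differential of a map and the velocity
of a variation are fields along maps and not on the manifold. -/
lemma SmoothMetric.contMDiffAt_inner (g : SmoothMetric n M) {EP HP P : Type*}
    [NormedAddCommGroup EP] [NormedSpace ℝ EP] [TopologicalSpace HP] [TopologicalSpace P]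
    [ChartedSpace HP P] {J : ModelWithCorners ℝ EP HP} {b : P → M}
    {v w : (p : P) → TangentSpace (𝓡 n) (b p)} {p₀ : P}
    (hv : ContMDiffAt J (𝓡 n).tangent ∞ (fun p ↦ (⟨b p, v p⟩ : TangentBundle (𝓡 n) M)) p₀)
    (hw : ContMDiffAt J (𝓡 n).tangent ∞ (fun p ↦ (⟨b p, w p⟩ : TangentBundle (𝓡 n) M)) p₀) :
    ContMDiffAt J 𝓘(ℝ, ℝ) ∞ (fun p ↦ g.inner (b p) (v p) (w p)) p₀ := by
  have hb : ContMDiffAt J (𝓡 n) ∞ b p₀ := by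
    rw [Bundle.contMDiffAt_totalSpace] at hv
    exact hv.1
  have : ContMDiffAt J ((𝓡 n).prod 𝓘(ℝ, ℝ)) ∞ (fun p ↦ Bundle.TotalSpace.mk' ℝ
      (E := Bundle.Trivial M ℝ) (b p) (g.inner (b p) (v p) (w p))) p₀ :=
    ContMDiffAt.clm_bundle_apply₂ (F₁ := EuclideanSpace ℝ (Fin n))
      (F₂ := EuclideanSpace ℝ (Fin n)) (g.contMDiff.contMDiffAt.comp p₀ hb) hv hw
  exact (Bundle.contMDiffAt_totalSpace.1 this).2

/-! ### Coordinate expressions -/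

variable {x₀ : M} {u : EuclideanSpace ℝ (Fin n)}

lemma contMDiffAt_extChartAt_symm (hu : u ∈ (extChartAt (𝓡 n) x₀).target) :
    ContMDiffAt 𝓘(ℝ, EuclideanSpace ℝ (Fin n)) (𝓡 n) ∞ (extChartAt (𝓡 n) x₀).symm u :=
  (contMDiffOn_extChartAt_symm x₀).contMDiffAt ((isOpen_extChartAt_target x₀).mem_nhds hu)

lemma isInvertible_mfderiv_extChartAt_symm (hu : u ∈ (extChartAt (𝓡 n) x₀).target) :
    (mfderiv 𝓘(ℝ, EuclideanSpace ℝ (Fin n)) (𝓡 n) (extChartAt (𝓡 n) x₀).symm u).IsInvertible := by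
  have := isInvertible_mfderivWithin_extChartAt_symm hu
  rwa [ModelWithCorners.range_eq_univ, mfderivWithin_univ] at this

/-- The expression of a vector field in the chart at `x₀`. -/
def rep (x₀ : M) (X : (p : M) → TangentSpace (𝓡 n) p) (u : EuclideanSpace ℝ (Fin n)) :
    EuclideanSpace ℝ (Fin n) :=
  VectorField.mpullback 𝓘(ℝ, EuclideanSpace ℝ (Fin n)) (𝓡 n) (extChartAt (𝓡 n) x₀).symm X u

lemma mfderiv_symm_rep (hu : u ∈ (extChartAt (𝓡 n) x₀).target)
    (X : (p : M) → TangentSpace (𝓡 n) p) :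
    mfderiv 𝓘(ℝ, EuclideanSpace ℝ (Fin n)) (𝓡 n) (extChartAt (𝓡 n) x₀).symm u (rep x₀ X u)
      = X ((extChartAt (𝓡 n) x₀).symm u) := by
  exact (isInvertible_mfderiv_extChartAt_symm hu).self_apply_inverse _

lemma mfderiv_symm_eq_sum (v : EuclideanSpace ℝ (Fin n)) :
    mfderiv 𝓘(ℝ, EuclideanSpace ℝ (Fin n)) (𝓡 n) (extChartAt (𝓡 n) x₀).symm u v
      = ∑ i, v i • coordVec n x₀ i u := by
  conv_lhs => rw [euclidean_eq_sum v]
  exact (map_sum (mfderiv 𝓘(ℝ, EuclideanSpace ℝ (Fin n)) (𝓡 n)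
    (extChartAt (𝓡 n) x₀).symm u) _ _).trans (Finset.sum_congr rfl fun i _ ↦ map_smul _ _ _)

lemma clm_sum_sum {F : Type*} [AddCommGroup F] [Module ℝ F] [TopologicalSpace F]
    [IsTopologicalAddGroup F] [ContinuousConstSMul ℝ F] {ι : Type*} [Fintype ι]
    (B : F →L[ℝ] F →L[ℝ] ℝ) (v w : ι → ℝ) (b : ι → F) :
    B (∑ i, v i • b i) (∑ j, w j • b j) = ∑ i, ∑ j, B (b i) (b j) * v i * w j := by
  simp only [map_sum, _root_.sum_apply, map_smul, _root_.smul_apply, smul_eq_mul]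
  rw [Finset.sum_comm]
  refine Finset.sum_congr rfl fun i _ ↦ ?_
  rw [Finset.mul_sum]
  exact Finset.sum_congr rfl fun j _ ↦ by ring

lemma inner_mfderiv_symm (g : SmoothMetric n M) (v w : EuclideanSpace ℝ (Fin n)) :
    g.inner ((extChartAt (𝓡 n) x₀).symm u)
      (mfderiv 𝓘(ℝ, EuclideanSpace ℝ (Fin n)) (𝓡 n) (extChartAt (𝓡 n) x₀).symm u v)
      (mfderiv 𝓘(ℝ, EuclideanSpace ℝ (Fin n)) (𝓡 n) (extChartAt (𝓡 n) x₀).symm u w)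
      = bil (gram g x₀ u) v w := by
  rw [mfderiv_symm_eq_sum, mfderiv_symm_eq_sum]
  exact clm_sum_sum _ _ _ _

lemma inner_eq_bil (g : SmoothMetric n M) (hu : u ∈ (extChartAt (𝓡 n) x₀).target)
    (X Y : (p : M) → TangentSpace (𝓡 n) p) :
    g.inner ((extChartAt (𝓡 n) x₀).symm u) (X ((extChartAt (𝓡 n) x₀).symm u))
      (Y ((extChartAt (𝓡 n) x₀).symm u)) = bil (gram g x₀ u) (rep x₀ X u) (rep x₀ Y u) := by
  rw [← inner_mfderiv_symm, mfderiv_symm_rep hu, mfderiv_symm_rep hu]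

lemma gram_isSymm (g : SmoothMetric n M) (x₀ : M) (u : EuclideanSpace ℝ (Fin n)) :
    (gram g x₀ u).IsSymm := by
  ext i j
  simp only [gram, Matrix.transpose_apply, Matrix.of_apply]
  exact g.symm _ _ _

lemma contDiffAt_gram (g : SmoothMetric n M) (hu : u ∈ (extChartAt (𝓡 n) x₀).target)
    (i j : Fin n) : ContDiffAt ℝ ∞ (fun v ↦ gram g x₀ v i j) u := by
  have h : ∀ i, ContMDiffAt 𝓘(ℝ, EuclideanSpace ℝ (Fin n)) (𝓡 n).tangent ∞
      (fun v ↦ (⟨(extChartAt (𝓡 n) x₀).symm v, coordVec n x₀ i v⟩ : TangentBundle (𝓡 n) M)) u :=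
    fun i ↦ ContMDiffAt.mfderiv_section (f := fun _ ↦ (extChartAt (𝓡 n) x₀).symm) (c := id)
      (v := fun _ ↦ (EuclideanSpace.single i (1 : ℝ) : EuclideanSpace ℝ (Fin n)))
      ((contMDiffAt_extChartAt_symm hu).comp (u, u) contMDiffAt_snd)
      (contMDiffAt_section_vectorSpace.2 ⟨contMDiffAt_id, contMDiffAt_const⟩)
  exact (g.contMDiffAt_inner (h i) (h j)).contDiffAt

lemma contDiffAt_rep {X : (p : M) → TangentSpace (𝓡 n) p}
    (hu : u ∈ (extChartAt (𝓡 n) x₀).target)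
    (hX : ContMDiffAt (𝓡 n) (𝓡 n).tangent ∞ (fun p ↦ (⟨p, X p⟩ : TangentBundle (𝓡 n) M))
      ((extChartAt (𝓡 n) x₀).symm u)) : ContDiffAt ℝ ∞ (rep x₀ X) u := by
  have := hX.mpullback_vectorField_preimage (contMDiffAt_extChartAt_symm hu)
    (isInvertible_mfderiv_extChartAt_symm hu) (by simp)
  exact (contMDiffAt_section_vectorSpace.1 this).2.contDiffAt

/-- Naturality of the bracket under pullback by the inverse chart. It reduces bracket computations
on the manifold to `ℝⁿ`. -/
lemma rep_mlieBracket {X Y : (p : M) → TangentSpace (𝓡 n) p}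
    (hu : u ∈ (extChartAt (𝓡 n) x₀).target)
    (hX : ContMDiffAt (𝓡 n) (𝓡 n).tangent ∞ (fun p ↦ (⟨p, X p⟩ : TangentBundle (𝓡 n) M))
      ((extChartAt (𝓡 n) x₀).symm u))
    (hY : ContMDiffAt (𝓡 n) (𝓡 n).tangent ∞ (fun p ↦ (⟨p, Y p⟩ : TangentBundle (𝓡 n) M))
      ((extChartAt (𝓡 n) x₀).symm u)) :
    rep x₀ (VectorField.mlieBracket (𝓡 n) X Y) u
      = VectorField.lieBracket ℝ (rep x₀ X) (rep x₀ Y) u := by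
  have : IsManifold (𝓡 n) (minSmoothness ℝ 2) M := by
    rw [minSmoothness_of_isRCLikeNormedField]; infer_instance
  have : IsManifold 𝓘(ℝ, EuclideanSpace ℝ (Fin n)) (minSmoothness ℝ 2)
      (EuclideanSpace ℝ (Fin n)) := inferInstance
  rw [rep, VectorField.mpullback_mlieBracket (n := ∞) (hX.mdifferentiableAt (by simp))
    (hY.mdifferentiableAt (by simp)) (contMDiffAt_extChartAt_symm hu)
    (by rw [minSmoothness_of_isRCLikeNormedField]; exact two_le_infty),
    ← VectorField.mlieBracketWithin_univ, VectorField.mlieBracketWithin_eq_lieBracketWithin]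
  exact congrFun VectorField.lieBracketWithin_univ u

lemma mfderiv_apply_eq_fderiv {F : Type*} [NormedAddCommGroup F] [NormedSpace ℝ F] {f : M → F}
    (X : (p : M) → TangentSpace (𝓡 n) p) (hu : u ∈ (extChartAt (𝓡 n) x₀).target)
    (hf : MDifferentiableAt (𝓡 n) 𝓘(ℝ, F) f ((extChartAt (𝓡 n) x₀).symm u)) :
    mfderiv (𝓡 n) 𝓘(ℝ, F) f ((extChartAt (𝓡 n) x₀).symm u) (X ((extChartAt (𝓡 n) x₀).symm u))
      = fderiv ℝ (fun v ↦ f ((extChartAt (𝓡 n) x₀).symm v)) u (rep x₀ X u) := by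
  have h1 := mfderiv_comp_apply u hf
    ((contMDiffAt_extChartAt_symm hu).mdifferentiableAt (by simp)) (rep x₀ X u)
  rw [mfderiv_symm_rep hu] at h1
  rw [← mfderiv_eq_fderiv]
  exact h1.symm

lemma dirDeriv_eq_fderiv {f : M → ℝ} (X : (p : M) → TangentSpace (𝓡 n) p)
    (hu : u ∈ (extChartAt (𝓡 n) x₀).target)
    (hf : MDifferentiableAt (𝓡 n) 𝓘(ℝ, ℝ) f ((extChartAt (𝓡 n) x₀).symm u)) :
    dirDeriv X f ((extChartAt (𝓡 n) x₀).symm u)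
      = fderiv ℝ (fun v ↦ f ((extChartAt (𝓡 n) x₀).symm v)) u (rep x₀ X u) :=
  mfderiv_apply_eq_fderiv X hu hf

/-- The bridge from manifolds to the Euclidean computations: chart target and domain of the frame
are open, so the frame conditions hold near `u` and not only at it. -/
lemma isLocalFrame_rep (g : SmoothMetric n M) {U : Set M} (hU : IsOpen U)
    {X : Fin n → (p : M) → TangentSpace (𝓡 n) p} (hX : IsOrthonormalOn g U X)
    (hu : u ∈ (extChartAt (𝓡 n) x₀).target) (huU : (extChartAt (𝓡 n) x₀).symm u ∈ U) :
    IsLocalFrame (gram g x₀) (fun a ↦ rep x₀ (X a)) u := by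
  have h1 : ∀ᶠ v in nhds u, v ∈ (extChartAt (𝓡 n) x₀).target :=
    (isOpen_extChartAt_target x₀).mem_nhds hu
  have h2 : ∀ᶠ v in nhds u, (extChartAt (𝓡 n) x₀).symm v ∈ U :=
    (contMDiffAt_extChartAt_symm hu).continuousAt (hU.mem_nhds huU)
  refine ⟨gram_isSymm g x₀, ?_, ?_, ?_⟩
  · filter_upwards [h1] with v hv i j using contDiffAt_gram g hv i j
  · filter_upwards [h1, h2] with v hv hvU a using
      contDiffAt_rep hv ((hX.smooth a).contMDiffAt (hU.mem_nhds hvU))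
  · filter_upwards [h1, h2] with v hv hvU a b
    rw [← inner_eq_bil g hv, hX.orthonormal _ hvU]

end Metric

end BiharmonicSubmersion
end

open scoped Manifold ContDiff
noncomputable section
namespace BiharmonicSubmersion

/-! ### The tension field in terms of orthonormal frames -/

section TensionEuclidean

variable {m n : ℕ}

/-- The bilinear map given by the Christoffel symbols. -/
def gam (H : EuclideanSpace ℝ (Fin n) → Matrix (Fin n) (Fin n) ℝ) (u : EuclideanSpace ℝ (Fin n)) :
    EuclideanSpace ℝ (Fin n) →ₗ[ℝ] EuclideanSpace ℝ (Fin n) →ₗ[ℝ] EuclideanSpace ℝ (Fin n) :=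
  LinearMap.mk₂ ℝ (fun X Y ↦ WithLp.toLp 2 (fun k ↦ ∑ i, ∑ j, chr H k i j u * X i * Y j))
    (fun X X' Y ↦ by ext k; simp [← Finset.sum_add_distrib, mul_add, add_mul])
    (fun c X Y ↦ by ext k; simp [Finset.mul_sum, mul_assoc, mul_left_comm])
    (fun X Y Y' ↦ by ext k; simp [← Finset.sum_add_distrib, mul_add])
    (fun c X Y ↦ by ext k; simp [Finset.mul_sum, mul_left_comm])

lemma cov_eq (H : EuclideanSpace ℝ (Fin n) → Matrix (Fin n) (Fin n) ℝ)
    (X Y : EuclideanSpace ℝ (Fin n) → EuclideanSpace ℝ (Fin n)) (u : EuclideanSpace ℝ (Fin n)) :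
    cov H X Y u = fderiv ℝ Y u (X u) + gam H u (X u) (Y u) := rfl

variable {G : EuclideanSpace ℝ (Fin m) → Matrix (Fin m) (Fin m) ℝ}
    {E : Fin m → EuclideanSpace ℝ (Fin m) → EuclideanSpace ℝ (Fin m)}
    {H : EuclideanSpace ℝ (Fin n) → Matrix (Fin n) (Fin n) ℝ}
    {ε : Fin n → EuclideanSpace ℝ (Fin n) → EuclideanSpace ℝ (Fin n)}
    {u : EuclideanSpace ℝ (Fin m)} {φ : EuclideanSpace ℝ (Fin m) → EuclideanSpace ℝ (Fin n)}

/-- Along `φ` one has `dφ(Eᵢ) = ∑ A a • ε a`. Differentiating this sum along `Eᵢ` gives the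
derivatives of the coefficients, and the chain rule produces derivatives of `ε a` along `dφ(Eᵢ)`,
which the Christoffel term `gam` completes to covariant derivatives. -/
lemma fderiv_comp_apply_frame (hε : IsLocalFrame H ε (φ u))
    (hφ : ContDiffAt ℝ ∞ φ u) {A : Fin n → EuclideanSpace ℝ (Fin m) → ℝ} (i : Fin m)
    (hA : ∀ a, ContDiffAt ℝ ∞ (A a) u)
    (hAφ : ∀ᶠ v in nhds u, ∀ a, A a v = bil (H (φ v)) (fderiv ℝ φ v (E i v)) (ε a (φ v))) :
    fderiv ℝ (fun v ↦ fderiv ℝ φ v (E i v)) u (E i u)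
        + gam H (φ u) (fderiv ℝ φ u (E i u)) (fderiv ℝ φ u (E i u))
      = ∑ a, fderiv ℝ (A a) u (E i u) • ε a (φ u)
        + ∑ b, ∑ a, (A b u * A a u) • cov H (ε b) (ε a) (φ u) := by
  have h1 : (fun v ↦ fderiv ℝ φ v (E i v)) =ᶠ[nhds u] fun v ↦ ∑ a, A a v • ε a (φ v) := by
    filter_upwards [hAφ, hφ.continuousAt.eventually hε.eventually] with v hv hv'
    simp_rw [hv]
    exact hv'.eq_sum _
  have hφ' : HasFDerivAt φ (fderiv ℝ φ u) u := (hφ.differentiableAt (by simp)).hasFDerivAt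
  have h2 := HasFDerivAt.fun_sum (u := Finset.univ) fun a _ ↦
    (((hA a).differentiableAt (by simp)).hasFDerivAt.smul
      ((((hε.frame a).differentiableAt (by simp)).hasFDerivAt.comp u hφ')))
  have h3 := h1.self_of_nhds
  rw [h1.fderiv_eq]
  erw [h2.fderiv]
  simp only [_root_.sum_apply, _root_.add_apply, _root_.smul_apply,
    ContinuousLinearMap.comp_apply, ContinuousLinearMap.smulRight_apply, Finset.sum_add_distrib,
    Function.comp_apply]
  simp only at h3
  have k1 : ∀ a, A a u • fderiv ℝ (ε a) (φ u) (fderiv ℝ φ u (E i u))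
      = ∑ b, (A b u * A a u) • fderiv ℝ (ε a) (φ u) (ε b (φ u)) := fun a ↦ by
    rw [h3, map_sum, Finset.smul_sum]
    exact Finset.sum_congr rfl fun b _ ↦ by rw [map_smul, smul_smul, mul_comm]
  have k2 : gam H (φ u) (fderiv ℝ φ u (E i u)) (fderiv ℝ φ u (E i u))
      = ∑ b, ∑ a, (A b u * A a u) • gam H (φ u) (ε b (φ u)) (ε a (φ u)) := by
    rw [h3]
    simp only [map_sum, map_smul, LinearMap.sum_apply, LinearMap.smul_apply, Finset.smul_sum,
      smul_smul]
    rw [Finset.sum_comm]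
    exact Finset.sum_congr rfl fun b _ ↦ Finset.sum_congr rfl fun a _ ↦ by rw [mul_comm]
  simp only [cov_eq, smul_add, Finset.sum_add_distrib, k1, k2]
  rw [Finset.sum_comm]
  abel

/-- The components of the tension field in coordinates, in terms of orthonormal frames of the source
and the target. -/
lemma tension_components (hE : IsLocalFrame G E u) (hε : IsLocalFrame H ε (φ u))
    (hφ : ContDiffAt ℝ ∞ φ u) {A : Fin m → Fin n → EuclideanSpace ℝ (Fin m) → ℝ}
    (hA : ∀ i a, ContDiffAt ℝ ∞ (A i a) u)
    (hAφ : ∀ᶠ v in nhds u, ∀ i a, A i a v = bil (H (φ v)) (fderiv ℝ φ v (E i v)) (ε a (φ v))) :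
    (WithLp.toLp 2 fun c ↦ ∑ i, ∑ j, (G u)⁻¹ i j * ((partialDeriv i (partialDeriv j φ) u) c
      - ∑ k, chr G k i j u * (partialDeriv k φ u) c
      + ∑ a, ∑ b, chr H c a b (φ u) * (partialDeriv i φ u) a * (partialDeriv j φ u) b))
    = ∑ a, (∑ i, (fderiv ℝ (A i a) u (E i u)
        - (∑ b, bil (G u) (VectorField.lieBracket ℝ (E i) (E b) u) (E b u)) * A i a u
        + ∑ b, ∑ d, A i b u * A i d u * bil (H (φ u)) (cov H (ε b) (ε d) (φ u)) (ε a (φ u))))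
        • ε a (φ u) := by
  have hRHS : ∑ a, (∑ i, (fderiv ℝ (A i a) u (E i u)
        - (∑ b, bil (G u) (VectorField.lieBracket ℝ (E i) (E b) u) (E b u)) * A i a u
        + ∑ b, ∑ d, A i b u * A i d u * bil (H (φ u)) (cov H (ε b) (ε d) (φ u)) (ε a (φ u))))
        • ε a (φ u)
      = ∑ i, (fderiv ℝ (fun v ↦ fderiv ℝ φ v (E i v)) u (E i u)
        + gam H (φ u) (fderiv ℝ φ u (E i u)) (fderiv ℝ φ u (E i u))
        - (∑ b, bil (G u) (VectorField.lieBracket ℝ (E i) (E b) u) (E b u)) •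
            fderiv ℝ φ u (E i u)) := by
    rw [Finset.sum_congr rfl fun a _ ↦ Finset.sum_smul, Finset.sum_comm]
    refine Finset.sum_congr rfl fun i _ ↦ ?_
    rw [fderiv_comp_apply_frame hε hφ i (hA i) (hAφ.mono fun v hv ↦ hv i)]
    have h3 : fderiv ℝ φ u (E i u) = ∑ a, A i a u • ε a (φ u) := by
      simp_rw [hAφ.self_of_nhds]
      exact hε.eq_sum _
    have h4 : ∀ b d, cov H (ε b) (ε d) (φ u)
      = ∑ a, bil (H (φ u)) (cov H (ε b) (ε d) (φ u)) (ε a (φ u)) • ε a (φ u) := fun b d ↦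
      hε.eq_sum _
    have h5 : ∑ b, ∑ d, (A i b u * A i d u) • cov H (ε b) (ε d) (φ u)
        = ∑ a, (∑ b, ∑ d, A i b u * A i d u *
          bil (H (φ u)) (cov H (ε b) (ε d) (φ u)) (ε a (φ u))) • ε a (φ u) := by
      have e : ∀ b d, (A i b u * A i d u) • cov H (ε b) (ε d) (φ u)
          = ∑ a, (A i b u * A i d u *
            bil (H (φ u)) (cov H (ε b) (ε d) (φ u)) (ε a (φ u))) • ε a (φ u) := fun b d ↦ by
        conv_lhs => rw [h4 b d, Finset.smul_sum]
        simp_rw [smul_smul]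
      simp_rw [e, Finset.sum_smul]
      rw [Finset.sum_congr rfl fun b _ ↦ Finset.sum_comm, Finset.sum_comm]
    have h6 : ∀ c : ℝ, c • fderiv ℝ φ u (E i u) = ∑ a, (c * A i a u) • ε a (φ u) := fun c ↦ by
      rw [h3, Finset.smul_sum]; simp_rw [smul_smul]
    rw [h5, h6, ← Finset.sum_add_distrib, ← Finset.sum_sub_distrib]
    refine Finset.sum_congr rfl fun a _ ↦ ?_
    rw [add_smul, sub_smul]
    abel
  rw [hRHS]
  ext c
  have hc : ContDiffAt ℝ ∞ (fun v ↦ φ v c) u :=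
    (EuclideanSpace.proj c : EuclideanSpace ℝ (Fin n) →L[ℝ] ℝ).contDiff.contDiffAt.comp u hφ
  have hcd : ∀ᶠ v in nhds u, ∀ w, fderiv ℝ (fun v ↦ φ v c) v w = fderiv ℝ φ v w c := by
    have : ∀ᶠ v in nhds u, DifferentiableAt ℝ φ v :=
      ((hφ.of_le (by norm_num : (1 : WithTop ℕ∞) ≤ ∞)).eventually (by simp)).mono fun v hv ↦
        hv.differentiableAt (by simp)
    filter_upwards [this] with v hv w
    have := ((EuclideanSpace.proj c : EuclideanSpace ℝ (Fin n) →L[ℝ] ℝ).hasFDerivAt.comp v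
      hv.hasFDerivAt)
    erw [this.fderiv]
    rfl
  -- The second-order part of a tension component is the Laplacian of the scalar function `φ c`, so
  -- `laplacian_eq` applies. The term quadratic in `dφ` is traced separately in `hgam`.
  have hlap := hE.laplacian_eq (hc.of_le two_le_infty)
  have hφd : ∀ᶠ v in nhds u, ContDiffAt ℝ 2 φ v :=
    (hφ.of_le two_le_infty).eventually (by simp)
  have hp : ∀ j, partialDeriv j (fun v ↦ φ v c) =ᶠ[nhds u] fun v ↦ partialDeriv j φ v c :=
    fun j ↦ hcd.mono fun v hv ↦ hv _
  have hproj : ∀ (f : EuclideanSpace ℝ (Fin m) → EuclideanSpace ℝ (Fin n)) w,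
      DifferentiableAt ℝ f u → fderiv ℝ (fun v ↦ f v c) u w = fderiv ℝ f u w c := fun f w hf ↦ by
    have := ((EuclideanSpace.proj c : EuclideanSpace ℝ (Fin n) →L[ℝ] ℝ).hasFDerivAt.comp u
      hf.hasFDerivAt)
    erw [this.fderiv]
    rfl
  have hD : DifferentiableAt ℝ (fderiv ℝ φ) u :=
    ((hφ.of_le two_le_infty).fderiv_right (m := 1) (by norm_num)).differentiableAt (by norm_num)
  have hpp : ∀ i j, partialDeriv i (partialDeriv j fun v ↦ φ v c) u
      = partialDeriv i (partialDeriv j φ) u c := fun i j ↦ by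
    rw [partialDeriv, (hp j).fderiv_eq]
    exact hproj _ _ (hD.clm_apply (differentiableAt_const _))
  have hpE : ∀ i, fderiv ℝ (fun v ↦ fderiv ℝ (fun v ↦ φ v c) v (E i v)) u (E i u)
      = fderiv ℝ (fun v ↦ fderiv ℝ φ v (E i v)) u (E i u) c := fun i ↦ by
    have : (fun v ↦ fderiv ℝ (fun v ↦ φ v c) v (E i v)) =ᶠ[nhds u]
      fun v ↦ fderiv ℝ φ v (E i v) c := hcd.mono fun v hv ↦ hv _
    rw [this.fderiv_eq, hproj _ _ (hD.clm_apply ((hE.frame i).differentiableAt (by simp)))]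
  have hgam : ∑ i, ∑ j, (G u)⁻¹ i j *
      (∑ a, ∑ b, chr H c a b (φ u) * (partialDeriv i φ u) a * (partialDeriv j φ u) b)
      = ∑ i, gam H (φ u) (fderiv ℝ φ u (E i u)) (fderiv ℝ φ u (E i u)) c := by
    rw [hE.sum_inv_mul]
    refine Finset.sum_congr rfl fun a _ ↦ ?_
    conv_rhs => rw [fderiv_apply_eq_sum]
    simp only [map_sum, map_smul, LinearMap.sum_apply, LinearMap.smul_apply, Finset.smul_sum,
      smul_smul, WithLp.ofLp_sum, Finset.sum_apply, WithLp.ofLp_smul, Pi.smul_apply, smul_eq_mul]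
    rw [Finset.sum_comm]
    refine Finset.sum_congr rfl fun i _ ↦ Finset.sum_congr rfl fun j _ ↦ ?_
    rw [mul_comm (E a u j)]
    rfl
  simp_rw [hpp, hpE] at hlap
  simp only [WithLp.ofLp_sum, Finset.sum_apply, WithLp.ofLp_sub, WithLp.ofLp_add, Pi.add_apply,
    Pi.sub_apply, WithLp.ofLp_smul, Pi.smul_apply, smul_eq_mul, mul_add,
    Finset.sum_add_distrib, Finset.sum_sub_distrib]
  simp only [partialDeriv, hcd.self_of_nhds, Finset.sum_sub_distrib] at hlap hgam ⊢
  erw [hlap, hgam]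
  ring

end TensionEuclidean
end BiharmonicSubmersion
end

open scoped Manifold ContDiff
noncomputable section
namespace BiharmonicSubmersion

/-! ### Transfer of the frame formulas for tension field and Laplacian to manifolds. -/

section Frames

variable {m n : ℕ} {M N : Type*}
  [TopologicalSpace M] [ChartedSpace (EuclideanSpace ℝ (Fin m)) M] [IsManifold (𝓡 m) ∞ M]
  [TopologicalSpace N] [ChartedSpace (EuclideanSpace ℝ (Fin n)) N] [IsManifold (𝓡 n) ∞ N]

/-- The coefficient `⟨dφ(X), Y⟩` of the differential of a map. -/
def frameDiff (h : SmoothMetric n N) (φ : M → N) (X : (p : M) → TangentSpace (𝓡 m) p)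
    (Y : (y : N) → TangentSpace (𝓡 n) y) (x : M) : ℝ :=
  h.inner (φ x) (mfderiv (𝓡 m) (𝓡 n) φ x (X x)) (Y (φ x))

/-- The component of `∑ⱼ ∇_{eⱼ} eⱼ` on `eᵢ`. -/
def frameDiv (g : SmoothMetric m M) (e : Fin m → (p : M) → TangentSpace (𝓡 m) p) (i : Fin m)
    (x : M) : ℝ :=
  ∑ j, g.inner x (VectorField.mlieBracket (𝓡 m) (e i) (e j) x) (e j x)

/-- The coefficient `⟨∇_{ε_b} ε_d, ε_a⟩` of the Levi-Civita connection in an orthonormal frame. -/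
def connCoeff (h : SmoothMetric n N) (ε : Fin n → (p : N) → TangentSpace (𝓡 n) p) (b d a : Fin n)
    (y : N) : ℝ :=
  (1 / 2) * (h.inner y (VectorField.mlieBracket (𝓡 n) (ε b) (ε d) y) (ε a y)
    - h.inner y (VectorField.mlieBracket (𝓡 n) (ε b) (ε a) y) (ε d y)
    - h.inner y (VectorField.mlieBracket (𝓡 n) (ε d) (ε a) y) (ε b y))

/-- The parameter space `P` is arbitrary so that one argument covers a single map and the joint
smoothness of a variation in time and point. -/
lemma contMDiffAt_frameDiff_family {EP HP P : Type*}
    [NormedAddCommGroup EP] [NormedSpace ℝ EP] [TopologicalSpace HP] [TopologicalSpace P]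
    [ChartedSpace HP P] {J : ModelWithCorners ℝ EP HP} [IsManifold J ∞ P] (h : SmoothMetric n N)
    {f : P → M → N} {c : P → M} {p₀ : P}
    {X : (p : M) → TangentSpace (𝓡 m) p} {Y : (y : N) → TangentSpace (𝓡 n) y}
    (hf : ContMDiffAt (J.prod (𝓡 m)) (𝓡 n) ∞ (Function.uncurry f) (p₀, c p₀))
    (hc : ContMDiffAt J (𝓡 m) ∞ c p₀)
    (hX : ContMDiffAt (𝓡 m) (𝓡 m).tangent ∞ (fun p ↦ (⟨p, X p⟩ : TangentBundle (𝓡 m) M)) (c p₀))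
    (hY : ContMDiffAt (𝓡 n) (𝓡 n).tangent ∞ (fun y ↦ (⟨y, Y y⟩ : TangentBundle (𝓡 n) N))
      (f p₀ (c p₀))) :
    ContMDiffAt J 𝓘(ℝ, ℝ) ∞ (fun p ↦ frameDiff h (f p) X Y (c p)) p₀ := by
  refine h.contMDiffAt_inner (b := fun p ↦ f p (c p)) ?_ ?_
  · exact ContMDiffAt.mfderiv_section hf (hX.comp p₀ hc)
  · exact hY.comp p₀ (hf.comp p₀ (contMDiffAt_id.prodMk hc))

lemma contMDiffAt_dirDeriv_family {EP HP P : Type*}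
    [NormedAddCommGroup EP] [NormedSpace ℝ EP] [TopologicalSpace HP] [TopologicalSpace P]
    [ChartedSpace HP P] {J : ModelWithCorners ℝ EP HP} [IsManifold J ∞ P]
    {f : P → M → ℝ} {c : P → M} {p₀ : P} {X : (p : M) → TangentSpace (𝓡 m) p}
    (hf : ContMDiffAt (J.prod (𝓡 m)) 𝓘(ℝ, ℝ) ∞ (Function.uncurry f) (p₀, c p₀))
    (hc : ContMDiffAt J (𝓡 m) ∞ c p₀)
    (hX : ContMDiffAt (𝓡 m) (𝓡 m).tangent ∞ (fun p ↦ (⟨p, X p⟩ : TangentBundle (𝓡 m) M)) (c p₀)) :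
    ContMDiffAt J 𝓘(ℝ, ℝ) ∞ (fun p ↦ dirDeriv X (f p) (c p)) p₀ :=
  (contMDiffAt_section_vectorSpace.1 (ContMDiffAt.mfderiv_section hf (hX.comp p₀ hc))).2

lemma contMDiffAt_frameDiff (h : SmoothMetric n N) {φ : M → N} {x : M}
    {X : (p : M) → TangentSpace (𝓡 m) p} {Y : (y : N) → TangentSpace (𝓡 n) y}
    (hφ : ContMDiffAt (𝓡 m) (𝓡 n) ∞ φ x)
    (hX : ContMDiffAt (𝓡 m) (𝓡 m).tangent ∞ (fun p ↦ (⟨p, X p⟩ : TangentBundle (𝓡 m) M)) x)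
    (hY : ContMDiffAt (𝓡 n) (𝓡 n).tangent ∞ (fun y ↦ (⟨y, Y y⟩ : TangentBundle (𝓡 n) N))
      (φ x)) :
    ContMDiffAt (𝓡 m) 𝓘(ℝ, ℝ) ∞ (frameDiff h φ X Y) x :=
  contMDiffAt_frameDiff_family h (f := fun _ ↦ φ) (c := id)
    (hφ.comp (x, x) contMDiffAt_snd) contMDiffAt_id hX hY

lemma contMDiffAt_dirDeriv {f : M → ℝ} {x : M} {X : (p : M) → TangentSpace (𝓡 m) p}
    (hf : ContMDiffAt (𝓡 m) 𝓘(ℝ, ℝ) ∞ f x)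
    (hX : ContMDiffAt (𝓡 m) (𝓡 m).tangent ∞ (fun p ↦ (⟨p, X p⟩ : TangentBundle (𝓡 m) M)) x) :
    ContMDiffAt (𝓡 m) 𝓘(ℝ, ℝ) ∞ (dirDeriv X f) x :=
  contMDiffAt_dirDeriv_family (f := fun _ ↦ f) (c := id)
    (hf.comp (x, x) contMDiffAt_snd) contMDiffAt_id hX

lemma contMDiffAt_mlieBracket {x : M} {X Y : (p : M) → TangentSpace (𝓡 m) p}
    (hX : ContMDiffAt (𝓡 m) (𝓡 m).tangent ∞ (fun p ↦ (⟨p, X p⟩ : TangentBundle (𝓡 m) M)) x)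
    (hY : ContMDiffAt (𝓡 m) (𝓡 m).tangent ∞ (fun p ↦ (⟨p, Y p⟩ : TangentBundle (𝓡 m) M)) x) :
    ContMDiffAt (𝓡 m) (𝓡 m).tangent ∞
      (fun p ↦ (⟨p, VectorField.mlieBracket (𝓡 m) X Y p⟩ : TangentBundle (𝓡 m) M)) x := by
  have : IsManifold (𝓡 m) ((⊤ : ℕ∞) + 1 : WithTop ℕ∞) M := by
    have : ((⊤ : ℕ∞) + 1 : WithTop ℕ∞) = ∞ := rfl
    rw [this]; infer_instance
  have : IsManifold (𝓡 m) (minSmoothness ℝ 2) M := by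
    rw [minSmoothness_of_isRCLikeNormedField]; infer_instance
  have : IsManifold (𝓡 m) (minSmoothness ℝ 3) M := by
    rw [minSmoothness_of_isRCLikeNormedField]; infer_instance
  exact ContMDiffAt.mlieBracket_vectorField (n := ⊤) (m := ⊤) hX hY
    (by rw [minSmoothness_of_isRCLikeNormedField]; simp)

/-- The chart is based at any `y₀` whose domain contains `φ p`, so that it can stay fixed while `p`
moves. The source is arbitrary because the formula is applied both to maps `M → N` and to the curves
`t ↦ Φ t x`. -/
lemma inner_mfderiv_eq_bil (h : SmoothMetric n N) {EP HP P : Type*}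
    [NormedAddCommGroup EP] [NormedSpace ℝ EP] [TopologicalSpace HP] [TopologicalSpace P]
    [ChartedSpace HP P] {J : ModelWithCorners ℝ EP HP} {φ : P → N} {p : P} (w : TangentSpace J p)
    (y₀ : N) (Y : (y : N) → TangentSpace (𝓡 n) y) (hφ : MDifferentiableAt J (𝓡 n) φ p)
    (hp : φ p ∈ (extChartAt (𝓡 n) y₀).source) :
    h.inner (φ p) (mfderiv J (𝓡 n) φ p w) (Y (φ p))
      = bil (gram h y₀ (extChartAt (𝓡 n) y₀ (φ p)))
        (mfderiv J 𝓘(ℝ, EuclideanSpace ℝ (Fin n)) (fun q ↦ extChartAt (𝓡 n) y₀ (φ q)) p w)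
        (rep y₀ Y (extChartAt (𝓡 n) y₀ (φ p))) := by
  have h1 : mfderiv J 𝓘(ℝ, EuclideanSpace ℝ (Fin n)) (fun q ↦ extChartAt (𝓡 n) y₀ (φ q)) p w
      = mfderiv (𝓡 n) 𝓘(ℝ, EuclideanSpace ℝ (Fin n)) (extChartAt (𝓡 n) y₀) (φ p)
        (mfderiv J (𝓡 n) φ p w) :=
    mfderiv_comp_apply p (mdifferentiableAt_extChartAt (by rwa [extChartAt_source] at hp)) hφ w
  have h2 : mfderiv 𝓘(ℝ, EuclideanSpace ℝ (Fin n)) (𝓡 n) (extChartAt (𝓡 n) y₀).symm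
      (extChartAt (𝓡 n) y₀ (φ p)) (mfderiv (𝓡 n) 𝓘(ℝ, EuclideanSpace ℝ (Fin n))
        (extChartAt (𝓡 n) y₀) (φ p) (mfderiv J (𝓡 n) φ p w)) = mfderiv J (𝓡 n) φ p w := by
    have := mfderivWithin_extChartAt_symm_comp_mfderiv_extChartAt' hp
    rw [ModelWithCorners.range_eq_univ, mfderivWithin_univ] at this
    exact congrArg (fun L ↦ L (mfderiv J (𝓡 n) φ p w)) this
  have h3 := inner_mfderiv_symm (x₀ := y₀) (u := extChartAt (𝓡 n) y₀ (φ p)) h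
    (mfderiv (𝓡 n) 𝓘(ℝ, EuclideanSpace ℝ (Fin n)) (extChartAt (𝓡 n) y₀) (φ p)
        (mfderiv J (𝓡 n) φ p w)) (rep y₀ Y (extChartAt (𝓡 n) y₀ (φ p)))
  rw [mfderiv_symm_rep ((extChartAt (𝓡 n) y₀).map_source hp)] at h3
  erw [h2] at h3
  have h4 : ∀ q, q = φ p → ∀ z : EuclideanSpace ℝ (Fin n),
      h.inner (φ p) z (Y (φ p)) = h.inner q z (Y q) := by
    rintro _ rfl z; rfl
  refine (h4 _ ((extChartAt (𝓡 n) y₀).left_inv hp) _).trans (h3.trans ?_)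
  rw [h1]

lemma frameDiff_eq_bil (h : SmoothMetric n N) {φ : M → N} {x₀ : M} {y₀ : N}
    {u : EuclideanSpace ℝ (Fin m)} (hu : u ∈ (extChartAt (𝓡 m) x₀).target)
    (X : (p : M) → TangentSpace (𝓡 m) p) (Y : (y : N) → TangentSpace (𝓡 n) y)
    (hφ : MDifferentiableAt (𝓡 m) (𝓡 n) φ ((extChartAt (𝓡 m) x₀).symm u))
    (hp : φ ((extChartAt (𝓡 m) x₀).symm u) ∈ (extChartAt (𝓡 n) y₀).source) :
    frameDiff h φ X Y ((extChartAt (𝓡 m) x₀).symm u)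
      = bil (gram h y₀ (extChartAt (𝓡 n) y₀ (φ ((extChartAt (𝓡 m) x₀).symm u))))
        (fderiv ℝ (fun v ↦ extChartAt (𝓡 n) y₀ (φ ((extChartAt (𝓡 m) x₀).symm v))) u (rep x₀ X u))
        (rep y₀ Y (extChartAt (𝓡 n) y₀ (φ ((extChartAt (𝓡 m) x₀).symm u)))) := by
  have h1 : MDifferentiableAt (𝓡 m) 𝓘(ℝ, EuclideanSpace ℝ (Fin n))
      (fun q ↦ extChartAt (𝓡 n) y₀ (φ q)) ((extChartAt (𝓡 m) x₀).symm u) :=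
    (mdifferentiableAt_extChartAt (by rwa [extChartAt_source] at hp)).comp _ hφ
  rw [frameDiff, inner_mfderiv_eq_bil h _ y₀ Y hφ hp, ← mfderiv_apply_eq_fderiv X hu h1]

/-- The tangent space at `x` is identified with the model space through the preferred chart at `x`,
whose inverse therefore has identity differential at its centre. -/
lemma rep_self (x : M) (X : (p : M) → TangentSpace (𝓡 m) p) :
    rep x X (extChartAt (𝓡 m) x x) = X x := by
  have h1 := mfderiv_symm_rep (mem_extChartAt_target (I := 𝓡 m) x) X
  have h2 := mfderivWithin_range_extChartAt_symm (I := 𝓡 m) (x := x)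
  rw [ModelWithCorners.range_eq_univ, mfderivWithin_univ] at h2
  have h3 : rep x X (extChartAt (𝓡 m) x x)
      = X ((extChartAt (𝓡 m) x).symm (extChartAt (𝓡 m) x x)) := by
    rw [← h1, h2]; rfl
  rw [h3]
  congr 1
  exact extChartAt_to_inv x

lemma frameDiv_eq (g : SmoothMetric m M) {U : Set M} (hU : IsOpen U)
    {e : Fin m → (p : M) → TangentSpace (𝓡 m) p} (he : IsOrthonormalOn g U e) {x₀ : M}
    {u : EuclideanSpace ℝ (Fin m)} (hu : u ∈ (extChartAt (𝓡 m) x₀).target)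
    (huU : (extChartAt (𝓡 m) x₀).symm u ∈ U) (i : Fin m) :
    frameDiv g e i ((extChartAt (𝓡 m) x₀).symm u) = ∑ j, bil (gram g x₀ u)
      (VectorField.lieBracket ℝ (rep x₀ (e i)) (rep x₀ (e j)) u) (rep x₀ (e j) u) := by
  refine Finset.sum_congr rfl fun j _ ↦ ?_
  rw [inner_eq_bil g hu, rep_mlieBracket hu ((he.smooth i).contMDiffAt (hU.mem_nhds huU))
    ((he.smooth j).contMDiffAt (hU.mem_nhds huU))]

lemma connCoeff_eq (h : SmoothMetric n N) {V : Set N} (hV : IsOpen V)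
    {ε : Fin n → (p : N) → TangentSpace (𝓡 n) p} (hε : IsOrthonormalOn h V ε) {y₀ : N}
    {v : EuclideanSpace ℝ (Fin n)} (hv : v ∈ (extChartAt (𝓡 n) y₀).target)
    (hvV : (extChartAt (𝓡 n) y₀).symm v ∈ V) (b d a : Fin n) :
    connCoeff h ε b d a ((extChartAt (𝓡 n) y₀).symm v) = bil (gram h y₀ v)
      (cov (gram h y₀) (rep y₀ (ε b)) (rep y₀ (ε d)) v) (rep y₀ (ε a) v) := by
  rw [(isLocalFrame_rep h hV hε hv hvV).bil_cov b d a]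
  have hs i := (hε.smooth i).contMDiffAt (hV.mem_nhds hvV)
  simp only [connCoeff, inner_eq_bil h hv, rep_mlieBracket hv (hs _) (hs _)]

/-- The tension field in terms of orthonormal frames. -/
theorem tension_eq_frame (g : SmoothMetric m M) (h : SmoothMetric n N) {U : Set M} (hU : IsOpen U)
    {e : Fin m → (p : M) → TangentSpace (𝓡 m) p} (he : IsOrthonormalOn g U e) {V : Set N}
    (hV : IsOpen V) {ε : Fin n → (p : N) → TangentSpace (𝓡 n) p} (hε : IsOrthonormalOn h V ε)
    {φ : M → N} {x : M} (hx : x ∈ U) (hxV : φ x ∈ V)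
    (hφ : ∀ᶠ y in nhds x, ContMDiffAt (𝓡 m) (𝓡 n) ∞ φ y) :
    tension g h φ x = ∑ a, (∑ i, (dirDeriv (e i) (frameDiff h φ (e i) (ε a)) x
      - frameDiv g e i x * frameDiff h φ (e i) (ε a) x
      + ∑ b, ∑ d, frameDiff h φ (e i) (ε b) x * frameDiff h φ (e i) (ε d) x
        * connCoeff h ε b d a (φ x))) • ε a (φ x) := by
  set u := extChartAt (𝓡 m) x x with hu_def
  have hu : u ∈ (extChartAt (𝓡 m) x).target := mem_extChartAt_target x
  have hux : (extChartAt (𝓡 m) x).symm u = x := extChartAt_to_inv x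
  set φc : EuclideanSpace ℝ (Fin m) → EuclideanSpace ℝ (Fin n) :=
    fun v ↦ extChartAt (𝓡 n) (φ x) (φ ((extChartAt (𝓡 m) x).symm v)) with hφc
  have hφu : φc u = extChartAt (𝓡 n) (φ x) (φ x) := by rw [hφc]; simp only [hux]
  have hφt : φc u ∈ (extChartAt (𝓡 n) (φ x)).target := by
    rw [hφu]; exact mem_extChartAt_target _
  have hφx : (extChartAt (𝓡 n) (φ x)).symm (φc u) = φ x := by
    rw [hφu]; exact extChartAt_to_inv _
  have hE := isLocalFrame_rep g hU he hu (by rwa [hux])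
  have hF := isLocalFrame_rep h hV hε hφt (by rwa [hφx])
  have hs : ContMDiffAt 𝓘(ℝ, EuclideanSpace ℝ (Fin m)) (𝓡 m) ∞ (extChartAt (𝓡 m) x).symm u :=
    contMDiffAt_extChartAt_symm hu
  have hst : Filter.Tendsto (extChartAt (𝓡 m) x).symm (nhds u) (nhds x) := by
    have := hs.continuousAt
    rwa [ContinuousAt, hux] at this
  have hφ₀ := hφ.self_of_nhds
  have hφcs : ContDiffAt ℝ ∞ φc u := by
    refine ContMDiffAt.contDiffAt ?_
    refine ContMDiffAt.comp u (I' := 𝓡 n) (g := extChartAt (𝓡 n) (φ x))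
      (f := fun v ↦ φ ((extChartAt (𝓡 m) x).symm v)) ?_ ?_
    · simp only [hux]; exact contMDiffAt_extChartAt
    · refine ContMDiffAt.comp u (g := φ) ?_ hs
      rwa [hux]
  have hes i := (he.smooth i).contMDiffAt (hU.mem_nhds hx)
  have hεs a := (hε.smooth a).contMDiffAt (hV.mem_nhds hxV)
  have hAs : ∀ i a, ContMDiffAt (𝓡 m) 𝓘(ℝ, ℝ) ∞ (frameDiff h φ (e i) (ε a)) x := fun i a ↦
    contMDiffAt_frameDiff h hφ₀ (hes i) (hεs a)
  have key := tension_components hE hF hφcs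
    (A := fun i a v ↦ frameDiff h φ (e i) (ε a) ((extChartAt (𝓡 m) x).symm v)) ?_ ?_
  · refine Eq.trans ?_ (key.trans ?_)
    · simp only [tension]
      rfl
    · refine Finset.sum_congr rfl fun a _ ↦ ?_
      have hr := rep_self (φ x) (ε a)
      rw [← hφu] at hr
      refine congrArg₂ (· • ·) ?_ hr
      refine Finset.sum_congr rfl fun i _ ↦ ?_
      have h1 := dirDeriv_eq_fderiv (e i) hu (f := frameDiff h φ (e i) (ε a))
        (by rw [hux]; exact (hAs i a).mdifferentiableAt (by simp))
      have h2 := frameDiv_eq g hU he hu (by rwa [hux]) i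
      have h3 := fun b d ↦ connCoeff_eq h hV hε hφt (by rwa [hφx]) b d a
      rw [hux] at h1 h2
      simp only [hφx] at h3
      simp only [hux]
      rw [h1, h2]
      simp only [h3]
  · intro i a
    refine ContMDiffAt.contDiffAt (ContMDiffAt.comp u (g := frameDiff h φ (e i) (ε a)) ?_ hs)
    rw [hux]; exact hAs i a
  · have h1 : ∀ᶠ v in nhds u, v ∈ (extChartAt (𝓡 m) x).target :=
      (isOpen_extChartAt_target x).mem_nhds hu
    have h2 := hst.eventually hφ
    have h3 : ∀ᶠ y in nhds x, φ y ∈ (extChartAt (𝓡 n) (φ x)).source :=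
      hφ₀.continuousAt ((isOpen_extChartAt_source (φ x)).mem_nhds (mem_extChartAt_source _))
    have h3 := hst.eventually h3
    filter_upwards [h1, h2, h3] with v hv1 hv2 hv3 i a
    exact frameDiff_eq_bil h hv1 _ _ (hv2.mdifferentiableAt (by simp)) hv3

/-- The Laplace-Beltrami operator in terms of an orthonormal frame. -/
theorem laplacian_eq_frame (g : SmoothMetric m M) {U : Set M} (hU : IsOpen U)
    {e : Fin m → (p : M) → TangentSpace (𝓡 m) p} (he : IsOrthonormalOn g U e)
    {f : M → ℝ} {x : M} (hx : x ∈ U) (hf : ∀ᶠ y in nhds x, ContMDiffAt (𝓡 m) 𝓘(ℝ, ℝ) ∞ f y) :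
    laplacian g f x = ∑ i, (dirDeriv (e i) (dirDeriv (e i) f) x
      - frameDiv g e i x * dirDeriv (e i) f x) := by
  set u := extChartAt (𝓡 m) x x with hu_def
  have hu : u ∈ (extChartAt (𝓡 m) x).target := mem_extChartAt_target x
  have hux : (extChartAt (𝓡 m) x).symm u = x := extChartAt_to_inv x
  have hE := isLocalFrame_rep g hU he hu (by rwa [hux])
  have hs : ContMDiffAt 𝓘(ℝ, EuclideanSpace ℝ (Fin m)) (𝓡 m) ∞ (extChartAt (𝓡 m) x).symm u :=
    contMDiffAt_extChartAt_symm hu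
  have hst : Filter.Tendsto (extChartAt (𝓡 m) x).symm (nhds u) (nhds x) := by
    have := hs.continuousAt
    rwa [ContinuousAt, hux] at this
  have hf₀ := hf.self_of_nhds
  have hfc : ContDiffAt ℝ ∞ (fun v ↦ f ((extChartAt (𝓡 m) x).symm v)) u :=
    ContMDiffAt.contDiffAt (ContMDiffAt.comp u (g := f) (by rwa [hux]) hs)
  refine (hE.laplacian_eq (hfc.of_le two_le_infty)).trans ?_
  refine Finset.sum_congr rfl fun i _ ↦ ?_
  have h1 : ∀ᶠ v in nhds u, v ∈ (extChartAt (𝓡 m) x).target :=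
    (isOpen_extChartAt_target x).mem_nhds hu
  have h2 := hst.eventually hf
  have h3 : (fun v ↦ fderiv ℝ (fun v ↦ f ((extChartAt (𝓡 m) x).symm v)) v (rep x (e i) v))
      =ᶠ[nhds u] fun v ↦ dirDeriv (e i) f ((extChartAt (𝓡 m) x).symm v) := by
    filter_upwards [h1, h2] with v hv1 hv2
    rw [dirDeriv_eq_fderiv (e i) hv1 (hv2.mdifferentiableAt (by simp))]
  have h4 := dirDeriv_eq_fderiv (e i) hu (f := dirDeriv (e i) f) (by
    rw [hux]
    exact (contMDiffAt_dirDeriv hf₀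
      ((he.smooth i).contMDiffAt (hU.mem_nhds hx))).mdifferentiableAt (by simp))
  have h5 := frameDiv_eq g hU he hu (by rwa [hux]) i
  have h6 := h3.self_of_nhds
  simp only at h6
  rw [hux] at h4 h5 h6
  rw [h3.fderiv_eq, h4, h5, h6]

end Frames
end BiharmonicSubmersion
end

open scoped Manifold ContDiff
noncomputable section
namespace BiharmonicSubmersion

/-! ### Related vector fields and integrability data -/

section Related

open VectorField

/-- Differentiating both relations expresses the two brackets through each other up to second
derivatives of `φ`, which cancel by symmetry. -/
lemma fderiv_lieBracket_of_related {E F : Type*} [NormedAddCommGroup E] [NormedSpace ℝ E]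
    [NormedAddCommGroup F] [NormedSpace ℝ F] {φ : E → F} {u : E} {X X' : E → E} {Y Y' : F → F}
    (hφ : ContDiffAt ℝ 2 φ u) (hX : DifferentiableAt ℝ X u) (hX' : DifferentiableAt ℝ X' u)
    (hY : DifferentiableAt ℝ Y (φ u)) (hY' : DifferentiableAt ℝ Y' (φ u))
    (h : ∀ᶠ v in nhds u, fderiv ℝ φ v (X v) = Y (φ v))
    (h' : ∀ᶠ v in nhds u, fderiv ℝ φ v (X' v) = Y' (φ v)) :
    fderiv ℝ φ u (lieBracket ℝ X X' u) = lieBracket ℝ Y Y' (φ u) := by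
  have key : ∀ {Z : E → E} {W : F → F}, DifferentiableAt ℝ Z u → DifferentiableAt ℝ W (φ u) →
      (∀ᶠ v in nhds u, fderiv ℝ φ v (Z v) = W (φ v)) → ∀ w, fderiv ℝ W (φ u) (fderiv ℝ φ u w)
      = fderiv ℝ (fderiv ℝ φ) u w (Z u) + fderiv ℝ φ u (fderiv ℝ Z u w) := by
    intro Z W hZ hW hZW w
    rw [← fderiv_fderiv_apply hφ hZ, Filter.EventuallyEq.fderiv_eq hZW]
    have := hW.hasFDerivAt.comp u (hφ.differentiableAt (by norm_num)).hasFDerivAt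
    erw [this.fderiv]
    rfl
  have hsym : IsSymmSndFDerivAt ℝ φ u :=
    hφ.isSymmSndFDerivAt (by rw [minSmoothness_of_isRCLikeNormedField])
  rw [lieBracket, lieBracket, map_sub, ← h.self_of_nhds, ← h'.self_of_nhds, key hX' hY' h',
    key hX hY h, hsym (X u) (X' u)]
  abel

variable {m n : ℕ} {M N : Type*}
  [TopologicalSpace M] [ChartedSpace (EuclideanSpace ℝ (Fin m)) M] [IsManifold (𝓡 m) ∞ M]
  [TopologicalSpace N] [ChartedSpace (EuclideanSpace ℝ (Fin n)) N] [IsManifold (𝓡 n) ∞ N]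

lemma mfderiv_extChartAt_apply {y₀ q : N} (hq : q ∈ (extChartAt (𝓡 n) y₀).source)
    (Y : (y : N) → TangentSpace (𝓡 n) y) :
    mfderiv (𝓡 n) 𝓘(ℝ, EuclideanSpace ℝ (Fin n)) (extChartAt (𝓡 n) y₀) q (Y q)
      = rep y₀ Y (extChartAt (𝓡 n) y₀ q) := by
  have hl := (extChartAt (𝓡 n) y₀).left_inv hq
  have h1 := mfderiv_extChartAt_comp_mfderivWithin_extChartAt_symm
    ((extChartAt (𝓡 n) y₀).map_source hq)
  rw [ModelWithCorners.range_eq_univ, mfderivWithin_univ] at h1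
  have h2 := DFunLike.congr_fun h1 (rep y₀ Y (extChartAt (𝓡 n) y₀ q))
  have h4 : ∀ q', q' = q → (mfderiv (𝓡 n) 𝓘(ℝ, EuclideanSpace ℝ (Fin n)) (extChartAt (𝓡 n) y₀) q
      (Y q) : EuclideanSpace ℝ (Fin n))
      = mfderiv (𝓡 n) 𝓘(ℝ, EuclideanSpace ℝ (Fin n)) (extChartAt (𝓡 n) y₀) q' (Y q') := by
    rintro _ rfl; rfl
  exact (h4 _ hl).trans ((congrArg (mfderiv (𝓡 n) 𝓘(ℝ, EuclideanSpace ℝ (Fin n))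
    (extChartAt (𝓡 n) y₀) ((extChartAt (𝓡 n) y₀).symm (extChartAt (𝓡 n) y₀ q)))
    (mfderiv_symm_rep ((extChartAt (𝓡 n) y₀).map_source hq) Y).symm).trans h2)

lemma fderiv_chart_of_related {φ : M → N} {x₀ : M} {y₀ : N} {u : EuclideanSpace ℝ (Fin m)}
    (hu : u ∈ (extChartAt (𝓡 m) x₀).target) {X : (p : M) → TangentSpace (𝓡 m) p}
    {Y : (y : N) → TangentSpace (𝓡 n) y}
    (hφ : MDifferentiableAt (𝓡 m) (𝓡 n) φ ((extChartAt (𝓡 m) x₀).symm u))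
    (hp : φ ((extChartAt (𝓡 m) x₀).symm u) ∈ (extChartAt (𝓡 n) y₀).source)
    (hr : mfderiv (𝓡 m) (𝓡 n) φ ((extChartAt (𝓡 m) x₀).symm u) (X ((extChartAt (𝓡 m) x₀).symm u))
      = Y (φ ((extChartAt (𝓡 m) x₀).symm u))) :
    fderiv ℝ (fun v ↦ extChartAt (𝓡 n) y₀ (φ ((extChartAt (𝓡 m) x₀).symm v))) u (rep x₀ X u)
      = rep y₀ Y (extChartAt (𝓡 n) y₀ (φ ((extChartAt (𝓡 m) x₀).symm u))) := by
  have hd := mdifferentiableAt_extChartAt (I := 𝓡 n) (by rwa [extChartAt_source] at hp)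
  have h1 : MDifferentiableAt (𝓡 m) 𝓘(ℝ, EuclideanSpace ℝ (Fin n))
      (fun q ↦ extChartAt (𝓡 n) y₀ (φ q)) ((extChartAt (𝓡 m) x₀).symm u) := hd.comp _ hφ
  rw [← mfderiv_apply_eq_fderiv X hu h1, ← mfderiv_extChartAt_apply hp, ← hr]
  exact mfderiv_comp_apply _ hd hφ _

lemma mfderiv_eq_fderiv_chart {φ : M → N} {x : M} (hφ : MDifferentiableAt (𝓡 m) (𝓡 n) φ x)
    (w : TangentSpace (𝓡 m) x) : mfderiv (𝓡 m) (𝓡 n) φ x w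
      = fderiv ℝ (fun v ↦ extChartAt (𝓡 n) (φ x) (φ ((extChartAt (𝓡 m) x).symm v)))
        (extChartAt (𝓡 m) x x) w := by
  have h := hφ.mfderiv
  rw [ModelWithCorners.range_eq_univ, fderivWithin_univ] at h
  rw [h]
  rfl

lemma contDiffAt_chart {φ : M → N} {x₀ : M} {y₀ : N} {u : EuclideanSpace ℝ (Fin m)}
    (hu : u ∈ (extChartAt (𝓡 m) x₀).target)
    (hφ : ContMDiffAt (𝓡 m) (𝓡 n) ∞ φ ((extChartAt (𝓡 m) x₀).symm u))
    (hp : φ ((extChartAt (𝓡 m) x₀).symm u) ∈ (extChartAt (𝓡 n) y₀).source) :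
    ContDiffAt ℝ ∞ (fun v ↦ extChartAt (𝓡 n) y₀ (φ ((extChartAt (𝓡 m) x₀).symm v))) u :=
  ContMDiffAt.contDiffAt (ContMDiffAt.comp u (I' := 𝓡 n) (g := extChartAt (𝓡 n) y₀)
    (f := fun v ↦ φ ((extChartAt (𝓡 m) x₀).symm v))
    (contMDiffAt_extChartAt' (by rwa [extChartAt_source] at hp))
    (ContMDiffAt.comp u hφ (contMDiffAt_extChartAt_symm hu)))

lemma tendsto_extChartAt_symm (x : M) :
    Filter.Tendsto (extChartAt (𝓡 m) x).symm (nhds (extChartAt (𝓡 m) x x)) (nhds x) := by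
  have := (contMDiffAt_extChartAt_symm (mem_extChartAt_target (I := 𝓡 m) x)).continuousAt
  rwa [ContinuousAt, extChartAt_to_inv] at this

/-- The differential of a map sends the bracket of two vector fields to the bracket of the vector
fields to which they are related. -/
theorem mfderiv_mlieBracket_of_related {φ : M → N} {x : M} {X X' : (p : M) → TangentSpace (𝓡 m) p}
    {Y Y' : (y : N) → TangentSpace (𝓡 n) y}
    (hφ : ∀ᶠ p in nhds x, ContMDiffAt (𝓡 m) (𝓡 n) ∞ φ p)
    (hX : ContMDiffAt (𝓡 m) (𝓡 m).tangent ∞ (fun p ↦ (⟨p, X p⟩ : TangentBundle (𝓡 m) M)) x)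
    (hX' : ContMDiffAt (𝓡 m) (𝓡 m).tangent ∞ (fun p ↦ (⟨p, X' p⟩ : TangentBundle (𝓡 m) M)) x)
    (hY : ContMDiffAt (𝓡 n) (𝓡 n).tangent ∞ (fun p ↦ (⟨p, Y p⟩ : TangentBundle (𝓡 n) N)) (φ x))
    (hY' : ContMDiffAt (𝓡 n) (𝓡 n).tangent ∞ (fun p ↦ (⟨p, Y' p⟩ : TangentBundle (𝓡 n) N)) (φ x))
    (h : ∀ᶠ p in nhds x, mfderiv (𝓡 m) (𝓡 n) φ p (X p) = Y (φ p))
    (h' : ∀ᶠ p in nhds x, mfderiv (𝓡 m) (𝓡 n) φ p (X' p) = Y' (φ p)) :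
    mfderiv (𝓡 m) (𝓡 n) φ x (mlieBracket (𝓡 m) X X' x) = mlieBracket (𝓡 n) Y Y' (φ x) := by
  have hu := mem_extChartAt_target (I := 𝓡 m) x
  have hux : (extChartAt (𝓡 m) x).symm (extChartAt (𝓡 m) x x) = x := extChartAt_to_inv x
  have hv := mem_extChartAt_target (I := 𝓡 n) (φ x)
  have hvx : (extChartAt (𝓡 n) (φ x)).symm (extChartAt (𝓡 n) (φ x) (φ x)) = φ x :=
    extChartAt_to_inv (φ x)
  have hφ₀ := hφ.self_of_nhds
  set φc : EuclideanSpace ℝ (Fin m) → EuclideanSpace ℝ (Fin n) :=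
    fun v ↦ extChartAt (𝓡 n) (φ x) (φ ((extChartAt (𝓡 m) x).symm v)) with hφc
  have hφu : φc (extChartAt (𝓡 m) x x) = extChartAt (𝓡 n) (φ x) (φ x) := by
    rw [hφc]; simp only [hux]
  have hsrc : ∀ᶠ y in nhds x, φ y ∈ (extChartAt (𝓡 n) (φ x)).source :=
    hφ₀.continuousAt ((isOpen_extChartAt_source (φ x)).mem_nhds (mem_extChartAt_source _))
  have htgt : ∀ᶠ v in nhds (extChartAt (𝓡 m) x x), v ∈ (extChartAt (𝓡 m) x).target :=
    (isOpen_extChartAt_target x).mem_nhds hu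
  have hrel : ∀ {Z : (p : M) → TangentSpace (𝓡 m) p} {W : (y : N) → TangentSpace (𝓡 n) y},
      (∀ᶠ p in nhds x, mfderiv (𝓡 m) (𝓡 n) φ p (Z p) = W (φ p)) →
      ∀ᶠ v in nhds (extChartAt (𝓡 m) x x), fderiv ℝ φc v (rep x Z v) = rep (φ x) W (φc v) := by
    intro Z W hZW
    filter_upwards [htgt, (tendsto_extChartAt_symm x).eventually hsrc,
      (tendsto_extChartAt_symm x).eventually hφ, (tendsto_extChartAt_symm x).eventually hZW]
      with v h1 h2 h3 h4
    exact fderiv_chart_of_related h1 (h3.mdifferentiableAt (by simp)) h2 h4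
  have hd {Z : (p : M) → TangentSpace (𝓡 m) p}
      (hZ : ContMDiffAt (𝓡 m) (𝓡 m).tangent ∞ (fun p ↦ (⟨p, Z p⟩ : TangentBundle (𝓡 m) M)) x) :
      DifferentiableAt ℝ (rep x Z) (extChartAt (𝓡 m) x x) :=
    (contDiffAt_rep hu (by rwa [hux])).differentiableAt (by simp)
  have hd' {Z : (p : N) → TangentSpace (𝓡 n) p}
      (hZ : ContMDiffAt (𝓡 n) (𝓡 n).tangent ∞ (fun p ↦ (⟨p, Z p⟩ : TangentBundle (𝓡 n) N)) (φ x)) :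
      DifferentiableAt ℝ (rep (φ x) Z) (φc (extChartAt (𝓡 m) x x)) := by
    rw [hφu]
    exact (contDiffAt_rep hv (by rwa [hvx])).differentiableAt (by simp)
  have hc : ContDiffAt ℝ ∞ φc (extChartAt (𝓡 m) x x) :=
    contDiffAt_chart hu (by rwa [hux]) (by rw [hux]; exact mem_extChartAt_source _)
  have key := fderiv_lieBracket_of_related (hc.of_le two_le_infty)
    (hd hX) (hd hX') (hd' hY) (hd' hY') (hrel h) (hrel h')
  rw [hφu, ← rep_mlieBracket hu (by rwa [hux]) (by rwa [hux]),
    ← rep_mlieBracket hv (by rwa [hvx]) (by rwa [hvx]), rep_self, rep_self] at key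
  rw [mfderiv_eq_fderiv_chart (hφ₀.mdifferentiableAt (by simp))]
  exact key

/-- Expansion of a tangent vector in an orthonormal frame. -/
lemma IsOrthonormalOn.eq_sum {g : SmoothMetric m M} {U : Set M} (hU : IsOpen U)
    {e : Fin m → (p : M) → TangentSpace (𝓡 m) p} (he : IsOrthonormalOn g U e) {x : M} (hx : x ∈ U)
    (v : TangentSpace (𝓡 m) x) : v = ∑ i, g.inner x v (e i x) • e i x := by
  have hu := mem_extChartAt_target (I := 𝓡 m) x
  have hux : (extChartAt (𝓡 m) x).symm (extChartAt (𝓡 m) x x) = x := extChartAt_to_inv x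
  -- Only the value at `x` matters, so the vector is extended by a constant in the model space; no
  -- smoothness of the extension is needed.
  let X : (p : M) → TangentSpace (𝓡 m) p := fun _ ↦ (v : EuclideanSpace ℝ (Fin m))
  have h1 := (isLocalFrame_rep g hU he hu (by rwa [hux])).eq_sum (rep x X (extChartAt (𝓡 m) x x))
  have h2 : ∀ i, bil (gram g x (extChartAt (𝓡 m) x x)) (rep x X (extChartAt (𝓡 m) x x))
      (rep x (e i) (extChartAt (𝓡 m) x x)) = g.inner x (X x) (e i x) := fun i ↦ by
    rw [← inner_eq_bil g hu, hux]
  simp only [h2] at h1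
  simp only [rep_self] at h1
  exact h1

end Related

end BiharmonicSubmersion
end

open scoped Manifold ContDiff
noncomputable section
namespace BiharmonicSubmersion

/-! ### Integrability data and tension field of the submersion. -/

section AdaptedFrame

open VectorField

variable {M N : Type*}
  [TopologicalSpace M] [ChartedSpace (EuclideanSpace ℝ (Fin 3)) M] [IsManifold (𝓡 3) ∞ M]
  [TopologicalSpace N] [ChartedSpace (EuclideanSpace ℝ (Fin 2)) N] [IsManifold (𝓡 2) ∞ N]
  {g : SmoothMetric 3 M} {h : SmoothMetric 2 N} {π : M → N} {U : Set M} {V : Set N}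
  {e₁ e₂ e₃ : (p : M) → TangentSpace (𝓡 3) p} {ε₁ ε₂ : (y : N) → TangentSpace (𝓡 2) y}

lemma IsOrthonormalOn.contMDiffAt {m : ℕ} {M : Type*}
    [TopologicalSpace M] [ChartedSpace (EuclideanSpace ℝ (Fin m)) M] [IsManifold (𝓡 m) ∞ M]
    {g : SmoothMetric m M} {U : Set M} {r : ℕ} {e : Fin r → (p : M) → TangentSpace (𝓡 m) p}
    (he : IsOrthonormalOn g U e) (hU : IsOpen U) {p : M} (hp : p ∈ U) (i : Fin r) :
    ContMDiffAt (𝓡 m) (𝓡 m).tangent ∞ (fun p ↦ (⟨p, e i p⟩ : TangentBundle (𝓡 m) M)) p :=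
  (he.smooth i).contMDiffAt (hU.mem_nhds hp)

lemma dirDeriv_congr {m : ℕ} {M : Type*} [TopologicalSpace M]
    [ChartedSpace (EuclideanSpace ℝ (Fin m)) M] {X : (p : M) → TangentSpace (𝓡 m) p} {f f' : M → ℝ}
    {p : M} (h : f =ᶠ[nhds p] f') : dirDeriv X f p = dirDeriv X f' p :=
  congrArg (fun L : EuclideanSpace ℝ (Fin m) →L[ℝ] ℝ ↦ L (X p)) h.mfderiv_eq

lemma dirDeriv_const {m : ℕ} {M : Type*} [TopologicalSpace M]
    [ChartedSpace (EuclideanSpace ℝ (Fin m)) M] (X : (p : M) → TangentSpace (𝓡 m) p) (c : ℝ)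
    (p : M) : dirDeriv X (fun _ ↦ c) p = 0 :=
  congrArg (fun L : EuclideanSpace ℝ (Fin m) →L[ℝ] ℝ ↦ L (X p)) mfderiv_const

namespace IsAdaptedFrame

/-- As `e₃` is related to zero, the brackets with `e₃` are killed by `dπ` and hence are multiples of
`e₃`. The bracket of `e₁` and `e₂` projects to that of `ε₁` and `ε₂`, so its horizontal coefficients
are pulled back from the base, and its vertical coefficient defines `σ`. -/
lemma exists_integrabilityData (hπ : ContMDiff (𝓡 3) (𝓡 2) ∞ π)
    (hf : IsAdaptedFrame g h π U V e₁ e₂ e₃ ε₁ ε₂) :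
    ∃ f₁ f₂ κ₁ κ₂ σ : M → ℝ, IsIntegrabilityData π U V e₁ e₂ e₃ ε₁ ε₂ f₁ f₂ κ₁ κ₂ σ := by
  have hzero : ∀ y : N, ContMDiffAt (𝓡 2) (𝓡 2).tangent ∞
      (fun p ↦ (⟨p, (0 : (y : N) → TangentSpace (𝓡 2) y) p⟩ : TangentBundle (𝓡 2) N)) y :=
    fun y ↦ (Bundle.contMDiff_zeroSection ℝ (TangentSpace (𝓡 2) : N → Type)).contMDiffAt
  have hU := hf.isOpen_source
  have hV := hf.isOpen_target
  have hsm {p : M} (hp : p ∈ U) i := hf.frame.contMDiffAt hU hp i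
  have hsn {y : N} (hy : y ∈ V) i := hf.baseFrame.contMDiffAt hV hy i
  have hon := hf.frame.orthonormal
  have hbase : ∀ y ∈ V, mlieBracket (𝓡 2) ε₁ ε₂ y
      = h.inner y (mlieBracket (𝓡 2) ε₁ ε₂ y) (ε₁ y) • ε₁ y
        + h.inner y (mlieBracket (𝓡 2) ε₁ ε₂ y) (ε₂ y) • ε₂ y := fun y hy ↦ by
    have := hf.baseFrame.eq_sum hV hy (mlieBracket (𝓡 2) ε₁ ε₂ y)
    rwa [Fin.sum_univ_two] at this
  have hrel₁ : ∀ p ∈ U, ∀ᶠ q in nhds p, mfderiv (𝓡 3) (𝓡 2) π q (e₁ q) = ε₁ (π q) :=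
    fun p hp ↦ Filter.eventually_of_mem (hU.mem_nhds hp) hf.related₁
  have hrel₂ : ∀ p ∈ U, ∀ᶠ q in nhds p, mfderiv (𝓡 3) (𝓡 2) π q (e₂ q) = ε₂ (π q) :=
    fun p hp ↦ Filter.eventually_of_mem (hU.mem_nhds hp) hf.related₂
  have hrel₃ : ∀ p ∈ U, ∀ᶠ q in nhds p, mfderiv (𝓡 3) (𝓡 2) π q (e₃ q)
      = (0 : (y : N) → TangentSpace (𝓡 2) y) (π q) :=
    fun p hp ↦ Filter.eventually_of_mem (hU.mem_nhds hp) hf.vertical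
  have hπ' : ∀ p, ∀ᶠ q in nhds p, ContMDiffAt (𝓡 3) (𝓡 2) ∞ π q := fun p ↦
    Filter.Eventually.of_forall fun q ↦ hπ q
  have hdπ : ∀ p ∈ U, ∀ v : TangentSpace (𝓡 3) p, mfderiv (𝓡 3) (𝓡 2) π p v
      = g.inner p v (e₁ p) • ε₁ (π p) + g.inner p v (e₂ p) • ε₂ (π p) := fun p hp v ↦ by
    have h1 := hf.frame.eq_sum hU hp v
    rw [Fin.sum_univ_three] at h1
    have h2 := congrArg (mfderiv (𝓡 3) (𝓡 2) π p) h1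
    simp only [map_add, map_smul] at h2
    change _ = _ • mfderiv (𝓡 3) (𝓡 2) π p (e₁ p) + _ • mfderiv (𝓡 3) (𝓡 2) π p (e₂ p)
      + _ • mfderiv (𝓡 3) (𝓡 2) π p (e₃ p) at h2
    rw [hf.related₁ p hp, hf.related₂ p hp, hf.vertical p hp, smul_zero, add_zero] at h2
    exact h2
  have hcoef : ∀ y ∈ V, ∀ a b : ℝ, h.inner y (a • ε₁ y + b • ε₂ y) (ε₁ y) = a ∧
      h.inner y (a • ε₁ y + b • ε₂ y) (ε₂ y) = b := fun y hy a b ↦ by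
    have h00 : h.inner y (ε₁ y) (ε₁ y) = 1 := hf.baseFrame.orthonormal y hy 0 0
    have h01 : h.inner y (ε₁ y) (ε₂ y) = 0 := hf.baseFrame.orthonormal y hy 0 1
    have h10 : h.inner y (ε₂ y) (ε₁ y) = 0 := hf.baseFrame.orthonormal y hy 1 0
    have h11 : h.inner y (ε₂ y) (ε₂ y) = 1 := hf.baseFrame.orthonormal y hy 1 1
    simp [h00, h01, h10, h11]
  -- Since `dπ` sends `e₁, e₂` to a basis, a vector in its kernel has no horizontal components.
  have hvert : ∀ p ∈ U, ∀ v : TangentSpace (𝓡 3) p, mfderiv (𝓡 3) (𝓡 2) π p v = 0 →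
      v = g.inner p v (e₃ p) • e₃ p := fun p hp v hv ↦ by
    have h1 := hf.frame.eq_sum hU hp v
    rw [Fin.sum_univ_three] at h1
    have h2 := hcoef (π p) (hf.mapsTo hp) (g.inner p v (e₁ p)) (g.inner p v (e₂ p))
    rw [← hdπ p hp, hv] at h2
    simp only [map_zero, _root_.zero_apply] at h2
    change v = g.inner p v (e₁ p) • e₁ p + g.inner p v (e₂ p) • e₂ p
      + g.inner p v (e₃ p) • e₃ p at h1
    rw [← h2.1, ← h2.2, zero_smul, zero_smul, zero_add, zero_add] at h1
    exact h1
  refine ⟨fun p ↦ h.inner (π p) (mlieBracket (𝓡 2) ε₁ ε₂ (π p)) (ε₁ (π p)),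
    fun p ↦ h.inner (π p) (mlieBracket (𝓡 2) ε₁ ε₂ (π p)) (ε₂ (π p)),
    fun p ↦ g.inner p (mlieBracket (𝓡 3) e₁ e₃ p) (e₃ p),
    fun p ↦ g.inner p (mlieBracket (𝓡 3) e₂ e₃ p) (e₃ p),
    fun p ↦ -(1 / 2) * g.inner p (mlieBracket (𝓡 3) e₁ e₂ p) (e₃ p), ⟨⟨_, _, hbase,
      fun p _ ↦ rfl, fun p _ ↦ rfl⟩, fun p hp ↦ ?_, fun p hp ↦ ?_, fun p hp ↦ ?_⟩⟩
  · apply hvert p hp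
    refine (mfderiv_mlieBracket_of_related (hπ' p) (hsm hp 0) (hsm hp 2) (hsn (hf.mapsTo hp) 0)
      (hzero _) (hrel₁ p hp) (hrel₃ p hp)).trans ?_
    rw [mlieBracket_zero_right]
    rfl
  · apply hvert p hp
    refine (mfderiv_mlieBracket_of_related (hπ' p) (hsm hp 1) (hsm hp 2) (hsn (hf.mapsTo hp) 1)
      (hzero _) (hrel₂ p hp) (hrel₃ p hp)).trans ?_
    rw [mlieBracket_zero_right]
    rfl
  · have h1 := hf.frame.eq_sum hU hp (mlieBracket (𝓡 3) e₁ e₂ p)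
    rw [Fin.sum_univ_three] at h1
    have h2 := mfderiv_mlieBracket_of_related (hπ' p) (hsm hp 0) (hsm hp 1) (hsn (hf.mapsTo hp) 0)
      (hsn (hf.mapsTo hp) 1) (hrel₁ p hp) (hrel₂ p hp)
    change mfderiv (𝓡 3) (𝓡 2) π p (mlieBracket (𝓡 3) e₁ e₂ p)
      = mlieBracket (𝓡 2) ε₁ ε₂ (π p) at h2
    rw [hdπ p hp] at h2
    have h3 := hcoef (π p) (hf.mapsTo hp) (g.inner p (mlieBracket (𝓡 3) e₁ e₂ p) (e₁ p))
      (g.inner p (mlieBracket (𝓡 3) e₁ e₂ p) (e₂ p))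
    rw [h2] at h3
    rw [h3.1, h3.2]
    refine h1.trans ?_
    change g.inner p _ (e₁ p) • e₁ p + g.inner p _ (e₂ p) • e₂ p + g.inner p _ (e₃ p) • e₃ p = _
    module

variable {f₁ f₂ κ₁ κ₂ σ : M → ℝ}

lemma inner_eq (hf : IsAdaptedFrame g h π U V e₁ e₂ e₃ ε₁ ε₂) {p : M} (hp : p ∈ U) :
    g.inner p (e₁ p) (e₁ p) = 1 ∧ g.inner p (e₁ p) (e₂ p) = 0 ∧ g.inner p (e₁ p) (e₃ p) = 0 ∧
    g.inner p (e₂ p) (e₁ p) = 0 ∧ g.inner p (e₂ p) (e₂ p) = 1 ∧ g.inner p (e₂ p) (e₃ p) = 0 ∧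
    g.inner p (e₃ p) (e₁ p) = 0 ∧ g.inner p (e₃ p) (e₂ p) = 0 ∧ g.inner p (e₃ p) (e₃ p) = 1 :=
  have ho := hf.frame.orthonormal p hp
  ⟨ho 0 0, ho 0 1, ho 0 2, ho 1 0, ho 1 1, ho 1 2, ho 2 0, ho 2 1, ho 2 2⟩

lemma base_inner_eq (hf : IsAdaptedFrame g h π U V e₁ e₂ e₃ ε₁ ε₂) {y : N} (hy : y ∈ V) :
    h.inner y (ε₁ y) (ε₁ y) = 1 ∧ h.inner y (ε₁ y) (ε₂ y) = 0 ∧ h.inner y (ε₂ y) (ε₁ y) = 0 ∧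
    h.inner y (ε₂ y) (ε₂ y) = 1 :=
  have ho := hf.baseFrame.orthonormal y hy
  ⟨ho 0 0, ho 0 1, ho 1 0, ho 1 1⟩

/-- These are the divergences of the frame fields with opposite sign. Each summand sees only the
component of a bracket along its second field, so `σ` does not enter, and `e₃` is divergence free
because its brackets with `e₁` and `e₂` are vertical. -/
lemma frameDiv_eq (hf : IsAdaptedFrame g h π U V e₁ e₂ e₃ ε₁ ε₂)
    (hd : IsIntegrabilityData π U V e₁ e₂ e₃ ε₁ ε₂ f₁ f₂ κ₁ κ₂ σ) {p : M} (hp : p ∈ U) :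
    frameDiv g ![e₁, e₂, e₃] 0 p = f₂ p + κ₁ p ∧ frameDiv g ![e₁, e₂, e₃] 1 p = κ₂ p - f₁ p ∧
      frameDiv g ![e₁, e₂, e₃] 2 p = 0 := by
  obtain ⟨h11, h12, h13, h21, h22, h23, h31, h32, h33⟩ := hf.inner_eq hp
  have b12 := hd.bracket₁₂ p hp
  have b13 := hd.bracket₁₃ p hp
  have b23 := hd.bracket₂₃ p hp
  have b21 := (mlieBracket_swap_apply (I := 𝓡 3) (V := e₂) (W := e₁) (x := p)).trans
    (congrArg _ b12)
  have b31 := (mlieBracket_swap_apply (I := 𝓡 3) (V := e₃) (W := e₁) (x := p)).trans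
    (congrArg _ b13)
  have b32 := (mlieBracket_swap_apply (I := 𝓡 3) (V := e₃) (W := e₂) (x := p)).trans
    (congrArg _ b23)
  refine ⟨?_, ?_, ?_⟩
  · rw [frameDiv, Fin.sum_univ_three]
    change g.inner p (mlieBracket (𝓡 3) e₁ e₁ p) (e₁ p) + g.inner p (mlieBracket (𝓡 3) e₁ e₂ p)
      (e₂ p) + g.inner p (mlieBracket (𝓡 3) e₁ e₃ p) (e₃ p) = _
    rw [b12, b13, mlieBracket_self]
    simp [h12, h22, h32, h33]
  · rw [frameDiv, Fin.sum_univ_three]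
    change g.inner p (mlieBracket (𝓡 3) e₂ e₁ p) (e₁ p) + g.inner p (mlieBracket (𝓡 3) e₂ e₂ p)
      (e₂ p) + g.inner p (mlieBracket (𝓡 3) e₂ e₃ p) (e₃ p) = _
    rw [b21, b23, mlieBracket_self]
    simp [h11, h21, h31, h33]
    ring
  · rw [frameDiv, Fin.sum_univ_three]
    change g.inner p (mlieBracket (𝓡 3) e₃ e₁ p) (e₁ p) + g.inner p (mlieBracket (𝓡 3) e₃ e₂ p)
      (e₂ p) + g.inner p (mlieBracket (𝓡 3) e₃ e₃ p) (e₃ p) = _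
    rw [b31, b32, mlieBracket_self]
    simp [h31, h32]

/-- On a surface the connection is a single one-form: `∇_{ε_b}` sends `ε₂` to `F_b ε₁` and `ε₁` to
`-F_b ε₂`. The quadratic form in `A` is written in closed form because it is later differentiated in
time. -/
lemma sum_connCoeff (hf : IsAdaptedFrame g h π U V e₁ e₂ e₃ ε₁ ε₂) {y : N} (hy : y ∈ V)
    {F₁ F₂ : ℝ} (hF : mlieBracket (𝓡 2) ε₁ ε₂ y = F₁ • ε₁ y + F₂ • ε₂ y) (A : Fin 2 → ℝ) :
    ∑ b, ∑ d, A b * A d * connCoeff h ![ε₁, ε₂] b d 0 y = (F₁ * A 0 + F₂ * A 1) * A 1 ∧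
    ∑ b, ∑ d, A b * A d * connCoeff h ![ε₁, ε₂] b d 1 y = -((F₁ * A 0 + F₂ * A 1) * A 0) := by
  obtain ⟨h11, h12, h21, h22⟩ := hf.base_inner_eq hy
  have b21 := (mlieBracket_swap_apply (I := 𝓡 2) (V := ε₂) (W := ε₁) (x := y)).trans
    (congrArg _ hF)
  have k : ∀ b d a, connCoeff h ![ε₁, ε₂] b d a y = (1 / 2) *
    (h.inner y (mlieBracket (𝓡 2) (![ε₁, ε₂] b) (![ε₁, ε₂] d) y) (![ε₁, ε₂] a y)
    - h.inner y (mlieBracket (𝓡 2) (![ε₁, ε₂] b) (![ε₁, ε₂] a) y) (![ε₁, ε₂] d y)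
    - h.inner y (mlieBracket (𝓡 2) (![ε₁, ε₂] d) (![ε₁, ε₂] a) y) (![ε₁, ε₂] b y)) :=
    fun b d a ↦ rfl
  simp only [Fin.sum_univ_two, k]
  simp only [Matrix.cons_val_zero, Matrix.cons_val_one, hF, b21, mlieBracket_self]
  simp [h11, h12, h21, h22]
  constructor <;> ring

/-- The coefficients of `dπ` are constant on `U`, so their derivatives vanish and the tension field
reduces to bracket terms. -/
lemma frameDiff_eq (hf : IsAdaptedFrame g h π U V e₁ e₂ e₃ ε₁ ε₂) {q : M} (hq : q ∈ U)
    (i : Fin 3) (a : Fin 2) :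
    frameDiff h π (![e₁, e₂, e₃] i) (![ε₁, ε₂] a) q = if i.val = a.val then 1 else 0 := by
  obtain ⟨h11, h12, h21, h22⟩ := hf.base_inner_eq (hf.mapsTo hq)
  have r1 := hf.related₁ q hq
  have r2 := hf.related₂ q hq
  have r3 := hf.vertical q hq
  fin_cases i <;> fin_cases a
  · change frameDiff h π e₁ ε₁ q = _
    rw [frameDiff, r1, h11]; rfl
  · change frameDiff h π e₁ ε₂ q = _
    rw [frameDiff, r1, h12]; rfl
  · change frameDiff h π e₂ ε₁ q = _
    rw [frameDiff, r2, h21]; rfl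
  · change frameDiff h π e₂ ε₂ q = _
    rw [frameDiff, r2, h22]; rfl
  · change frameDiff h π e₃ ε₁ q = _
    rw [frameDiff, r3, map_zero]; rfl
  · change frameDiff h π e₃ ε₂ q = _
    rw [frameDiff, r3, map_zero]; rfl

/-- The divergence coefficients contribute `-(f₂ + κ₁)` and `-(κ₂ - f₁)`, the connection of the base
contributes `f₂` and `-f₁`, and the parts coming from the base cancel. -/
theorem tension_eq (hπ : ContMDiff (𝓡 3) (𝓡 2) ∞ π)
    (hf : IsAdaptedFrame g h π U V e₁ e₂ e₃ ε₁ ε₂)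
    (hd : IsIntegrabilityData π U V e₁ e₂ e₃ ε₁ ε₂ f₁ f₂ κ₁ κ₂ σ) {p : M} (hp : p ∈ U) :
    tension g h π p = -κ₁ p • ε₁ (π p) - κ₂ p • ε₂ (π p) := by
  obtain ⟨F₁, F₂, hF, hf₁, hf₂⟩ := hd.base
  have hU := hf.isOpen_source
  have hA := fun i a q (hq : q ∈ U) ↦ hf.frameDiff_eq hq i a
  have hdA : ∀ i a (X : (p : M) → TangentSpace (𝓡 3) p),
      dirDeriv X (frameDiff h π (![e₁, e₂, e₃] i) (![ε₁, ε₂] a)) p = 0 := fun i a X ↦ by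
    rw [dirDeriv_congr (f' := fun _ ↦ if i.val = a.val then 1 else 0)
      (Filter.eventually_of_mem (hU.mem_nhds hp) fun q hq ↦ hA i a q hq), dirDeriv_const]
  obtain ⟨c0, c1, c2⟩ := hf.frameDiv_eq hd hp
  have hc := fun A ↦ hf.sum_connCoeff (hf.mapsTo hp) (hF _ (hf.mapsTo hp)) A
  rw [tension_eq_frame g h hU hf.frame hf.isOpen_target hf.baseFrame hp (hf.mapsTo hp)
    (Filter.Eventually.of_forall fun q ↦ hπ q), Fin.sum_univ_two, Fin.sum_univ_three,
    Fin.sum_univ_three]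
  simp only [hdA, hA _ _ p hp, c0, c1, c2]
  simp only [fun i : Fin 3 ↦ (hc fun b ↦ if i.val = b.val then 1 else 0).1,
    fun i : Fin 3 ↦ (hc fun b ↦ if i.val = b.val then 1 else 0).2, ← hf₁ p hp, ← hf₂ p hp]
  change _ • ε₁ (π p) + _ • ε₂ (π p) = _
  simp
  module

end IsAdaptedFrame

end AdaptedFrame

end BiharmonicSubmersion
end

open scoped Manifold ContDiff
noncomputable section
namespace BiharmonicSubmersion

/-! ### Structure equations and curvature of a surface -/

section Coframe

open VectorField

variable {n : ℕ} {H : EuclideanSpace ℝ (Fin n) → Matrix (Fin n) (Fin n) ℝ}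
    {ε : Fin n → EuclideanSpace ℝ (Fin n) → EuclideanSpace ℝ (Fin n)}
    {v : EuclideanSpace ℝ (Fin n)}

/-- The one-form metrically dual to a vector field. -/
def coframe (H : EuclideanSpace ℝ (Fin n) → Matrix (Fin n) (Fin n) ℝ)
    (Y : EuclideanSpace ℝ (Fin n) → EuclideanSpace ℝ (Fin n)) (v : EuclideanSpace ℝ (Fin n)) :
    EuclideanSpace ℝ (Fin n) →L[ℝ] ℝ :=
  ∑ i, (∑ j, H v i j * Y v j) • (EuclideanSpace.proj i : EuclideanSpace ℝ (Fin n) →L[ℝ] ℝ)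

lemma coframe_apply (Y : EuclideanSpace ℝ (Fin n) → EuclideanSpace ℝ (Fin n))
    (w : EuclideanSpace ℝ (Fin n)) : coframe H Y v w = bil (H v) w (Y v) := by
  simp only [coframe, bil_apply, _root_.sum_apply, _root_.smul_apply, smul_eq_mul, Finset.sum_mul]
  refine Finset.sum_congr rfl fun i _ ↦ Finset.sum_congr rfl fun j _ ↦ ?_
  change H v i j * Y v j * w i = _
  ring

lemma contDiffAt_coframe (hε : IsLocalFrame H ε v) (a : Fin n) :
    ContDiffAt ℝ ∞ (coframe H (ε a)) v := by
  refine ContDiffAt.sum fun i _ ↦ ContDiffAt.fun_smul (ContDiffAt.sum fun j _ ↦ ?_)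
    contDiffAt_const
  exact (hε.metric i j).mul ((EuclideanSpace.proj j : EuclideanSpace ℝ (Fin n) →L[ℝ]
    ℝ).contDiff.contDiffAt.comp v (hε.frame a))

lemma coframe_frame (hε : IsLocalFrame H ε v) (a b : Fin n) :
    coframe H (ε a) v (ε b v) = if b = a then 1 else 0 := by
  rw [coframe_apply, hε.orthonormal.self_of_nhds]

lemma eq_sum_coframe (hε : IsLocalFrame H ε v) (w : EuclideanSpace ℝ (Fin n)) :
    w = ∑ a, coframe H (ε a) v w • ε a v := by
  simp_rw [coframe_apply]
  exact hε.eq_sum w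

/-- The structure equation of a coframe. -/
lemma fderiv_coframe_sub (hε : IsLocalFrame H ε v) (a b c : Fin n) :
    fderiv ℝ (coframe H (ε a)) v (ε b v) (ε c v) - fderiv ℝ (coframe H (ε a)) v (ε c v) (ε b v)
      = -coframe H (ε a) v (lieBracket ℝ (ε b) (ε c) v) := by
  -- Differentiating the constant `θ^a(ε_c)` moves the derivative from the form to the field;
  -- antisymmetrising then produces the bracket.
  have key : ∀ c w, fderiv ℝ (coframe H (ε a)) v w (ε c v)
      = -coframe H (ε a) v (fderiv ℝ (ε c) v w) := fun c w ↦ by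
    have h1 : (fun x ↦ coframe H (ε a) x (ε c x)) =ᶠ[nhds v]
        fun _ ↦ (if c = a then 1 else 0 : ℝ) := by
      filter_upwards [hε.eventually] with x hx using coframe_frame hx a c
    have h2 := h1.fderiv_eq (𝕜 := ℝ)
    rw [(((contDiffAt_coframe hε a).differentiableAt (by simp)).hasFDerivAt.clm_apply
      ((hε.frame c).differentiableAt (by simp)).hasFDerivAt).fderiv] at h2
    have h3 := DFunLike.congr_fun h2 w
    simp at h3
    linarith
  rw [key, key, lieBracket, map_sub]
  ring

/-- Near `v` the inverse metric is the product of the frame matrix and its transpose, which is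
visibly smooth. -/
lemma contDiffAt_chr (hε : IsLocalFrame H ε v) (k i j : Fin n) :
    ContDiffAt ℝ ∞ (chr H k i j) v := by
  have h1 : chr H k i j =ᶠ[nhds v] fun u ↦ (1 / 2) * ∑ l, (∑ a, ε a u k * ε a u l) *
    (partialDeriv i (fun v ↦ H v j l) u + partialDeriv j (fun v ↦ H v i l) u
      - partialDeriv l (fun v ↦ H v i j) u) := by
    filter_upwards [hε.eventually] with u hu
    simp only [chr, hu.inv_eq, Matrix.mul_apply]
    rfl
  have h2 : ∀ i j l, ContDiffAt ℝ ∞ (partialDeriv l (fun v ↦ H v i j)) v := fun i j l ↦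
    ((hε.metric i j).fderiv_right (m := ∞) (by simp)).clm_apply contDiffAt_const
  have h3 : ∀ a k, ContDiffAt ℝ ∞ (fun u ↦ ε a u k) v := fun a k ↦
    (EuclideanSpace.proj k : EuclideanSpace ℝ (Fin n) →L[ℝ] ℝ).contDiff.contDiffAt.comp v
      (hε.frame a)
  refine ContDiffAt.congr_of_eventuallyEq ?_ h1
  refine contDiffAt_const.mul (ContDiffAt.sum fun l _ ↦ ContDiffAt.mul
    (ContDiffAt.sum fun a _ ↦ (h3 a k).mul (h3 a l)) (((h2 _ _ _).add (h2 _ _ _)).sub (h2 _ _ _)))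

/-- The derivative of the bilinear map given by the Christoffel symbols. -/
def dgam (H : EuclideanSpace ℝ (Fin n) → Matrix (Fin n) (Fin n) ℝ)
    (v z w x : EuclideanSpace ℝ (Fin n)) : EuclideanSpace ℝ (Fin n) :=
  WithLp.toLp 2 fun k ↦ ∑ i, ∑ j, fderiv ℝ (chr H k i j) v z * w i * x j

lemma hasFDerivAt_gam (hε : IsLocalFrame H ε v) (w : EuclideanSpace ℝ (Fin n))
    {X : EuclideanSpace ℝ (Fin n) → EuclideanSpace ℝ (Fin n)} (hX : DifferentiableAt ℝ X v) :
    DifferentiableAt ℝ (fun u ↦ gam H u w (X u)) v ∧ ∀ z,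
    fderiv ℝ (fun u ↦ gam H u w (X u)) v z = dgam H v z w (X v) + gam H v w (fderiv ℝ X v z) := by
  have hXj : ∀ j, HasFDerivAt (fun v ↦ X v j) ((EuclideanSpace.proj j).comp (fderiv ℝ X v)) v :=
    fun j ↦ (EuclideanSpace.proj j : EuclideanSpace ℝ (Fin n) →L[ℝ] ℝ).hasFDerivAt.comp v
      hX.hasFDerivAt
  have h1 : ∀ k, HasFDerivAt (fun u ↦ gam H u w (X u) k) _ v := fun k ↦
    HasFDerivAt.fun_sum (u := Finset.univ) fun i _ ↦ HasFDerivAt.fun_sum (u := Finset.univ)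
    fun j _ ↦ ((((contDiffAt_chr hε k i j).differentiableAt (by simp)).hasFDerivAt.mul_const
      (w i)).mul (hXj j))
  have hd : DifferentiableAt ℝ (fun u ↦ gam H u w (X u)) v :=
    (differentiableAt_euclidean).2 fun k ↦ (h1 k).differentiableAt
  refine ⟨hd, fun z ↦ ?_⟩
  ext k
  have h2 : fderiv ℝ (fun u ↦ gam H u w (X u) k) v z
      = fderiv ℝ (fun u ↦ gam H u w (X u)) v z k := by
    have := ((EuclideanSpace.proj k : EuclideanSpace ℝ (Fin n) →L[ℝ] ℝ).hasFDerivAt.comp v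
      hd.hasFDerivAt)
    erw [this.fderiv]
    rfl
  rw [← h2, (h1 k).fderiv]
  simp only [_root_.sum_apply, _root_.add_apply, _root_.smul_apply, smul_eq_mul, WithLp.ofLp_add,
    Pi.add_apply]
  change _ = (∑ i, ∑ j, fderiv ℝ (chr H k i j) v z * w i * X v j)
    + ∑ i, ∑ j, chr H k i j v * w i * fderiv ℝ X v z j
  simp only [← Finset.sum_add_distrib]
  refine Finset.sum_congr rfl fun i _ ↦ Finset.sum_congr rfl fun j _ ↦ ?_
  simp
  ring

end Coframe

section Surface

open VectorField

variable {H : EuclideanSpace ℝ (Fin 2) → Matrix (Fin 2) (Fin 2) ℝ}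
    {ε : Fin 2 → EuclideanSpace ℝ (Fin 2) → EuclideanSpace ℝ (Fin 2)}
    {v : EuclideanSpace ℝ (Fin 2)}

/-- In dimension two an alternating bilinear form is determined by its value on the pair `ε 0, ε 1`,
which the structure equation provides. -/
lemma fderiv_coframe_sub_surface (hε : IsLocalFrame H ε v) {F : Fin 2 → ℝ}
    (hF : lieBracket ℝ (ε 0) (ε 1) v = F 0 • ε 0 v + F 1 • ε 1 v) (a : Fin 2)
    (X Y : EuclideanSpace ℝ (Fin 2)) :
    fderiv ℝ (coframe H (ε a)) v X Y - fderiv ℝ (coframe H (ε a)) v Y X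
      = -(F a * (coframe H (ε 0) v X * coframe H (ε 1) v Y
        - coframe H (ε 1) v X * coframe H (ε 0) v Y)) := by
  have h1 := fderiv_coframe_sub hε a 0 1
  rw [hF, map_add, map_smul, map_smul, coframe_frame hε, coframe_frame hε] at h1
  have h2 : (F 0 • (if (0 : Fin 2) = a then (1 : ℝ) else 0)
      + F 1 • (if (1 : Fin 2) = a then (1 : ℝ) else 0)) = F a := by
    fin_cases a <;> simp
  rw [h2] at h1
  have hX := eq_sum_coframe hε X
  have hY := eq_sum_coframe hε Y
  rw [Fin.sum_univ_two] at hX hY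
  generalize coframe H (ε 0) v X = x0 at *
  generalize coframe H (ε 1) v X = x1 at *
  generalize coframe H (ε 0) v Y = y0 at *
  generalize coframe H (ε 1) v Y = y1 at *
  rw [hX, hY]
  simp only [map_add, map_smul, _root_.add_apply, _root_.smul_apply, smul_eq_mul]
  linear_combination (x0 * y1 - x1 * y0) * h1

/-- The connection form of an orthonormal frame on a surface. -/
def connForm (H : EuclideanSpace ℝ (Fin 2) → Matrix (Fin 2) (Fin 2) ℝ)
    (ε : Fin 2 → EuclideanSpace ℝ (Fin 2) → EuclideanSpace ℝ (Fin 2))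
    (F : Fin 2 → EuclideanSpace ℝ (Fin 2) → ℝ) (v : EuclideanSpace ℝ (Fin 2)) :
    EuclideanSpace ℝ (Fin 2) →L[ℝ] ℝ :=
  -(F 0 v • coframe H (ε 0) v + F 1 v • coframe H (ε 1) v)

/-- These are the equations `∇ε₀ = ω ε₁` and `∇ε₁ = -ω ε₀`, with `ω = connForm H ε F`, solved for
the ordinary derivatives. They are checked on the two frame directions with `bil_cov` and extended
linearly in `w`. -/
lemma fderiv_frame (hε : IsLocalFrame H ε v) {F : Fin 2 → EuclideanSpace ℝ (Fin 2) → ℝ}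
    (hF : lieBracket ℝ (ε 0) (ε 1) v = F 0 v • ε 0 v + F 1 v • ε 1 v)
    (w : EuclideanSpace ℝ (Fin 2)) :
    fderiv ℝ (ε 0) v w = -gam H v w (ε 0 v) + connForm H ε F v w • ε 1 v ∧
    fderiv ℝ (ε 1) v w = -gam H v w (ε 1 v) - connForm H ε F v w • ε 0 v := by
  have hF' : lieBracket ℝ (ε 1) (ε 0) v = -(F 0 v • ε 0 v + F 1 v • ε 1 v) := by
    rw [lieBracket_swap, hF]
  have ho := hε.orthonormal.self_of_nhds
  have hs : ∀ a, lieBracket ℝ (ε a) (ε a) v = 0 := fun a ↦ by rw [lieBracket_self]; rfl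
  have c : ∀ b, cov H (ε b) (ε 0) v = -F b v • ε 1 v ∧ cov H (ε b) (ε 1) v = F b v • ε 0 v := by
    intro b
    rw [hε.eq_sum (cov H (ε b) (ε 0) v), hε.eq_sum (cov H (ε b) (ε 1) v)]
    simp only [Fin.sum_univ_two, hε.bil_cov]
    fin_cases b
    · simp [hF, hF', hs, ho]
      constructor <;> module
    · simp [hF, hF', hs, ho]
      constructor <;> module
  simp only [cov_eq] at c
  have hw := eq_sum_coframe hε w
  rw [Fin.sum_univ_two] at hw
  have hω : connForm H ε F v w
      = -(F 0 v * coframe H (ε 0) v w + F 1 v * coframe H (ε 1) v w) := rfl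
  rw [hω]
  have k : ∀ a, fderiv ℝ (ε a) v w + gam H v w (ε a v)
      = coframe H (ε 0) v w • (fderiv ℝ (ε a) v (ε 0 v) + gam H v (ε 0 v) (ε a v))
      + coframe H (ε 1) v w • (fderiv ℝ (ε a) v (ε 1 v) + gam H v (ε 1 v) (ε a v)) := fun a ↦ by
    conv_lhs => rw [hw]
    simp only [map_add, map_smul, LinearMap.add_apply, LinearMap.smul_apply]
    module
  constructor
  · have := k 0
    rw [(c 0).1, (c 1).1] at this
    rw [eq_sub_of_add_eq this]
    module
  · have := k 1
    rw [(c 0).2, (c 1).2] at this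
    rw [eq_sub_of_add_eq this]
    module

lemma differentiableAt_connForm (hε : IsLocalFrame H ε v)
    {F : Fin 2 → EuclideanSpace ℝ (Fin 2) → ℝ} (hFd : ∀ a, DifferentiableAt ℝ (F a) v) :
    DifferentiableAt ℝ (connForm H ε F) v :=
  have hc a := (contDiffAt_coframe hε a).differentiableAt (by simp)
  (((hFd 0).smul (hc 0)).add ((hFd 1).smul (hc 1))).neg

/-- This evaluates `dω`: the derivatives of `F` contribute the linear terms, and the structure
equations for `dθ⁰, dθ¹` contribute the squares. -/
lemma fderiv_connForm_sub (hε : IsLocalFrame H ε v) {F : Fin 2 → EuclideanSpace ℝ (Fin 2) → ℝ}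
    (hF : lieBracket ℝ (ε 0) (ε 1) v = F 0 v • ε 0 v + F 1 v • ε 1 v)
    (hFd : ∀ a, DifferentiableAt ℝ (F a) v) (X Y : EuclideanSpace ℝ (Fin 2)) :
    fderiv ℝ (connForm H ε F) v X Y - fderiv ℝ (connForm H ε F) v Y X
      = (coframe H (ε 0) v X * coframe H (ε 1) v Y - coframe H (ε 1) v X * coframe H (ε 0) v Y)
        * (fderiv ℝ (F 0) v (ε 1 v) - fderiv ℝ (F 1) v (ε 0 v) + F 0 v ^ 2 + F 1 v ^ 2) := by
  have hc a := (contDiffAt_coframe hε a).differentiableAt (by simp)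
  have h1 := ((((hFd 0).hasFDerivAt.smul (hc 0).hasFDerivAt).add
    ((hFd 1).hasFDerivAt.smul (hc 1).hasFDerivAt)).neg)
  have h2 : fderiv ℝ (connForm H ε F) v = _ := h1.fderiv
  have e0 := fderiv_coframe_sub_surface hε (F := fun a ↦ F a v) hF 0 X Y
  have e1 := fderiv_coframe_sub_surface hε (F := fun a ↦ F a v) hF 1 X Y
  have hX := eq_sum_coframe hε X
  have hY := eq_sum_coframe hε Y
  rw [Fin.sum_univ_two] at hX hY
  have fX : ∀ a, fderiv ℝ (F a) v X = coframe H (ε 0) v X * fderiv ℝ (F a) v (ε 0 v)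
      + coframe H (ε 1) v X * fderiv ℝ (F a) v (ε 1 v) := fun a ↦ by
    conv_lhs => rw [hX]
    simp
  have fY : ∀ a, fderiv ℝ (F a) v Y = coframe H (ε 0) v Y * fderiv ℝ (F a) v (ε 0 v)
      + coframe H (ε 1) v Y * fderiv ℝ (F a) v (ε 1 v) := fun a ↦ by
    conv_lhs => rw [hY]
    simp
  rw [h2]
  simp only [_root_.neg_apply, _root_.add_apply, _root_.smul_apply,
    ContinuousLinearMap.smulRight_apply, smul_eq_mul, fX, fY]
  linear_combination (-F 0 v) * e0 - F 1 v * e1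

/-- The curvature operator `R(w, z) x` in coordinates. -/
def curvOp {n : ℕ} (H : EuclideanSpace ℝ (Fin n) → Matrix (Fin n) (Fin n) ℝ)
    (v w z x : EuclideanSpace ℝ (Fin n)) : EuclideanSpace ℝ (Fin n) :=
  dgam H v w z x - dgam H v z w x + gam H v w (gam H v z x) - gam H v z (gam H v w x)

/-- `fderiv_frame` holds in a neighbourhood, so it can be differentiated again. Equating the two
orders of the second derivative of `ε a` leaves the curvature operator on one side and `dω` on the
other; the terms quadratic in `ω` are symmetric and cancel. -/
lemma curvOp_frame (hε : IsLocalFrame H ε v) {F : Fin 2 → EuclideanSpace ℝ (Fin 2) → ℝ}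
    (hF : ∀ᶠ u in nhds v, lieBracket ℝ (ε 0) (ε 1) u = F 0 u • ε 0 u + F 1 u • ε 1 u)
    (hFd : ∀ a, DifferentiableAt ℝ (F a) v) (w z : EuclideanSpace ℝ (Fin 2)) :
    curvOp H v w z (ε 0 v) = (fderiv ℝ (connForm H ε F) v w z - fderiv ℝ (connForm H ε F) v z w)
      • ε 1 v ∧
    curvOp H v w z (ε 1 v) = -(fderiv ℝ (connForm H ε F) v w z - fderiv ℝ (connForm H ε F) v z w)
      • ε 0 v := by
  have hd a := (hε.frame a).differentiableAt (by simp)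
  have hω := (differentiableAt_connForm hε hFd).hasFDerivAt
  have hsym : ∀ a, fderiv ℝ (fderiv ℝ (ε a)) v w z = fderiv ℝ (fderiv ℝ (ε a)) v z w := fun a ↦
    ((hε.frame a).of_le two_le_infty).isSymmSndFDerivAt
      (by rw [minSmoothness_of_isRCLikeNormedField]) w z
  have hD : ∀ a, DifferentiableAt ℝ (fderiv ℝ (ε a)) v := fun a ↦
    (((hε.frame a).of_le two_le_infty).fderiv_right (m := 1) (by norm_num)).differentiableAt
      (by norm_num)
  have hDw : ∀ a w z, fderiv ℝ (fun u ↦ fderiv ℝ (ε a) u w) v z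
      = fderiv ℝ (fderiv ℝ (ε a)) v z w := fun a w z ↦ by
    rw [((hD a).hasFDerivAt.clm_apply (hasFDerivAt_const w v)).fderiv]
    simp
  have e0 : ∀ w z, fderiv ℝ (fderiv ℝ (ε 0)) v z w
      = -(dgam H v z w (ε 0 v) + gam H v w (fderiv ℝ (ε 0) v z))
      + (connForm H ε F v w • fderiv ℝ (ε 1) v z
        + fderiv ℝ (connForm H ε F) v z w • ε 1 v) := fun w z ↦ by
    have h1 : (fun u ↦ fderiv ℝ (ε 0) u w) =ᶠ[nhds v]
        fun u ↦ -gam H u w (ε 0 u) + connForm H ε F u w • ε 1 u := by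
      filter_upwards [hε.eventually, hF] with u hu hFu using (fderiv_frame hu hFu w).1
    obtain ⟨g1, g2⟩ := hasFDerivAt_gam hε w (hd 0)
    rw [← hDw, h1.fderiv_eq, ((g1.hasFDerivAt.fun_neg).fun_add
      ((hω.clm_apply (hasFDerivAt_const w v)).fun_smul (hd 1).hasFDerivAt)).fderiv]
    simp [g2]
  have e1 : ∀ w z, fderiv ℝ (fderiv ℝ (ε 1)) v z w
      = -(dgam H v z w (ε 1 v) + gam H v w (fderiv ℝ (ε 1) v z))
      - (connForm H ε F v w • fderiv ℝ (ε 0) v z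
        + fderiv ℝ (connForm H ε F) v z w • ε 0 v) := fun w z ↦ by
    have h1 : (fun u ↦ fderiv ℝ (ε 1) u w) =ᶠ[nhds v]
        fun u ↦ -gam H u w (ε 1 u) - connForm H ε F u w • ε 0 u := by
      filter_upwards [hε.eventually, hF] with u hu hFu using (fderiv_frame hu hFu w).2
    obtain ⟨g1, g2⟩ := hasFDerivAt_gam hε w (hd 1)
    rw [← hDw, h1.fderiv_eq, ((g1.hasFDerivAt.fun_neg).fun_sub
      ((hω.clm_apply (hasFDerivAt_const w v)).fun_smul (hd 0).hasFDerivAt)).fderiv]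
    simp [g2]
  have k w := fderiv_frame hε hF.self_of_nhds w
  constructor
  · have h1 := (e0 w z).symm.trans ((hsym 0).symm.trans (e0 z w))
    rw [(k z).1, (k w).1, (k z).2, (k w).2] at h1
    simp only [map_add, map_neg, map_smul] at h1
    rw [curvOp, ← sub_eq_zero]
    rw [← sub_eq_zero] at h1
    rw [← h1]
    module
  · have h1 := (e1 w z).symm.trans ((hsym 1).symm.trans (e1 z w))
    rw [(k z).1, (k w).1, (k z).2, (k w).2] at h1
    simp only [map_sub, map_neg, map_smul] at h1
    rw [curvOp, ← sub_eq_zero]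
    rw [← sub_eq_zero] at h1
    rw [← h1]
    module

lemma curvOp_add_smul {n : ℕ} (H : EuclideanSpace ℝ (Fin n) → Matrix (Fin n) (Fin n) ℝ)
    (v w z x y : EuclideanSpace ℝ (Fin n)) (a b : ℝ) :
    curvOp H v w z (a • x + b • y) = a • curvOp H v w z x + b • curvOp H v w z y := by
  have h : ∀ w z, dgam H v w z (a • x + b • y) = a • dgam H v w z x + b • dgam H v w z y :=
    fun w z ↦ by
    ext k
    simp only [dgam, WithLp.ofLp_add, WithLp.ofLp_smul, Pi.add_apply, Pi.smul_apply, smul_eq_mul,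
      Finset.mul_sum, ← Finset.sum_add_distrib]
    exact Finset.sum_congr rfl fun i _ ↦ Finset.sum_congr rfl fun j _ ↦ by ring
  simp only [curvOp, h, map_add, map_smul]
  module

lemma sum_curvature_eq (v : EuclideanSpace ℝ (Fin 2)) :
    ∑ l, H v 0 l * (partialDeriv 0 (chr H l 1 1) v - partialDeriv 1 (chr H l 0 1) v
      + ∑ m, (chr H l 0 m v * chr H m 1 1 v - chr H l 1 m v * chr H m 0 1 v))
      = bil (H v) (EuclideanSpace.single 0 1) (curvOp H v (EuclideanSpace.single 0 1)
        (EuclideanSpace.single 1 1) (EuclideanSpace.single 1 1)) := by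
  have h : ∀ l, curvOp H v (EuclideanSpace.single 0 1)
      (EuclideanSpace.single 1 1) (EuclideanSpace.single 1 1) l
      = partialDeriv 0 (chr H l 1 1) v - partialDeriv 1 (chr H l 0 1) v
      + ∑ m, (chr H l 0 m v * chr H m 1 1 v - chr H l 1 m v * chr H m 0 1 v) := fun l ↦ by
    simp [curvOp, dgam, gam, partialDeriv, Fin.sum_univ_two]
    ring
  simp_rw [← h, bil_apply, Fin.sum_univ_two]
  simp

/-- The Gauss curvature of a surface in terms of an orthonormal frame. -/
lemma sum_curvature_div_det (hε : IsLocalFrame H ε v) {F : Fin 2 → EuclideanSpace ℝ (Fin 2) → ℝ}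
    (hF : ∀ᶠ u in nhds v, lieBracket ℝ (ε 0) (ε 1) u = F 0 u • ε 0 u + F 1 u • ε 1 u)
    (hFd : ∀ a, DifferentiableAt ℝ (F a) v) :
    (∑ l, H v 0 l * (partialDeriv 0 (chr H l 1 1) v - partialDeriv 1 (chr H l 0 1) v
      + ∑ m, (chr H l 0 m v * chr H m 1 1 v - chr H l 1 m v * chr H m 0 1 v))) / (H v).det
      = -(fderiv ℝ (F 0) v (ε 1 v) - fderiv ℝ (F 1) v (ε 0 v) + F 0 v ^ 2 + F 1 v ^ 2) := by
  rw [sum_curvature_eq, div_eq_iff hε.det_ne_zero]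
  have hb : ∀ i j, H v i j = bil (H v) (EuclideanSpace.single i 1)
      (EuclideanSpace.single j 1) := fun i j ↦ by simp [bil_apply]
  rw [Matrix.det_fin_two, hb 0 0, hb 0 1, hb 1 0, hb 1 1]
  obtain ⟨c0, c1⟩ := curvOp_frame hε hF hFd (EuclideanSpace.single 0 1) (EuclideanSpace.single 1 1)
  rw [fderiv_connForm_sub hε hF.self_of_nhds hFd] at c0 c1
  generalize fderiv ℝ (F 0) v (ε 1 v) - fderiv ℝ (F 1) v (ε 0 v) + F 0 v ^ 2 + F 1 v ^ 2 = K at *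
  have h0 := eq_sum_coframe hε (EuclideanSpace.single 0 1)
  have h1 := eq_sum_coframe hε (EuclideanSpace.single 1 1)
  rw [Fin.sum_univ_two] at h0 h1
  have ho := hε.orthonormal.self_of_nhds
  generalize coframe H (ε 0) v (EuclideanSpace.single 0 1) = x0 at *
  generalize coframe H (ε 1) v (EuclideanSpace.single 0 1) = x1 at *
  generalize coframe H (ε 0) v (EuclideanSpace.single 1 1) = y0 at *
  generalize coframe H (ε 1) v (EuclideanSpace.single 1 1) = y1 at *
  -- In the coframe components of the two coordinate vectors, numerator and Gram determinant are
  -- both multiples of the squared area `(x0 * y1 - x1 * y0) ^ 2`, and the quotient is `-K`.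
  have h2 : curvOp H v (EuclideanSpace.single 0 1) (EuclideanSpace.single 1 1)
      (EuclideanSpace.single 1 1) = (y0 * ((x0 * y1 - x1 * y0) * K)) • ε 1 v
        - (y1 * ((x0 * y1 - x1 * y0) * K)) • ε 0 v := by
    conv_lhs => rw [show (EuclideanSpace.single 1 1 : EuclideanSpace ℝ (Fin 2))
      = y0 • ε 0 v + y1 • ε 1 v from h1]
    rw [curvOp_add_smul]
    rw [← h1, c0, c1]
    module
  rw [h2, h0, h1]
  simp [ho]
  ring

end Surface

end BiharmonicSubmersion
end

open scoped Manifold ContDiff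
noncomputable section
namespace BiharmonicSubmersion

/-! ### Gauss curvature of the base and its pullback; smoothness of the integrability data. -/

section GaussCurvature

open VectorField

lemma rep_linear {n : ℕ} {N : Type*} [TopologicalSpace N]
    [ChartedSpace (EuclideanSpace ℝ (Fin n)) N] [IsManifold (𝓡 n) ∞ N] {y₀ : N}
    {v : EuclideanSpace ℝ (Fin n)} {X Y Z : (y : N) → TangentSpace (𝓡 n) y} {a b : ℝ}
    (hZ : Z ((extChartAt (𝓡 n) y₀).symm v) = a • X ((extChartAt (𝓡 n) y₀).symm v)
      + b • Y ((extChartAt (𝓡 n) y₀).symm v)) : rep y₀ Z v = a • rep y₀ X v + b • rep y₀ Y v := by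
  simp only [rep, mpullback_apply, hZ, map_add, map_smul]
  rfl

variable {M N : Type*}
  [TopologicalSpace M] [ChartedSpace (EuclideanSpace ℝ (Fin 3)) M] [IsManifold (𝓡 3) ∞ M]
  [TopologicalSpace N] [ChartedSpace (EuclideanSpace ℝ (Fin 2)) N] [IsManifold (𝓡 2) ∞ N]
  {g : SmoothMetric 3 M} {h : SmoothMetric 2 N} {π : M → N} {U : Set M} {V : Set N}
  {e₁ e₂ e₃ : (p : M) → TangentSpace (𝓡 3) p} {ε₁ ε₂ : (y : N) → TangentSpace (𝓡 2) y}

/-- The coefficients are not assumed smooth; on `V` they equal inner products of smooth fields. -/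
lemma contMDiffAt_bracket_coeff {ε : Fin 2 → (y : N) → TangentSpace (𝓡 2) y} (hV : IsOpen V)
    (hε : IsOrthonormalOn h V ε) {F : Fin 2 → N → ℝ}
    (hF : ∀ y ∈ V, mlieBracket (𝓡 2) (ε 0) (ε 1) y = F 0 y • ε 0 y + F 1 y • ε 1 y) {y : N}
    (hy : y ∈ V) (a : Fin 2) : ContMDiffAt (𝓡 2) 𝓘(ℝ, ℝ) ∞ (F a) y := by
  refine (h.contMDiffAt_inner (b := id) (contMDiffAt_mlieBracket (hε.contMDiffAt hV hy 0)
    (hε.contMDiffAt hV hy 1)) (hε.contMDiffAt hV hy a)).congr_of_eventuallyEq ?_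
  filter_upwards [hV.mem_nhds hy] with z hz
  rw [hF z hz]
  simp only [map_add, map_smul, _root_.add_apply, _root_.smul_apply, id, hε.orthonormal z hz]
  fin_cases a <;> simp

/-- The Gauss curvature in terms of an orthonormal frame. -/
theorem gaussCurvature_eq_frame {ε : Fin 2 → (y : N) → TangentSpace (𝓡 2) y} (hV : IsOpen V)
    (hε : IsOrthonormalOn h V ε) {F : Fin 2 → N → ℝ}
    (hF : ∀ y ∈ V, mlieBracket (𝓡 2) (ε 0) (ε 1) y = F 0 y • ε 0 y + F 1 y • ε 1 y) {y : N}
    (hy : y ∈ V) : gaussCurvature h y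
      = -(dirDeriv (ε 1) (F 0) y - dirDeriv (ε 0) (F 1) y + F 0 y ^ 2 + F 1 y ^ 2) := by
  have hv := mem_extChartAt_target (I := 𝓡 2) y
  have hvy : (extChartAt (𝓡 2) y).symm (extChartAt (𝓡 2) y y) = y := extChartAt_to_inv y
  have hFs := fun a ↦ contMDiffAt_bracket_coeff hV hε hF hy a
  have hfr := isLocalFrame_rep h hV hε hv (by rwa [hvy])
  have hFc : ∀ a, DifferentiableAt ℝ (fun u ↦ F a ((extChartAt (𝓡 2) y).symm u))
      (extChartAt (𝓡 2) y y) := fun a ↦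
    (ContMDiffAt.contDiffAt (ContMDiffAt.comp _ (g := F a) (by rw [hvy]; exact hFs a)
      (contMDiffAt_extChartAt_symm hv))).differentiableAt (by simp)
  have hF' : ∀ᶠ u in nhds (extChartAt (𝓡 2) y y),
      lieBracket ℝ (rep y (ε 0)) (rep y (ε 1)) u = F 0 ((extChartAt (𝓡 2) y).symm u) •
        rep y (ε 0) u + F 1 ((extChartAt (𝓡 2) y).symm u) • rep y (ε 1) u := by
    filter_upwards [(isOpen_extChartAt_target y).mem_nhds hv,
      tendsto_extChartAt_symm y (hV.mem_nhds hy)] with u hu huV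
    rw [← rep_mlieBracket hu (hε.contMDiffAt hV huV 0) (hε.contMDiffAt hV huV 1)]
    exact rep_linear (hF _ huV)
  have key := sum_curvature_div_det hfr (F := fun a u ↦ F a ((extChartAt (𝓡 2) y).symm u)) hF' hFc
  have hdd : ∀ a b, fderiv ℝ (fun u ↦ F a ((extChartAt (𝓡 2) y).symm u)) (extChartAt (𝓡 2) y y)
      (rep y (ε b) (extChartAt (𝓡 2) y y)) = dirDeriv (ε b) (F a) y := fun a b ↦ by
    rw [← dirDeriv_eq_fderiv (ε b) hv (by rw [hvy]; exact (hFs a).mdifferentiableAt (by simp)), hvy]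
  rw [hdd, hdd, hvy] at key
  exact key

lemma dirDeriv_comp_of_related {m n : ℕ} {M N : Type*}
    [TopologicalSpace M] [ChartedSpace (EuclideanSpace ℝ (Fin m)) M] [TopologicalSpace N]
    [ChartedSpace (EuclideanSpace ℝ (Fin n)) N] {φ : M → N} {F : N → ℝ} {p : M}
    {X : (p : M) → TangentSpace (𝓡 m) p} {Y : (y : N) → TangentSpace (𝓡 n) y}
    (hφ : MDifferentiableAt (𝓡 m) (𝓡 n) φ p) (hF : MDifferentiableAt (𝓡 n) 𝓘(ℝ, ℝ) F (φ p))
    (hr : mfderiv (𝓡 m) (𝓡 n) φ p (X p) = Y (φ p)) :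
    dirDeriv X (fun q ↦ F (φ q)) p = dirDeriv Y F (φ p) := by
  have := mfderiv_comp_apply p hF hφ (X p)
  rw [hr] at this
  exact this

namespace IsAdaptedFrame

variable {f₁ f₂ κ₁ κ₂ σ : M → ℝ} {F₁ F₂ : N → ℝ}

lemma contMDiffAt_base (hf : IsAdaptedFrame g h π U V e₁ e₂ e₃ ε₁ ε₂)
    (hF : ∀ y ∈ V, mlieBracket (𝓡 2) ε₁ ε₂ y = F₁ y • ε₁ y + F₂ y • ε₂ y) {y : N} (hy : y ∈ V) :
    ContMDiffAt (𝓡 2) 𝓘(ℝ, ℝ) ∞ F₁ y ∧ ContMDiffAt (𝓡 2) 𝓘(ℝ, ℝ) ∞ F₂ y :=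
  have := contMDiffAt_bracket_coeff hf.isOpen_target hf.baseFrame (F := ![F₁, F₂]) hF hy
  ⟨this 0, this 1⟩

lemma dirDeriv_pullback (hπ : ContMDiff (𝓡 3) (𝓡 2) ∞ π)
    (hf : IsAdaptedFrame g h π U V e₁ e₂ e₃ ε₁ ε₂) {F : N → ℝ} {f : M → ℝ}
    (hF : ∀ y ∈ V, ContMDiffAt (𝓡 2) 𝓘(ℝ, ℝ) ∞ F y) (hfF : ∀ p ∈ U, f p = F (π p)) {p : M}
    (hp : p ∈ U) : ContMDiffAt (𝓡 3) 𝓘(ℝ, ℝ) ∞ f p ∧ dirDeriv e₁ f p = dirDeriv ε₁ F (π p) ∧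
      dirDeriv e₂ f p = dirDeriv ε₂ F (π p) := by
  have h1 : f =ᶠ[nhds p] fun q ↦ F (π q) :=
    Filter.eventually_of_mem (hf.isOpen_source.mem_nhds hp) hfF
  have hFp := hF _ (hf.mapsTo hp)
  have hFd := hFp.mdifferentiableAt (n := ∞) (by simp)
  have hπd := (hπ p).mdifferentiableAt (by simp)
  refine ⟨(hFp.comp p (hπ p)).congr_of_eventuallyEq h1, ?_, ?_⟩
  · rw [dirDeriv_congr h1, dirDeriv_comp_of_related hπd hFd (hf.related₁ p hp)]
  · rw [dirDeriv_congr h1, dirDeriv_comp_of_related hπd hFd (hf.related₂ p hp)]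

theorem gaussCurvature_eq (hπ : ContMDiff (𝓡 3) (𝓡 2) ∞ π)
    (hf : IsAdaptedFrame g h π U V e₁ e₂ e₃ ε₁ ε₂)
    (hd : IsIntegrabilityData π U V e₁ e₂ e₃ ε₁ ε₂ f₁ f₂ κ₁ κ₂ σ) {p : M} (hp : p ∈ U) :
    gaussCurvature h (π p)
      = -(dirDeriv e₂ f₁ p - dirDeriv e₁ f₂ p + f₁ p ^ 2 + f₂ p ^ 2) := by
  obtain ⟨F₁, F₂, hF, hf₁, hf₂⟩ := hd.base
  have h1 := gaussCurvature_eq_frame hf.isOpen_target hf.baseFrame (F := ![F₁, F₂]) hF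
    (hf.mapsTo hp)
  change gaussCurvature h (π p) = -(dirDeriv ε₂ F₁ (π p) - dirDeriv ε₁ F₂ (π p)
    + F₁ (π p) ^ 2 + F₂ (π p) ^ 2) at h1
  rw [h1, (hf.dirDeriv_pullback hπ (fun y hy ↦ (hf.contMDiffAt_base hF hy).1) hf₁ hp).2.2,
    (hf.dirDeriv_pullback hπ (fun y hy ↦ (hf.contMDiffAt_base hF hy).2) hf₂ hp).2.1,
    hf₁ p hp, hf₂ p hp]

lemma contMDiffAt_kappa (hf : IsAdaptedFrame g h π U V e₁ e₂ e₃ ε₁ ε₂)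
    (hd : IsIntegrabilityData π U V e₁ e₂ e₃ ε₁ ε₂ f₁ f₂ κ₁ κ₂ σ) {p : M} (hp : p ∈ U) :
    ContMDiffAt (𝓡 3) 𝓘(ℝ, ℝ) ∞ κ₁ p ∧ ContMDiffAt (𝓡 3) 𝓘(ℝ, ℝ) ∞ κ₂ p := by
  have hU := hf.isOpen_source
  have hs := fun i ↦ hf.frame.contMDiffAt hU hp i
  constructor
  · refine (g.contMDiffAt_inner (b := id) (contMDiffAt_mlieBracket (hs 0) (hs 2))
      (hs 2)).congr_of_eventuallyEq ?_
    filter_upwards [hU.mem_nhds hp] with q hq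
    change κ₁ q = g.inner q (mlieBracket (𝓡 3) e₁ e₃ q) (e₃ q)
    rw [hd.bracket₁₃ q hq]
    simp [(hf.inner_eq hq).2.2.2.2.2.2.2.2]
  · refine (g.contMDiffAt_inner (b := id) (contMDiffAt_mlieBracket (hs 1) (hs 2))
      (hs 2)).congr_of_eventuallyEq ?_
    filter_upwards [hU.mem_nhds hp] with q hq
    change κ₂ q = g.inner q (mlieBracket (𝓡 3) e₂ e₃ q) (e₃ q)
    rw [hd.bracket₂₃ q hq]
    simp [(hf.inner_eq hq).2.2.2.2.2.2.2.2]

end IsAdaptedFrame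

end GaussCurvature

end BiharmonicSubmersion
end

open scoped Manifold ContDiff
noncomputable section
namespace BiharmonicSubmersion

/-! ### Variations of maps -/

section Families

/-- Time and space derivatives commute because the second derivative of `ψ` on the product is
symmetric. -/
lemma hasDerivAt_fderiv_family {E F : Type*} [NormedAddCommGroup E] [NormedSpace ℝ E]
    [NormedAddCommGroup F] [NormedSpace ℝ F] {ψ : ℝ × E → F} {u : E}
    (hψ : ContDiffAt ℝ 2 ψ (0, u)) (w : E) :
    DifferentiableAt ℝ (fun v ↦ deriv (fun t ↦ ψ (t, v)) 0) u ∧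
    HasDerivAt (fun t ↦ fderiv ℝ (fun v ↦ ψ (t, v)) u w)
      (fderiv ℝ (fun v ↦ deriv (fun t ↦ ψ (t, v)) 0) u w) 0 := by
  have h1 : ∀ᶠ q in nhds ((0 : ℝ), u), DifferentiableAt ℝ ψ q :=
    (hψ.eventually (by simp)).mono fun q hq ↦ hq.differentiableAt (by norm_num)
  have hD : HasFDerivAt (fderiv ℝ ψ) (fderiv ℝ (fderiv ℝ ψ) (0, u)) (0, u) :=
    ((hψ.fderiv_right (m := 1) (by norm_num)).differentiableAt (by norm_num)).hasFDerivAt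
  have hl : HasFDerivAt (fun t : ℝ ↦ (t, u)) (ContinuousLinearMap.inl ℝ ℝ E) 0 :=
    hasFDerivAt_prodMk_left 0 u
  have hr : HasFDerivAt (fun v : E ↦ ((0 : ℝ), v)) (ContinuousLinearMap.inr ℝ ℝ E) u :=
    hasFDerivAt_prodMk_right 0 u
  have hsym := hψ.isSymmSndFDerivAt (by rw [minSmoothness_of_isRCLikeNormedField])
  have e1 : (fun t ↦ fderiv ℝ (fun v ↦ ψ (t, v)) u w)
      =ᶠ[nhds 0] fun t ↦ fderiv ℝ ψ (t, u) ((0 : ℝ), w) := by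
    filter_upwards [hl.continuousAt.eventually h1] with t ht
    have h2 : HasFDerivAt (fun v ↦ ψ (t, v)) _ u :=
      ht.hasFDerivAt.comp u (hasFDerivAt_prodMk_right t u)
    rw [h2.fderiv]
    rfl
  have e2 : (fun v ↦ deriv (fun t ↦ ψ (t, v)) 0)
      =ᶠ[nhds u] fun v ↦ fderiv ℝ ψ ((0 : ℝ), v) ((1 : ℝ), (0 : E)) := by
    filter_upwards [hr.continuousAt.eventually h1] with v hv
    have h2 : HasFDerivAt (fun t ↦ ψ (t, v)) _ 0 :=
      hv.hasFDerivAt.comp (0 : ℝ) (hasFDerivAt_prodMk_left 0 v)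
    rw [h2.hasDerivAt.deriv]
    rfl
  have d2 : HasFDerivAt (fun v ↦ fderiv ℝ ψ ((0 : ℝ), v) ((1 : ℝ), (0 : E))) _ u :=
    (hD.comp u hr).clm_apply (hasFDerivAt_const ((1 : ℝ), (0 : E)) u)
  have d1 : HasFDerivAt (fun t ↦ fderiv ℝ ψ (t, u) ((0 : ℝ), w)) _ 0 :=
    (hD.comp (0 : ℝ) hl).clm_apply (hasFDerivAt_const ((0 : ℝ), w) (0 : ℝ))
  have d2' : HasFDerivAt (fun v ↦ deriv (fun t ↦ ψ (t, v)) 0) _ u := d2.congr_of_eventuallyEq e2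
  refine ⟨d2'.differentiableAt, ?_⟩
  refine HasDerivAt.congr_of_eventuallyEq ?_ e1
  convert d1.hasDerivAt using 1
  rw [d2'.fderiv]
  simp [hsym.eq ((0 : ℝ), w) ((1 : ℝ), (0 : E))]

variable {m n : ℕ} {M N : Type*}
  [TopologicalSpace M] [ChartedSpace (EuclideanSpace ℝ (Fin m)) M] [IsManifold (𝓡 m) ∞ M]
  [TopologicalSpace N] [ChartedSpace (EuclideanSpace ℝ (Fin n)) N] [IsManifold (𝓡 n) ∞ N]

lemma contMDiffAt_deriv_family {EP HP P : Type*}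
    [NormedAddCommGroup EP] [NormedSpace ℝ EP] [TopologicalSpace HP] [TopologicalSpace P]
    [ChartedSpace HP P] {J : ModelWithCorners ℝ EP HP} [IsManifold J ∞ P]
    {S : P → ℝ → ℝ} {c : P → ℝ} {p₀ : P}
    (hS : ContMDiffAt (J.prod 𝓘(ℝ, ℝ)) 𝓘(ℝ, ℝ) ∞ (Function.uncurry S) (p₀, c p₀))
    (hc : ContMDiffAt J 𝓘(ℝ, ℝ) ∞ c p₀) :
    ContMDiffAt J 𝓘(ℝ, ℝ) ∞ (fun p ↦ deriv (S p) (c p)) p₀ := by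
  have := (contMDiffAt_section_vectorSpace.1 (ContMDiffAt.mfderiv_section hS
    (v := fun _ ↦ (1 : ℝ)) (contMDiffAt_section_vectorSpace.2 ⟨hc, contMDiffAt_const⟩))).2
  simp only [mfderiv_eq_fderiv] at this
  exact this

lemma contDiffAt_family_chart {Q EQ HQ : Type*} [NormedAddCommGroup EQ] [NormedSpace ℝ EQ]
    [TopologicalSpace HQ] [TopologicalSpace Q] [ChartedSpace HQ Q] {J : ModelWithCorners ℝ EQ HQ}
    {Φ : ℝ → M → Q} {t : ℝ} {x₀ : M} {u : EuclideanSpace ℝ (Fin m)}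
    (hu : u ∈ (extChartAt (𝓡 m) x₀).target)
    (hΦ : ContMDiffAt (𝓘(ℝ, ℝ).prod (𝓡 m)) J ∞ (Function.uncurry Φ)
      (t, (extChartAt (𝓡 m) x₀).symm u)) :
    ContMDiffAt 𝓘(ℝ, ℝ × EuclideanSpace ℝ (Fin m)) J ∞
      (fun q : ℝ × EuclideanSpace ℝ (Fin m) ↦ Φ q.1 ((extChartAt (𝓡 m) x₀).symm q.2)) (t, u) :=
  ContMDiffAt.comp (t, u) (g := Function.uncurry Φ)
    (f := fun q : ℝ × EuclideanSpace ℝ (Fin m) ↦ (q.1, (extChartAt (𝓡 m) x₀).symm q.2)) hΦ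
    (ContMDiffAt.prodMk contDiffAt_fst.contMDiffAt
      (ContMDiffAt.comp (t, u) (g := (extChartAt (𝓡 m) x₀).symm)
        (contMDiffAt_extChartAt_symm hu) contDiffAt_snd.contMDiffAt))

/-- Directional derivatives commute with differentiation with respect to a parameter. -/
lemma hasDerivAt_dirDeriv_family {S : ℝ → M → ℝ} {x : M} (X : (p : M) → TangentSpace (𝓡 m) p)
    (hS : ContMDiffAt (𝓘(ℝ, ℝ).prod (𝓡 m)) 𝓘(ℝ, ℝ) ∞ (Function.uncurry S) (0, x)) :
    HasDerivAt (fun t ↦ dirDeriv X (S t) x)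
      (dirDeriv X (fun y ↦ deriv (fun t ↦ S t y) 0) x) 0 := by
  have hu := mem_extChartAt_target (I := 𝓡 m) x
  have hux : (extChartAt (𝓡 m) x).symm (extChartAt (𝓡 m) x x) = x := extChartAt_to_inv x
  have hψ := (contDiffAt_family_chart (Φ := S) (t := 0) hu (by rwa [hux])).contDiffAt
  have key := (hasDerivAt_fderiv_family (hψ.of_le two_le_infty)
    (rep x X (extChartAt (𝓡 m) x x))).2
  have hV : ContMDiffAt (𝓡 m) 𝓘(ℝ, ℝ) ∞ (fun y ↦ deriv (fun t ↦ S t y) 0) x :=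
    contMDiffAt_deriv_family (S := fun y t ↦ S t y) (c := fun _ ↦ 0)
      (hS.comp (x, (0 : ℝ)) (contMDiffAt_snd.prodMk contMDiffAt_fst)) contMDiffAt_const
  have e1 := dirDeriv_eq_fderiv X hu (f := fun y ↦ deriv (fun t ↦ S t y) 0)
    (by rw [hux]; exact hV.mdifferentiableAt (by simp))
  rw [hux] at e1
  rw [e1]
  refine key.congr_of_eventuallyEq ?_
  have h1 : ∀ᶠ q in nhds ((0 : ℝ), x), ContMDiffAt (𝓘(ℝ, ℝ).prod (𝓡 m)) 𝓘(ℝ, ℝ) 1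
      (Function.uncurry S) q :=
    (contMDiffAt_iff_contMDiffAt_nhds (by simp)).1 (ContMDiffAt.of_le hS (by simp))
  have hc : ContinuousAt (fun t : ℝ ↦ (t, x)) 0 := by fun_prop
  filter_upwards [hc.eventually h1] with t ht
  have h2 : MDifferentiableAt (𝓡 m) 𝓘(ℝ, ℝ) (S t) x :=
    (ContMDiffAt.comp x (g := Function.uncurry S) (f := fun y ↦ (t, y)) ht
      (contMDiffAt_const.prodMk contMDiffAt_id)).mdifferentiableAt (by simp)
  have e2 := dirDeriv_eq_fderiv X hu (f := S t) (by rwa [hux])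
  rwa [hux] at e2

/-- The component `⟨∂ₜ Φ, Y⟩` of the variation field of a variation `Φ`, at time `0`. -/
def varCoeff (h : SmoothMetric n N) (Φ : ℝ → M → N) (Y : (y : N) → TangentSpace (𝓡 n) y)
    (x : M) : ℝ :=
  h.inner (Φ 0 x) (mfderiv 𝓘(ℝ, ℝ) (𝓡 n) (fun t ↦ Φ t x) 0 (1 : ℝ)) (Y (Φ 0 x))

lemma contMDiffAt_varCoeff (h : SmoothMetric n N) {Φ : ℝ → M → N}
    (hΦ : ContMDiff (𝓘(ℝ, ℝ).prod (𝓡 m)) (𝓡 n) ∞ (fun q : ℝ × M ↦ Φ q.1 q.2))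
    {Y : (y : N) → TangentSpace (𝓡 n) y} {x : M}
    (hY : ContMDiffAt (𝓡 n) (𝓡 n).tangent ∞ (fun y ↦ (⟨y, Y y⟩ : TangentBundle (𝓡 n) N))
      (Φ 0 x)) : ContMDiffAt (𝓡 m) 𝓘(ℝ, ℝ) ∞ (varCoeff h Φ Y) x := by
  refine h.contMDiffAt_inner (b := fun y ↦ Φ 0 y) ?_ ?_
  · refine ContMDiffAt.mfderiv_section (f := fun y t ↦ Φ t y) (c := fun _ : M ↦ (0 : ℝ))
      (v := fun _ ↦ (1 : ℝ)) ?_ (contMDiffAt_section_vectorSpace.2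
        ⟨contMDiffAt_const, contMDiffAt_const⟩)
    exact (hΦ (0, x)).comp (x, (0 : ℝ)) (contMDiffAt_snd.prodMk contMDiffAt_fst)
  · exact ContMDiffAt.comp x hY (ContMDiffAt.comp x (g := fun q : ℝ × M ↦ Φ q.1 q.2) (hΦ (0, x))
      (contMDiffAt_const.prodMk contMDiffAt_id))

lemma hasDerivAt_comp_family (h : SmoothMetric n N) {V : Set N} (hV : IsOpen V)
    {ε : Fin n → (y : N) → TangentSpace (𝓡 n) y} (hε : IsOrthonormalOn h V ε)
    {Φ : ℝ → M → N} {x : M}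
    (hΦ : ContMDiff (𝓘(ℝ, ℝ).prod (𝓡 m)) (𝓡 n) ∞ (fun q : ℝ × M ↦ Φ q.1 q.2))
    (hx : Φ 0 x ∈ V) {F : N → ℝ} (hF : ContMDiffAt (𝓡 n) 𝓘(ℝ, ℝ) ∞ F (Φ 0 x)) :
    HasDerivAt (fun t ↦ F (Φ t x)) (∑ a, varCoeff h Φ (ε a) x * dirDeriv (ε a) F (Φ 0 x)) 0 := by
  have hc : ContMDiffAt 𝓘(ℝ, ℝ) (𝓡 n) ∞ (fun t ↦ Φ t x) 0 :=
    ContMDiffAt.comp (0 : ℝ) (g := fun q : ℝ × M ↦ Φ q.1 q.2) (hΦ (0, x))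
      (contMDiffAt_id.prodMk contMDiffAt_const)
  have hFd := hF.mdifferentiableAt (n := ∞) (by simp)
  have hcd := hc.mdifferentiableAt (by simp)
  have h1 : DifferentiableAt ℝ (fun t ↦ F (Φ t x)) 0 :=
    mdifferentiableAt_iff_differentiableAt.1 (hFd.comp (0 : ℝ) hcd)
  have h2 := mfderiv_comp_apply (0 : ℝ) hFd hcd (1 : ℝ)
  have h3 := hε.eq_sum hV hx (mfderiv 𝓘(ℝ, ℝ) (𝓡 n) (fun t ↦ Φ t x) 0 (1 : ℝ))
  rw [h3, map_sum, mfderiv_eq_fderiv] at h2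
  simp only [map_smul] at h2
  exact h1.hasDerivAt.congr_deriv h2

end Families

/-! ### Variation of the differential of a map into a surface. -/

section Surface

open VectorField

variable {m : ℕ} {M N : Type*}
  [TopologicalSpace M] [ChartedSpace (EuclideanSpace ℝ (Fin m)) M] [IsManifold (𝓡 m) ∞ M]
  [TopologicalSpace N] [ChartedSpace (EuclideanSpace ℝ (Fin 2)) N] [IsManifold (𝓡 2) ∞ N]

/-- The derivative of the components of the differential along a variation. -/
theorem hasDerivAt_frameDiff (h : SmoothMetric 2 N) {V : Set N} (hV : IsOpen V)
    {ε : Fin 2 → (y : N) → TangentSpace (𝓡 2) y} (hε : IsOrthonormalOn h V ε) {F : Fin 2 → N → ℝ}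
    (hF : ∀ y ∈ V, mlieBracket (𝓡 2) (ε 0) (ε 1) y = F 0 y • ε 0 y + F 1 y • ε 1 y)
    {Φ : ℝ → M → N} {x : M}
    (hΦ : ContMDiff (𝓘(ℝ, ℝ).prod (𝓡 m)) (𝓡 2) ∞ (fun q : ℝ × M ↦ Φ q.1 q.2))
    (hx : Φ 0 x ∈ V) (X : (p : M) → TangentSpace (𝓡 m) p) (a : Fin 2) :
    HasDerivAt (fun t ↦ frameDiff h (Φ t) X (ε a) x)
      (dirDeriv X (varCoeff h Φ (ε a)) x - F a (Φ 0 x)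
        * (varCoeff h Φ (ε 0) x * frameDiff h (Φ 0) X (ε 1) x
          - varCoeff h Φ (ε 1) x * frameDiff h (Φ 0) X (ε 0) x)) 0 := by
  have hu := mem_extChartAt_target (I := 𝓡 m) x
  have hux : (extChartAt (𝓡 m) x).symm (extChartAt (𝓡 m) x x) = x := extChartAt_to_inv x
  set u₀ := extChartAt (𝓡 m) x x with hu₀
  set y₀ := Φ 0 x with hy₀
  have hv := mem_extChartAt_target (I := 𝓡 2) y₀
  have hvy : (extChartAt (𝓡 2) y₀).symm (extChartAt (𝓡 2) y₀ y₀) = y₀ := extChartAt_to_inv y₀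
  set ψ : ℝ × EuclideanSpace ℝ (Fin m) → EuclideanSpace ℝ (Fin 2) :=
    fun q ↦ extChartAt (𝓡 2) y₀ (Φ q.1 ((extChartAt (𝓡 m) x).symm q.2)) with hψ_def
  have hψ0 : ψ (0, u₀) = extChartAt (𝓡 2) y₀ y₀ := by simp only [hψ_def, hux]; rfl
  have hψ : ContDiffAt ℝ ∞ ψ (0, u₀) := by
    refine ContMDiffAt.contDiffAt (ContMDiffAt.comp _ (g := extChartAt (𝓡 2) y₀) (I' := 𝓡 2) ?_
      (contDiffAt_family_chart hu (hΦ _)))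
    simp only [hux]
    exact contMDiffAt_extChartAt
  have hψd := hψ.differentiableAt (by simp)
  set H := gram h y₀
  set w := rep x X u₀
  have hfr : IsLocalFrame H (fun a ↦ rep y₀ (ε a)) (ψ (0, u₀)) := by
    rw [hψ0]
    exact isLocalFrame_rep h hV hε hv (by rwa [hvy])
  obtain ⟨k1, k2⟩ := hasDerivAt_fderiv_family (hψ.of_le two_le_infty) w
  have hsl : ∀ t y, MDifferentiableAt (𝓡 m) (𝓡 2) (Φ t) y := fun t y ↦
    (ContMDiffAt.comp y (g := fun q : ℝ × M ↦ Φ q.1 q.2) (f := fun y ↦ (t, y)) (hΦ (t, y))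
      (contMDiffAt_const.prodMk contMDiffAt_id)).mdifferentiableAt (by simp)
  have hst : ∀ y, MDifferentiableAt 𝓘(ℝ, ℝ) (𝓡 2) (fun t ↦ Φ t y) 0 := fun y ↦
    (ContMDiffAt.comp (0 : ℝ) (g := fun q : ℝ × M ↦ Φ q.1 q.2) (f := fun t ↦ (t, y)) (hΦ (0, y))
      (contMDiffAt_id.prodMk contMDiffAt_const)).mdifferentiableAt (by simp)
  have hsrc : ∀ᶠ q in nhds ((0 : ℝ), x), Φ q.1 q.2 ∈ (extChartAt (𝓡 2) y₀).source :=
    (hΦ (0, x)).continuousAt ((isOpen_extChartAt_source y₀).mem_nhds (mem_extChartAt_source _))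
  have hA : ∀ t b, Φ t x ∈ (extChartAt (𝓡 2) y₀).source → frameDiff h (Φ t) X (ε b) x
      = coframe H (rep y₀ (ε b)) (ψ (t, u₀)) (fderiv ℝ (fun v ↦ ψ (t, v)) u₀ w) := fun t b ht ↦ by
    have := frameDiff_eq_bil h (φ := Φ t) (y₀ := y₀) hu X (ε b) (hsl _ _) (by rwa [hux])
    rw [coframe_apply, ← this, hux]
  have hB : ∀ y b, Φ 0 y ∈ (extChartAt (𝓡 2) y₀).source → varCoeff h Φ (ε b) y
      = coframe H (rep y₀ (ε b)) (extChartAt (𝓡 2) y₀ (Φ 0 y))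
        (deriv (fun t ↦ extChartAt (𝓡 2) y₀ (Φ t y)) 0) := fun y b hy ↦ by
    refine (inner_mfderiv_eq_bil h (φ := fun t ↦ Φ t y) (p := (0 : ℝ)) (1 : ℝ) y₀ (ε b) (hst y)
      hy).trans ?_
    rw [coframe_apply, mfderiv_eq_fderiv]
    rfl
  have ht0 : ∀ᶠ t in nhds (0 : ℝ), Φ t x ∈ (extChartAt (𝓡 2) y₀).source :=
    (show ContinuousAt (fun t : ℝ ↦ (t, x)) 0 by fun_prop).eventually hsrc
  have hu0 : ∀ᶠ v in nhds u₀, Φ 0 ((extChartAt (𝓡 m) x).symm v)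
      ∈ (extChartAt (𝓡 2) y₀).source :=
    (tendsto_extChartAt_symm x).eventually
      ((show ContinuousAt (fun y : M ↦ ((0 : ℝ), y)) x by fun_prop).eventually hsrc)
  have hθ : HasFDerivAt (coframe H (rep y₀ (ε a)))
      (fderiv ℝ (coframe H (rep y₀ (ε a))) (ψ (0, u₀))) (ψ (0, u₀)) :=
    ((contDiffAt_coframe hfr a).differentiableAt (by simp)).hasFDerivAt
  have hl : HasFDerivAt (fun t : ℝ ↦ ψ (t, u₀)) _ 0 :=
    HasFDerivAt.comp (g := ψ) (f := fun t : ℝ ↦ (t, u₀)) (0 : ℝ) hψd.hasFDerivAt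
      (hasFDerivAt_prodMk_left 0 u₀)
  have hr : HasFDerivAt (fun v ↦ ψ ((0 : ℝ), v)) _ u₀ :=
    HasFDerivAt.comp (g := ψ) (f := fun v ↦ ((0 : ℝ), v)) u₀ hψd.hasFDerivAt
      (hasFDerivAt_prodMk_right 0 u₀)
  -- The coefficient of `dΦ(X)` and that of `∂ₜΦ` are the same coframe form applied to the two
  -- partial derivatives of one map `ψ`, so their cross derivatives can be compared.
  have dA : HasFDerivAt (fun t ↦ coframe H (rep y₀ (ε a)) (ψ (t, u₀))
      (fderiv ℝ (fun v ↦ ψ (t, v)) u₀ w)) _ 0 := (hθ.comp (0 : ℝ) hl).clm_apply k2.hasFDerivAt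
  have dB : HasFDerivAt (fun v ↦ coframe H (rep y₀ (ε a)) (ψ (0, v))
      (deriv (fun t ↦ ψ (t, v)) 0)) _ u₀ := (hθ.comp u₀ hr).clm_apply k1.hasFDerivAt
  have eB : dirDeriv X (varCoeff h Φ (ε a)) x
      = fderiv ℝ (coframe H (rep y₀ (ε a))) (ψ (0, u₀)) (fderiv ℝ (fun v ↦ ψ (0, v)) u₀ w)
        (deriv (fun t ↦ ψ (t, u₀)) 0) + coframe H (rep y₀ (ε a)) (ψ (0, u₀))
          (fderiv ℝ (fun v ↦ deriv (fun t ↦ ψ (t, v)) 0) u₀ w) := by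
    have h1 := dirDeriv_eq_fderiv X hu (f := varCoeff h Φ (ε a)) (by
      rw [hux]
      exact (contMDiffAt_varCoeff h hΦ (hε.contMDiffAt hV hx a)).mdifferentiableAt (by simp))
    rw [hux] at h1
    have h2 : (fun v ↦ varCoeff h Φ (ε a) ((extChartAt (𝓡 m) x).symm v)) =ᶠ[nhds u₀]
        fun v ↦ coframe H (rep y₀ (ε a)) (ψ (0, v)) (deriv (fun t ↦ ψ (t, v)) 0) := by
      filter_upwards [hu0] with v hv using hB _ a hv
    rw [h1, h2.fderiv_eq, HasFDerivAt.fderiv dB, hr.fderiv]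
    simp only [_root_.add_apply, ContinuousLinearMap.comp_apply, ContinuousLinearMap.flip_apply]
    exact add_comm _ _
  have eA : HasDerivAt (fun t ↦ frameDiff h (Φ t) X (ε a) x)
      (fderiv ℝ (coframe H (rep y₀ (ε a))) (ψ (0, u₀)) (deriv (fun t ↦ ψ (t, u₀)) 0)
        (fderiv ℝ (fun v ↦ ψ (0, v)) u₀ w) + coframe H (rep y₀ (ε a)) (ψ (0, u₀))
          (fderiv ℝ (fun v ↦ deriv (fun t ↦ ψ (t, v)) 0) u₀ w)) 0 := by
    refine HasDerivAt.congr_of_eventuallyEq (f₁ := fun t ↦ frameDiff h (Φ t) X (ε a) x) ?_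
      (ht0.mono fun t ht ↦ hA t a ht)
    refine dA.hasDerivAt.congr_deriv ?_
    rw [hl.hasDerivAt.deriv]
    simp only [_root_.add_apply, ContinuousLinearMap.comp_apply, ContinuousLinearMap.flip_apply,
      ContinuousLinearMap.toSpanSingleton_apply, one_smul]
    exact add_comm _ _
  have hbr : lieBracket ℝ (rep y₀ (ε 0)) (rep y₀ (ε 1)) (ψ (0, u₀))
      = F 0 y₀ • rep y₀ (ε 0) (ψ (0, u₀)) + F 1 y₀ • rep y₀ (ε 1) (ψ (0, u₀)) := by
    rw [hψ0, ← rep_mlieBracket hv (by rw [hvy]; exact hε.contMDiffAt hV hx 0)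
      (by rw [hvy]; exact hε.contMDiffAt hV hx 1)]
    exact rep_linear (by rw [hvy]; exact hF _ hx)
  -- The mixed second derivative of `ψ` occurs in both cross derivatives and cancels. Their
  -- difference is `dθ^a` on the two partial derivatives.
  have tors := fderiv_coframe_sub_surface hfr (F := fun a ↦ F a y₀) hbr a
    (deriv (fun t ↦ ψ (t, u₀)) 0) (fderiv ℝ (fun v ↦ ψ (0, v)) u₀ w)
  have hmem : Φ 0 x ∈ (extChartAt (𝓡 2) y₀).source := mem_extChartAt_source _
  have hB' : ∀ b, varCoeff h Φ (ε b) x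
      = coframe H (rep y₀ (ε b)) (ψ (0, u₀)) (deriv (fun t ↦ ψ (t, u₀)) 0) := fun b ↦ by
    rw [hB x b hmem]
    simp only [hψ_def, hux]
  rw [hA 0 0 hmem, hA 0 1 hmem, hB' 0, hB' 1, eB]
  refine eA.congr_deriv ?_
  linear_combination tors

end Surface

end BiharmonicSubmersion
end

open scoped Manifold ContDiff
noncomputable section
namespace BiharmonicSubmersion

/-! ### The tension field along a variation -/

section TensionCoeff

variable {m n : ℕ} {M N : Type*}
  [TopologicalSpace M] [ChartedSpace (EuclideanSpace ℝ (Fin m)) M] [IsManifold (𝓡 m) ∞ M]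
  [TopologicalSpace N] [ChartedSpace (EuclideanSpace ℝ (Fin n)) N] [IsManifold (𝓡 n) ∞ N]

/-- The components of the tension field in an orthonormal frame. -/
def tensionCoeff (g : SmoothMetric m M) (h : SmoothMetric n N)
    (e : Fin m → (p : M) → TangentSpace (𝓡 m) p) (ε : Fin n → (p : N) → TangentSpace (𝓡 n) p)
    (φ : M → N) (a : Fin n) (x : M) : ℝ :=
  ∑ i, (dirDeriv (e i) (frameDiff h φ (e i) (ε a)) x
      - frameDiv g e i x * frameDiff h φ (e i) (ε a) x
      + ∑ b, ∑ d, frameDiff h φ (e i) (ε b) x * frameDiff h φ (e i) (ε d) x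
        * connCoeff h ε b d a (φ x))

variable (g : SmoothMetric m M) (h : SmoothMetric n N) {U : Set M}
    {e : Fin m → (p : M) → TangentSpace (𝓡 m) p} {V : Set N}
    {ε : Fin n → (p : N) → TangentSpace (𝓡 n) p}

/-- This is needed for every member of a variation, so it is stated for an arbitrary smooth `φ`;
only `φ x ∈ V` matters. -/
lemma inner_tension_self (hU : IsOpen U) (he : IsOrthonormalOn g U e)
    (hV : IsOpen V) (hε : IsOrthonormalOn h V ε) {φ : M → N} {x : M} (hx : x ∈ U) (hxV : φ x ∈ V)
    (hφ : ContMDiff (𝓡 m) (𝓡 n) ∞ φ) :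
    h.inner (φ x) (tension g h φ x) (tension g h φ x)
      = ∑ a, tensionCoeff g h e ε φ a x ^ 2 := by
  rw [tension_eq_frame g h hU he hV hε hx hxV (Filter.Eventually.of_forall fun y ↦ hφ y)]
  refine (clm_sum_sum (h.inner (φ x)) (fun a ↦ tensionCoeff g h e ε φ a x)
    (fun a ↦ tensionCoeff g h e ε φ a x) fun a ↦ ε a (φ x)).trans ?_
  simp [hε.orthonormal _ hxV, pow_two]

lemma contMDiffAt_frameDiv (hU : IsOpen U) (he : IsOrthonormalOn g U e)
    {x : M} (hx : x ∈ U) (i : Fin m) :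
    ContMDiffAt (𝓡 m) 𝓘(ℝ, ℝ) ∞ (frameDiv g e i) x :=
  contMDiffAt_finsetSum fun j _ ↦ g.contMDiffAt_inner (b := id) (contMDiffAt_mlieBracket
    (he.contMDiffAt hU hx i) (he.contMDiffAt hU hx j)) (he.contMDiffAt hU hx j)

lemma contMDiffAt_connCoeff (hV : IsOpen V) (hε : IsOrthonormalOn h V ε)
    {y : N} (hy : y ∈ V) (b d a : Fin n) :
    ContMDiffAt (𝓡 n) 𝓘(ℝ, ℝ) ∞ (connCoeff h ε b d a) y := by
  have k : ∀ b d a, ContMDiffAt (𝓡 n) 𝓘(ℝ, ℝ) ∞ (fun y ↦ h.inner y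
      (VectorField.mlieBracket (𝓡 n) (ε b) (ε d) y) (ε a y)) y := fun b d a ↦
    h.contMDiffAt_inner (b := id) (contMDiffAt_mlieBracket
    (hε.contMDiffAt hV hy b) (hε.contMDiffAt hV hy d)) (hε.contMDiffAt hV hy a)
  exact contMDiffAt_const.mul (((k b d a).sub (k b a d)).sub (k d a b))

lemma contMDiffAt_frameDiff_variation (hU : IsOpen U) (he : IsOrthonormalOn g U e)
    (hV : IsOpen V) (hε : IsOrthonormalOn h V ε) {Φ : ℝ → M → N}
    (hΦ : ContMDiff (𝓘(ℝ, ℝ).prod (𝓡 m)) (𝓡 n) ∞ (fun q : ℝ × M ↦ Φ q.1 q.2)) {t : ℝ} {x : M}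
    (hx : x ∈ U) (hxV : Φ t x ∈ V) (i : Fin m) (a : Fin n) :
    ContMDiffAt (𝓘(ℝ, ℝ).prod (𝓡 m)) 𝓘(ℝ, ℝ) ∞
      (fun q : ℝ × M ↦ frameDiff h (Φ q.1) (e i) (ε a) q.2) (t, x) :=
  contMDiffAt_frameDiff_family h (f := fun q : ℝ × M ↦ Φ q.1) (c := Prod.snd)
    (ContMDiffAt.comp ((t, x), x) (g := fun q : ℝ × M ↦ Φ q.1 q.2) (hΦ (t, x))
      ((contMDiffAt_fst.comp ((t, x), x) contMDiffAt_fst).prodMk contMDiffAt_snd))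
    contMDiffAt_snd (he.contMDiffAt hU hx i) (hε.contMDiffAt hV hxV a)

lemma contMDiffAt_tensionCoeff_variation (hU : IsOpen U) (he : IsOrthonormalOn g U e)
    (hV : IsOpen V) (hε : IsOrthonormalOn h V ε) {Φ : ℝ → M → N}
    (hΦ : ContMDiff (𝓘(ℝ, ℝ).prod (𝓡 m)) (𝓡 n) ∞ (fun q : ℝ × M ↦ Φ q.1 q.2)) {t : ℝ} {x : M}
    (hx : x ∈ U) (hxV : Φ t x ∈ V) (a : Fin n) :
    ContMDiffAt (𝓘(ℝ, ℝ).prod (𝓡 m)) 𝓘(ℝ, ℝ) ∞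
      (fun q : ℝ × M ↦ tensionCoeff g h e ε (Φ q.1) a q.2) (t, x) := by
  have h1 := fun i a ↦ contMDiffAt_frameDiff_variation g h hU he hV hε hΦ hx hxV i a
  refine contMDiffAt_finsetSum fun i _ ↦ ((ContMDiffAt.sub ?_ (ContMDiffAt.mul ?_ (h1 i a))).add
    (contMDiffAt_finsetSum fun b _ ↦ contMDiffAt_finsetSum fun d _ ↦
      ((h1 i b).mul (h1 i d)).mul ?_))
  · refine contMDiffAt_dirDeriv_family (f := fun q : ℝ × M ↦ frameDiff h (Φ q.1) (e i) (ε a))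
      (c := Prod.snd) ?_ contMDiffAt_snd (he.contMDiffAt hU hx i)
    exact ContMDiffAt.comp ((t, x), x)
      (g := fun q : ℝ × M ↦ frameDiff h (Φ q.1) (e i) (ε a) q.2) (h1 i a)
      ((contMDiffAt_fst.comp ((t, x), x) contMDiffAt_fst).prodMk contMDiffAt_snd)
  · exact ContMDiffAt.comp (t, x) (g := frameDiv g e i) (f := Prod.snd)
      (contMDiffAt_frameDiv g hU he hx i) contMDiffAt_snd
  · exact ContMDiffAt.comp (t, x) (g := connCoeff h ε b d a)
      (f := fun q : ℝ × M ↦ Φ q.1 q.2) (contMDiffAt_connCoeff h hV hε hxV b d a) (hΦ (t, x))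

end TensionCoeff

/-! ### Time derivative of the tension components at a Riemannian submersion. -/

section FirstVariation

open VectorField

variable {M N : Type*}
  [TopologicalSpace M] [ChartedSpace (EuclideanSpace ℝ (Fin 3)) M] [IsManifold (𝓡 3) ∞ M]
  [TopologicalSpace N] [ChartedSpace (EuclideanSpace ℝ (Fin 2)) N] [IsManifold (𝓡 2) ∞ N]
  {g : SmoothMetric 3 M} {h : SmoothMetric 2 N} {U : Set M} {V : Set N}
  {e : Fin 3 → (p : M) → TangentSpace (𝓡 3) p} {ε : Fin 2 → (y : N) → TangentSpace (𝓡 2) y}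

/-- The derivative of the components of the differential along a variation of a Riemannian
submersion, the variation field having components `W`. -/
def diffVariation (e : Fin 3 → (p : M) → TangentSpace (𝓡 3) p) (f W : Fin 2 → M → ℝ) (i : Fin 3)
    (a : Fin 2) (y : M) : ℝ :=
  dirDeriv (e i) (W a) y - f a y * (W 0 y * (if i.val = 1 then 1 else 0)
    - W 1 y * (if i.val = 0 then 1 else 0))

/-- The closed form `hconn` of the connection term is differentiated by the product rule, and the
0-1 coefficients `hA` are substituted at time 0. The last sum comes from moving the base point of
`F`. Directional derivatives commute with the time derivative by `hasDerivAt_dirDeriv_family`. -/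
theorem hasDerivAt_tensionCoeff (hU : IsOpen U) (he : IsOrthonormalOn g U e) (hV : IsOpen V)
    (hε : IsOrthonormalOn h V ε) {F : Fin 2 → N → ℝ}
    (hF : ∀ y ∈ V, mlieBracket (𝓡 2) (ε 0) (ε 1) y = F 0 y • ε 0 y + F 1 y • ε 1 y)
    (hconn : ∀ y ∈ V, ∀ A : Fin 2 → ℝ,
      ∑ b, ∑ d, A b * A d * connCoeff h ε b d 0 y = (F 0 y * A 0 + F 1 y * A 1) * A 1 ∧
      ∑ b, ∑ d, A b * A d * connCoeff h ε b d 1 y = -((F 0 y * A 0 + F 1 y * A 1) * A 0))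
    {Φ : ℝ → M → N}
    (hΦ : ContMDiff (𝓘(ℝ, ℝ).prod (𝓡 3)) (𝓡 2) ∞ (fun q : ℝ × M ↦ Φ q.1 q.2))
    (hUV : ∀ y ∈ U, Φ 0 y ∈ V) (hA : ∀ y ∈ U, ∀ i a, frameDiff h (Φ 0) (e i) (ε a) y
      = if i.val = a.val then 1 else 0) {f : Fin 2 → M → ℝ}
    (hf : ∀ y ∈ U, ∀ a, f a y = F a (Φ 0 y)) {x : M} (hx : x ∈ U) :
    HasDerivAt (fun t ↦ tensionCoeff g h e ε (Φ t) 0 x)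
      (∑ i, (dirDeriv (e i) (diffVariation e f (fun a ↦ varCoeff h Φ (ε a)) i 0) x
        - frameDiv g e i x * diffVariation e f (fun a ↦ varCoeff h Φ (ε a)) i 0 x)
      + f 0 x * diffVariation e f (fun a ↦ varCoeff h Φ (ε a)) 0 1 x
      + f 0 x * diffVariation e f (fun a ↦ varCoeff h Φ (ε a)) 1 0 x
      + 2 * f 1 x * diffVariation e f (fun a ↦ varCoeff h Φ (ε a)) 1 1 x
      + ∑ a, varCoeff h Φ (ε a) x * dirDeriv (ε a) (F 1) (Φ 0 x)) 0 ∧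
    HasDerivAt (fun t ↦ tensionCoeff g h e ε (Φ t) 1 x)
      (∑ i, (dirDeriv (e i) (diffVariation e f (fun a ↦ varCoeff h Φ (ε a)) i 1) x
        - frameDiv g e i x * diffVariation e f (fun a ↦ varCoeff h Φ (ε a)) i 1 x)
      - 2 * f 0 x * diffVariation e f (fun a ↦ varCoeff h Φ (ε a)) 0 0 x
      - f 1 x * diffVariation e f (fun a ↦ varCoeff h Φ (ε a)) 0 1 x
      - f 1 x * diffVariation e f (fun a ↦ varCoeff h Φ (ε a)) 1 0 x
      - ∑ a, varCoeff h Φ (ε a) x * dirDeriv (ε a) (F 0) (Φ 0 x)) 0 := by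
  set B := diffVariation e f (fun a ↦ varCoeff h Φ (ε a)) with hB
  have hAd : ∀ y ∈ U, ∀ i a, HasDerivAt (fun t ↦ frameDiff h (Φ t) (e i) (ε a) y) (B i a y) 0 :=
    fun y hy i a ↦ by
    refine (hasDerivAt_frameDiff h hV hε hF hΦ (hUV y hy) (e i) a).congr_deriv ?_
    rw [hA y hy, hA y hy, hB, diffVariation, hf y hy]
    rfl
  have hSw : ∀ i a, HasDerivAt (fun t ↦ dirDeriv (e i) (frameDiff h (Φ t) (e i) (ε a)) x)
      (dirDeriv (e i) (B i a) x) 0 := fun i a ↦ by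
    refine (hasDerivAt_dirDeriv_family (S := fun t ↦ frameDiff h (Φ t) (e i) (ε a)) (e i)
      (contMDiffAt_frameDiff_variation g h hU he hV hε hΦ hx (hUV x hx) i a)).congr_deriv ?_
    exact dirDeriv_congr (Filter.eventually_of_mem (hU.mem_nhds hx) fun y hy ↦ (hAd y hy i a).deriv)
  have hFd : ∀ a, HasDerivAt (fun t ↦ F a (Φ t x)) _ 0 := fun a ↦
    hasDerivAt_comp_family h hV hε hΦ (hUV x hx) (contMDiffAt_bracket_coeff hV hε hF (hUV x hx) a)
  -- The closed form of the connection term is available only over `V`, hence only for small times.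
  have hin : ∀ᶠ t in nhds (0 : ℝ), Φ t x ∈ V :=
    ((hΦ.continuous.comp (by fun_prop : Continuous fun t : ℝ ↦ (t, x))).continuousAt).eventually
      (hV.mem_nhds (hUV x hx))
  have hd := hAd x hx
  have hA' := hA x hx
  have hf' := hf x hx
  constructor
  · have h1 : HasDerivAt (fun t ↦ ∑ i, (dirDeriv (e i) (frameDiff h (Φ t) (e i) (ε 0)) x
        - frameDiv g e i x * frameDiff h (Φ t) (e i) (ε 0) x
        + (F 0 (Φ t x) * frameDiff h (Φ t) (e i) (ε 0) x
          + F 1 (Φ t x) * frameDiff h (Φ t) (e i) (ε 1) x)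
          * frameDiff h (Φ t) (e i) (ε 1) x)) _ 0 := HasDerivAt.fun_sum fun i _ ↦
      ((hSw i 0).fun_sub ((hd i 0).const_mul _)).fun_add
        ((((hFd 0).fun_mul (hd i 0)).fun_add ((hFd 1).fun_mul (hd i 1))).fun_mul (hd i 1))
    refine (h1.congr_of_eventuallyEq (hin.mono fun t ht ↦ ?_)).congr_deriv ?_
    · exact Finset.sum_congr rfl fun i _ ↦ by
        rw [(hconn _ ht fun b ↦ frameDiff h (Φ t) (e i) (ε b) x).1]
    · simp only [Fin.sum_univ_three, hA', hf']
      simp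
      ring
  · have h1 : HasDerivAt (fun t ↦ ∑ i, (dirDeriv (e i) (frameDiff h (Φ t) (e i) (ε 1)) x
        - frameDiv g e i x * frameDiff h (Φ t) (e i) (ε 1) x
        - (F 0 (Φ t x) * frameDiff h (Φ t) (e i) (ε 0) x
          + F 1 (Φ t x) * frameDiff h (Φ t) (e i) (ε 1) x)
          * frameDiff h (Φ t) (e i) (ε 0) x)) _ 0 := HasDerivAt.fun_sum fun i _ ↦
      ((hSw i 1).fun_sub ((hd i 1).const_mul _)).fun_sub
        ((((hFd 0).fun_mul (hd i 0)).fun_add ((hFd 1).fun_mul (hd i 1))).fun_mul (hd i 0))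
    refine (h1.congr_of_eventuallyEq (hin.mono fun t ht ↦ ?_)).congr_deriv ?_
    · exact Finset.sum_congr rfl fun i _ ↦ by
        rw [(hconn _ ht fun b ↦ frameDiff h (Φ t) (e i) (ε b) x).2]
        exact (sub_eq_add_neg _ _).symm
    · simp only [Fin.sum_univ_three, hA', hf']
      simp
      ring

end FirstVariation

end BiharmonicSubmersion
end

open scoped Manifold ContDiff
noncomputable section
namespace BiharmonicSubmersion

/-! ### Integration by parts in the first variation -/

section DirDeriv

variable {m : ℕ} {M : Type*} [TopologicalSpace M] [ChartedSpace (EuclideanSpace ℝ (Fin m)) M]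
  {X : (p : M) → TangentSpace (𝓡 m) p} {f f' : M → ℝ} {p : M} {d d' : ℝ}

/-- `f` is differentiable at `p` and its derivative in the direction of `X` is `d`. -/
def HasDirDeriv (X : (p : M) → TangentSpace (𝓡 m) p) (f : M → ℝ) (p : M) (d : ℝ) : Prop :=
  MDifferentiableAt (𝓡 m) 𝓘(ℝ, ℝ) f p ∧ dirDeriv X f p = d

lemma _root_.ContMDiffAt.hasDirDeriv (hf : ContMDiffAt (𝓡 m) 𝓘(ℝ, ℝ) ∞ f p) :
    HasDirDeriv X f p (dirDeriv X f p) :=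
  ⟨hf.mdifferentiableAt (by simp), rfl⟩

namespace HasDirDeriv

lemma const (c : ℝ) : HasDirDeriv X (fun _ ↦ c) p 0 :=
  ⟨mdifferentiableAt_const, dirDeriv_const X c p⟩

lemma of_hasMFDerivAt {L : EuclideanSpace ℝ (Fin m) →L[ℝ] ℝ}
    (h : HasMFDerivAt (𝓡 m) 𝓘(ℝ, ℝ) f p L) : HasDirDeriv X f p (L (X p)) :=
  ⟨h.mdifferentiableAt, congrArg (fun L : EuclideanSpace ℝ (Fin m) →L[ℝ] ℝ ↦ L (X p)) h.mfderiv⟩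

lemma add (h : HasDirDeriv X f p d) (h' : HasDirDeriv X f' p d') :
    HasDirDeriv X (fun q ↦ f q + f' q) p (d + d') := by
  refine ⟨h.1.add h'.1, ?_⟩
  rw [← h.2, ← h'.2]
  exact (of_hasMFDerivAt (h.1.hasMFDerivAt.add h'.1.hasMFDerivAt)).2

lemma neg (h : HasDirDeriv X f p d) : HasDirDeriv X (fun q ↦ -f q) p (-d) := by
  refine ⟨h.1.neg, ?_⟩
  rw [← h.2]
  exact (of_hasMFDerivAt h.1.hasMFDerivAt.neg).2

lemma sub (h : HasDirDeriv X f p d) (h' : HasDirDeriv X f' p d') :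
    HasDirDeriv X (fun q ↦ f q - f' q) p (d - d') := by
  simpa only [sub_eq_add_neg] using h.add h'.neg

lemma mul (h : HasDirDeriv X f p d) (h' : HasDirDeriv X f' p d') :
    HasDirDeriv X (fun q ↦ f q * f' q) p (f p * d' + f' p * d) := by
  refine ⟨h.1.mul h'.1, ?_⟩
  rw [← h.2, ← h'.2]
  exact (of_hasMFDerivAt (h.1.hasMFDerivAt.mul h'.1.hasMFDerivAt)).2

end HasDirDeriv

end DirDeriv

section Flux

variable {M : Type*} [TopologicalSpace M] [ChartedSpace (EuclideanSpace ℝ (Fin 3)) M]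

/-- The part of the flux without derivatives. -/
def lowerFlux (f κ W : Fin 2 → M → ℝ) : Fin 3 → M → ℝ :=
  ![fun y ↦ -(κ 0 y * (f 0 y * W 1 y)) + 2 * (κ 1 y * (f 0 y * W 0 y)) + κ 1 y * (f 1 y * W 1 y),
    fun y ↦ -(κ 0 y * (f 0 y * W 0 y)) - 2 * (κ 0 y * (f 1 y * W 1 y)) + κ 1 y * (f 1 y * W 0 y),
    fun _ ↦ 0]

/-- The boundary term of the first variation of the bienergy. -/
def bienergyFlux (e : Fin 3 → (p : M) → TangentSpace (𝓡 3) p) (f κ W : Fin 2 → M → ℝ) (i : Fin 3)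
    (y : M) : ℝ :=
  -(κ 0 y * diffVariation e f W i 0 y) - κ 1 y * diffVariation e f W i 1 y
    + dirDeriv (e i) (κ 0) y * W 0 y + dirDeriv (e i) (κ 1) y * W 1 y + lowerFlux f κ W i y

/-- The Euler-Lagrange expressions of the bienergy; `K` is the Gauss curvature of the base. -/
def bitension (e : Fin 3 → (p : M) → TangentSpace (𝓡 3) p) (Δ : (M → ℝ) → M → ℝ)
    (f κ : Fin 2 → M → ℝ) (K : M → ℝ) : Fin 2 → M → ℝ :=
  ![fun p ↦ -Δ (κ 0) p
              - f 0 p * dirDeriv (e 0) (κ 1) p - dirDeriv (e 0) (fun q ↦ κ 1 q * f 0 q) p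
              - f 1 p * dirDeriv (e 1) (κ 1) p - dirDeriv (e 1) (fun q ↦ κ 1 q * f 1 q) p
              + κ 0 p * κ 1 p * f 0 p + κ 1 p ^ 2 * f 1 p
              + κ 0 p * (-K p + f 0 p ^ 2 + f 1 p ^ 2),
    fun p ↦ -Δ (κ 1) p
              + f 0 p * dirDeriv (e 0) (κ 0) p + dirDeriv (e 0) (fun q ↦ κ 0 q * f 0 q) p
              + f 1 p * dirDeriv (e 1) (κ 0) p + dirDeriv (e 1) (fun q ↦ κ 0 q * f 1 q) p
              - κ 0 p * κ 1 p * f 1 p - κ 0 p ^ 2 * f 0 p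
              + κ 1 p * (-K p + f 0 p ^ 2 + f 1 p ^ 2)]

variable [IsManifold (𝓡 3) ∞ M] {g : SmoothMetric 3 M}
  {e : Fin 3 → (p : M) → TangentSpace (𝓡 3) p} {f κ W : Fin 2 → M → ℝ} {x : M}

lemma contMDiffAt_diffVariation
    (he : ∀ i, ContMDiffAt (𝓡 3) (𝓡 3).tangent ∞ (fun p ↦ (⟨p, e i p⟩ : TangentBundle (𝓡 3) M)) x)
    (hf : ∀ a, ContMDiffAt (𝓡 3) 𝓘(ℝ, ℝ) ∞ (f a) x)
    (hW : ∀ a, ContMDiffAt (𝓡 3) 𝓘(ℝ, ℝ) ∞ (W a) x) (i : Fin 3) (a : Fin 2) :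
    ContMDiffAt (𝓡 3) 𝓘(ℝ, ℝ) ∞ (diffVariation e f W i a) x :=
  (contMDiffAt_dirDeriv (hW a) (he i)).sub ((hf a).mul (((hW 0).mul contMDiffAt_const).sub
    ((hW 1).mul contMDiffAt_const)))

lemma contMDiffAt_bienergyFlux
    (he : ∀ i, ContMDiffAt (𝓡 3) (𝓡 3).tangent ∞ (fun p ↦ (⟨p, e i p⟩ : TangentBundle (𝓡 3) M)) x)
    (hf : ∀ a, ContMDiffAt (𝓡 3) 𝓘(ℝ, ℝ) ∞ (f a) x)
    (hκ : ∀ a, ContMDiffAt (𝓡 3) 𝓘(ℝ, ℝ) ∞ (κ a) x)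
    (hW : ∀ a, ContMDiffAt (𝓡 3) 𝓘(ℝ, ℝ) ∞ (W a) x) (i : Fin 3) :
    ContMDiffAt (𝓡 3) 𝓘(ℝ, ℝ) ∞ (bienergyFlux e f κ W i) x := by
  have hB := contMDiffAt_diffVariation he hf hW
  have h3 := fun a b c ↦ (hκ a).mul ((hf b).mul (hW c))
  refine ((((((hκ 0).mul (hB i 0)).neg.sub ((hκ 1).mul (hB i 1)))).add
    ((contMDiffAt_dirDeriv (hκ 0) (he i)).mul (hW 0))).add
    ((contMDiffAt_dirDeriv (hκ 1) (he i)).mul (hW 1))).add ?_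
  fin_cases i
  · exact ((h3 0 0 1).neg.add (contMDiffAt_const.mul (h3 1 0 0))).add (h3 1 1 1)
  · exact ((h3 0 0 0).neg.sub (contMDiffAt_const.mul (h3 0 1 1))).add (h3 1 1 0)
  · exact contMDiffAt_const

/-- The first variation of the bienergy density is the Euler-Lagrange expression up to a
divergence. -/
lemma first_variation_density
    (he : ∀ i, ContMDiffAt (𝓡 3) (𝓡 3).tangent ∞ (fun p ↦ (⟨p, e i p⟩ : TangentBundle (𝓡 3) M)) x)
    (hf : ∀ a, ContMDiffAt (𝓡 3) 𝓘(ℝ, ℝ) ∞ (f a) x)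
    (hκ : ∀ a, ContMDiffAt (𝓡 3) 𝓘(ℝ, ℝ) ∞ (κ a) x)
    (hW : ∀ a, ContMDiffAt (𝓡 3) 𝓘(ℝ, ℝ) ∞ (W a) x)
    (hc : frameDiv g e 0 x = f 1 x + κ 0 x ∧ frameDiv g e 1 x = κ 1 x - f 0 x ∧
      frameDiv g e 2 x = 0) {K : M → ℝ}
    (hK : K x = -(dirDeriv (e 1) (f 0) x - dirDeriv (e 0) (f 1) x + f 0 x ^ 2 + f 1 x ^ 2))
    {Δ : (M → ℝ) → M → ℝ} (hΔ : ∀ a, Δ (κ a) x = ∑ i, (dirDeriv (e i) (dirDeriv (e i) (κ a)) x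
      - frameDiv g e i x * dirDeriv (e i) (κ a) x)) :
    -κ 0 x * (∑ i, (dirDeriv (e i) (diffVariation e f W i 0) x
        - frameDiv g e i x * diffVariation e f W i 0 x)
      + f 0 x * diffVariation e f W 0 1 x + f 0 x * diffVariation e f W 1 0 x
      + 2 * f 1 x * diffVariation e f W 1 1 x
      + (W 0 x * dirDeriv (e 0) (f 1) x + W 1 x * dirDeriv (e 1) (f 1) x))
    + -κ 1 x * (∑ i, (dirDeriv (e i) (diffVariation e f W i 1) x
        - frameDiv g e i x * diffVariation e f W i 1 x)
      - 2 * f 0 x * diffVariation e f W 0 0 x - f 1 x * diffVariation e f W 0 1 x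
      - f 1 x * diffVariation e f W 1 0 x
      - (W 0 x * dirDeriv (e 0) (f 0) x + W 1 x * dirDeriv (e 1) (f 0) x))
    = bitension e Δ f κ K 0 x * W 0 x + bitension e Δ f κ K 1 x * W 1 x
      + ∑ i, (dirDeriv (e i) (bienergyFlux e f κ W i) x
        - frameDiv g e i x * bienergyFlux e f κ W i x) := by
  have dB := fun i a ↦ (contMDiffAt_diffVariation he hf hW i a).hasDirDeriv (X := e i)
  have df := fun i a ↦ (hf a).hasDirDeriv (X := e i)
  have dκ := fun i a ↦ (hκ a).hasDirDeriv (X := e i)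
  have dW := fun i a ↦ (hW a).hasDirDeriv (X := e i)
  have ddκ := fun i a ↦ (contMDiffAt_dirDeriv (hκ a) (he i)).hasDirDeriv (X := e i)
  have d3 := fun i a b c ↦ (dκ i a).mul ((df i b).mul (dW i c))
  have d2 : ∀ i, HasDirDeriv (e i) (fun _ : M ↦ (2 : ℝ)) x 0 := fun i ↦ HasDirDeriv.const 2
  have main := fun i ↦ ((((dκ i 0).mul (dB i 0)).neg.sub ((dκ i 1).mul (dB i 1))).add
    ((ddκ i 0).mul (dW i 0))).add ((ddκ i 1).mul (dW i 1))
  have fl0 : dirDeriv (e 0) (bienergyFlux e f κ W 0) x = _ := ((main 0).add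
    (((d3 0 0 0 1).neg.add ((d2 0).mul (d3 0 1 0 0))).add (d3 0 1 1 1))).2
  have fl1 : dirDeriv (e 1) (bienergyFlux e f κ W 1) x = _ := ((main 1).add
    (((d3 1 0 0 0).neg.sub ((d2 1).mul (d3 1 0 1 1))).add (d3 1 1 1 0))).2
  have fl2 : dirDeriv (e 2) (bienergyFlux e f κ W 2) x = _ :=
    ((main 2).add (HasDirDeriv.const 0)).2
  have p0 : ∀ i a b, dirDeriv (e i) (fun q ↦ κ a q * f b q) x = _ :=
    fun i a b ↦ ((dκ i a).mul (df i b)).2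
  have t0 : bitension e Δ f κ K 0 x = -Δ (κ 0) x
              - f 0 x * dirDeriv (e 0) (κ 1) x - dirDeriv (e 0) (fun q ↦ κ 1 q * f 0 q) x
              - f 1 x * dirDeriv (e 1) (κ 1) x - dirDeriv (e 1) (fun q ↦ κ 1 q * f 1 q) x
              + κ 0 x * κ 1 x * f 0 x + κ 1 x ^ 2 * f 1 x
              + κ 0 x * (-K x + f 0 x ^ 2 + f 1 x ^ 2) := rfl
  have t1 : bitension e Δ f κ K 1 x = -Δ (κ 1) x
              + f 0 x * dirDeriv (e 0) (κ 0) x + dirDeriv (e 0) (fun q ↦ κ 0 q * f 0 q) x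
              + f 1 x * dirDeriv (e 1) (κ 0) x + dirDeriv (e 1) (fun q ↦ κ 0 q * f 1 q) x
              - κ 0 x * κ 1 x * f 1 x - κ 0 x ^ 2 * f 0 x
              + κ 1 x * (-K x + f 0 x ^ 2 + f 1 x ^ 2) := rfl
  have l0 : lowerFlux f κ W 0 x = -(κ 0 x * (f 0 x * W 1 x)) + 2 * (κ 1 x * (f 0 x * W 0 x))
    + κ 1 x * (f 1 x * W 1 x) := rfl
  have l1 : lowerFlux f κ W 1 x = -(κ 0 x * (f 0 x * W 0 x)) - 2 * (κ 0 x * (f 1 x * W 1 x))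
    + κ 1 x * (f 1 x * W 0 x) := rfl
  have l2 : lowerFlux f κ W 2 x = 0 := rfl
  have b : ∀ i a, diffVariation e f W i a x = dirDeriv (e i) (W a) x - f a x *
    (W 0 x * (if i.val = 1 then 1 else 0) - W 1 x * (if i.val = 0 then 1 else 0)) := fun _ _ ↦ rfl
  rw [t0, t1, hΔ, hΔ, p0, p0, p0, p0, hK]
  simp only [Fin.sum_univ_three, fl0, fl1, fl2, hc.1, hc.2.1, hc.2.2, bienergyFlux, l0, l1, l2]
  -- The derivatives of `diffVariation` occur with the same coefficients on both sides and stay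
  -- opaque; only the values of `diffVariation` at `x` need to be expanded.
  have b' : ∀ i a, ∃ z, dirDeriv (e i) (diffVariation e f W i a) x = z := fun i a ↦ ⟨_, rfl⟩
  obtain ⟨z00, h00⟩ := b' 0 0
  obtain ⟨z01, h01⟩ := b' 0 1
  obtain ⟨z10, h10⟩ := b' 1 0
  obtain ⟨z11, h11⟩ := b' 1 1
  obtain ⟨z20, h20⟩ := b' 2 0
  obtain ⟨z21, h21⟩ := b' 2 1
  simp only [h00, h01, h10, h11, h20, h21, b]
  simp
  ring

end Flux

end BiharmonicSubmersion
end

open scoped Manifold ContDiff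
noncomputable section
namespace BiharmonicSubmersion

/-! ### The Riemannian volume measure -/

section ChartVolume

open MeasureTheory

variable {n : ℕ} {M : Type*} [TopologicalSpace M] [ChartedSpace (EuclideanSpace ℝ (Fin n)) M]
  [IsManifold (𝓡 n) ∞ M] (g : SmoothMetric n M)

lemma gram_apply_eq_bil (x₀ : M) (u : EuclideanSpace ℝ (Fin n)) (i j : Fin n) :
    gram g x₀ u i j = bil (gram g x₀ u) (EuclideanSpace.single i 1)
      (EuclideanSpace.single j 1) := by
  simp [bil_apply]

/-- The coordinate change between two charts. -/
def coordChange (x₀ x₁ : M) (u : EuclideanSpace ℝ (Fin n)) : EuclideanSpace ℝ (Fin n) :=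
  extChartAt (𝓡 n) x₁ ((extChartAt (𝓡 n) x₀).symm u)

variable {x₀ x₁ : M} {u : EuclideanSpace ℝ (Fin n)}

lemma contDiffAt_coordChange (hu : u ∈ (extChartAt (𝓡 n) x₀).target)
    (hp : (extChartAt (𝓡 n) x₀).symm u ∈ (extChartAt (𝓡 n) x₁).source) :
    ContDiffAt ℝ ∞ (coordChange x₀ x₁) u :=
  contDiffAt_chart (φ := id) hu contMDiffAt_id hp

/-- The coordinate change carries the two chart expressions of a vector field into each other, and
both sides compute the same inner product on `M`. -/
lemma bil_gram_coordChange (hu : u ∈ (extChartAt (𝓡 n) x₀).target)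
    (hp : (extChartAt (𝓡 n) x₀).symm u ∈ (extChartAt (𝓡 n) x₁).source)
    (v w : EuclideanSpace ℝ (Fin n)) :
    bil (gram g x₀ u) v w = bil (gram g x₁ (coordChange x₀ x₁ u))
      (fderiv ℝ (coordChange x₀ x₁) u v) (fderiv ℝ (coordChange x₀ x₁) u w) := by
  have hext : ∀ v : EuclideanSpace ℝ (Fin n), ∃ X : (p : M) → TangentSpace (𝓡 n) p,
      rep x₀ X u = v := fun v ↦
    ⟨fun _ ↦ (mfderiv 𝓘(ℝ, EuclideanSpace ℝ (Fin n)) (𝓡 n) (extChartAt (𝓡 n) x₀).symm u v :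
      EuclideanSpace ℝ (Fin n)), (isInvertible_mfderiv_extChartAt_symm hu).inverse_apply_self v⟩
  obtain ⟨X, rfl⟩ := hext v
  obtain ⟨Y, rfl⟩ := hext w
  have hrel : ∀ Z : (p : M) → TangentSpace (𝓡 n) p,
      fderiv ℝ (coordChange x₀ x₁) u (rep x₀ Z u) = rep x₁ Z (coordChange x₀ x₁ u) := fun Z ↦
    fderiv_chart_of_related (φ := id) (Y := Z) hu mdifferentiableAt_id hp (by
      rw [mfderiv_id]; rfl)
  have h1 := inner_eq_bil g (x₀ := x₁) (u := coordChange x₀ x₁ u)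
    ((extChartAt (𝓡 n) x₁).map_source hp) X Y
  rw [hrel, hrel, ← inner_eq_bil g hu, ← h1, coordChange, (extChartAt (𝓡 n) x₁).left_inv hp]

/-- Determinant of the congruence `Dᵀ G D`, with `D` the Jacobian matrix of the coordinate change.
-/
lemma det_gram_coordChange (hu : u ∈ (extChartAt (𝓡 n) x₀).target)
    (hp : (extChartAt (𝓡 n) x₀).symm u ∈ (extChartAt (𝓡 n) x₁).source) :
    (gram g x₀ u).det = (fderiv ℝ (coordChange x₀ x₁) u).det ^ 2
      * (gram g x₁ (coordChange x₀ x₁ u)).det := by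
  set T := fderiv ℝ (coordChange x₀ x₁) u
  set D : Matrix (Fin n) (Fin n) ℝ := Matrix.of fun i j ↦ T (EuclideanSpace.single j 1) i with hD
  have hdet : D.det = T.det := by
    have : D = LinearMap.toMatrix (EuclideanSpace.basisFun (Fin n) ℝ).toBasis
        (EuclideanSpace.basisFun (Fin n) ℝ).toBasis (T : EuclideanSpace ℝ (Fin n) →ₗ[ℝ]
          EuclideanSpace ℝ (Fin n)) := by
      ext i j
      simp [hD, LinearMap.toMatrix_apply]
    rw [this, LinearMap.det_toMatrix]
  have h1 : gram g x₀ u = D.transpose * gram g x₁ (coordChange x₀ x₁ u) * D := by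
    ext i j
    rw [gram_apply_eq_bil, bil_gram_coordChange g hu hp, bil_apply]
    simp only [Matrix.mul_apply, Matrix.transpose_apply, hD, Matrix.of_apply, Finset.sum_mul]
    rw [Finset.sum_comm]
    exact Finset.sum_congr rfl fun k _ ↦ Finset.sum_congr rfl fun l _ ↦ by ring
  rw [h1, Matrix.det_mul, Matrix.det_mul, Matrix.det_transpose, hdet]
  ring

lemma continuousOn_gram_det (x₀ : M) :
    ContinuousOn (fun u ↦ (gram g x₀ u).det) (extChartAt (𝓡 n) x₀).target := fun u hu ↦ by
  refine ContinuousAt.continuousWithinAt ?_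
  simp only [Matrix.det_apply]
  refine tendsto_finsetSum _ fun σ _ ↦ Filter.Tendsto.const_smul (tendsto_finsetProd _ fun i _ ↦
    (contDiffAt_gram g hu _ _).continuousAt) _

lemma continuousOn_density (x₀ : M) :
    ContinuousOn (fun u ↦ ENNReal.ofReal (Real.sqrt (gram g x₀ u).det))
      (extChartAt (𝓡 n) x₀).target :=
  ENNReal.continuous_ofReal.comp_continuousOn
    (Real.continuous_sqrt.comp_continuousOn (continuousOn_gram_det g x₀))

variable [MeasurableSpace M] [BorelSpace M]

lemma aemeasurable_extChartAt_symm (x₀ : M) :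
    AEMeasurable (extChartAt (𝓡 n) x₀).symm
      (((volume : Measure (EuclideanSpace ℝ (Fin n))).restrict (extChartAt (𝓡 n) x₀).target
        ).withDensity (fun u ↦ ENNReal.ofReal (Real.sqrt (gram g x₀ u).det))) :=
  ((continuousOn_extChartAt_symm x₀).aemeasurable
    (isOpen_extChartAt_target x₀).measurableSet).mono_ac (withDensity_absolutelyContinuous _ _)

lemma measurableSet_extChartAt_symm_preimage (x₀ : M) {A : Set M} (hA : MeasurableSet A) :
    MeasurableSet ((extChartAt (𝓡 n) x₀).symm ⁻¹' A ∩ (extChartAt (𝓡 n) x₀).target) := by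
  have h := MeasurableSet.subtype_image (isOpen_extChartAt_target (I := 𝓡 n) x₀).measurableSet
    ((continuousOn_iff_continuous_domRestrict.1
      (continuousOn_extChartAt_symm (I := 𝓡 n) x₀)).measurable hA)
  convert h using 1
  ext u
  simp [Set.domRestrict, and_comm]

lemma chartVolume_apply (x₀ : M) {A : Set M} (hA : MeasurableSet A) :
    chartVolume g x₀ A = ∫⁻ u in (extChartAt (𝓡 n) x₀).symm ⁻¹' A ∩ (extChartAt (𝓡 n) x₀).target,
      ENNReal.ofReal (Real.sqrt (gram g x₀ u).det) := by
  rw [chartVolume, Measure.map_apply_of_aemeasurable (aemeasurable_extChartAt_symm g x₀) hA,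
    withDensity_apply', Measure.restrict_restrict' (isOpen_extChartAt_target x₀).measurableSet]

lemma chartVolume_inter_source (x₀ : M) {A : Set M} (hA : MeasurableSet A) :
    chartVolume g x₀ (A ∩ (extChartAt (𝓡 n) x₀).source) = chartVolume g x₀ A := by
  rw [chartVolume_apply g x₀ hA,
    chartVolume_apply g x₀ (hA.inter (isOpen_extChartAt_source x₀).measurableSet)]
  congr 2
  ext u
  constructor
  · rintro ⟨h1, h2⟩
    exact ⟨h1.1, h2⟩
  · rintro ⟨h1, h2⟩
    exact ⟨⟨h1, (extChartAt (𝓡 n) x₀).map_target h2⟩, h2⟩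

/-- Two of the local measures agree where both charts are defined. -/
lemma chartVolume_eq (x₀ x₁ : M) {A : Set M} (hA : MeasurableSet A)
    (h₀ : A ⊆ (extChartAt (𝓡 n) x₀).source) (h₁ : A ⊆ (extChartAt (𝓡 n) x₁).source) :
    chartVolume g x₁ A = chartVolume g x₀ A := by
  rw [chartVolume_apply g x₀ hA, chartVolume_apply g x₁ hA]
  set B := (extChartAt (𝓡 n) x₀).symm ⁻¹' A ∩ (extChartAt (𝓡 n) x₀).target
  have hB : MeasurableSet B := measurableSet_extChartAt_symm_preimage x₀ hA
  have himg : (extChartAt (𝓡 n) x₁).symm ⁻¹' A ∩ (extChartAt (𝓡 n) x₁).target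
      = coordChange x₀ x₁ '' B := by
    ext v
    constructor
    · rintro ⟨hv, hvt⟩
      refine ⟨extChartAt (𝓡 n) x₀ ((extChartAt (𝓡 n) x₁).symm v), ⟨?_,
        (extChartAt (𝓡 n) x₀).map_source (h₀ hv)⟩, ?_⟩
      · rw [Set.mem_preimage, (extChartAt (𝓡 n) x₀).left_inv (h₀ hv)]
        exact hv
      · rw [coordChange, (extChartAt (𝓡 n) x₀).left_inv (h₀ hv),
          (extChartAt (𝓡 n) x₁).right_inv hvt]
    · rintro ⟨u, ⟨huA, hut⟩, rfl⟩
      refine ⟨?_, (extChartAt (𝓡 n) x₁).map_source (h₁ huA)⟩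
      rw [Set.mem_preimage, coordChange, (extChartAt (𝓡 n) x₁).left_inv (h₁ huA)]
      exact huA
  have hinj : Set.InjOn (coordChange x₀ x₁) B := by
    rintro u ⟨huA, hut⟩ v ⟨hvA, hvt⟩ huv
    have h := (extChartAt (𝓡 n) x₁).injOn (h₁ huA) (h₁ hvA) huv
    exact (extChartAt (𝓡 n) x₀).symm.injOn hut hvt h
  rw [himg, lintegral_image_eq_lintegral_abs_det_fderiv_mul volume hB
    (fun u hu ↦ ((contDiffAt_coordChange hu.2 (h₁ hu.1)).differentiableAt
      (by simp)).hasFDerivAt.hasFDerivWithinAt) hinj]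
  refine setLIntegral_congr_fun hB fun u hu ↦ ?_
  -- The square root of the squared Jacobian is its absolute value, precisely the factor in the
  -- change of variables formula.
  rw [det_gram_coordChange g hu.2 (h₁ hu.1), Real.sqrt_mul (sq_nonneg _), Real.sqrt_sq_eq_abs,
    ENNReal.ofReal_mul (abs_nonneg _)]

/-- A supremum of measures is at most any measure that dominates each of them, so a convenient upper
bound replaces a computation of the supremum. -/
lemma riemannianVolume_apply (x₀ : M) {A : Set M} (hA : MeasurableSet A)
    (h₀ : A ⊆ (extChartAt (𝓡 n) x₀).source) : riemannianVolume g A = chartVolume g x₀ A := by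
  refine le_antisymm ?_ ((le_iSup (chartVolume g) x₀) A)
  set s := (extChartAt (𝓡 n) x₀).source with hs_def
  have hs : MeasurableSet s := (isOpen_extChartAt_source x₀).measurableSet
  -- The upper bound agrees with the local measure inside the chart domain and with the whole
  -- supremum outside it. Domination is checked on the two pieces separately: by agreement of the
  -- local measures inside, trivially outside.
  have key : riemannianVolume g ≤ chartVolume g x₀ + (riemannianVolume g).restrict sᶜ := by
    refine iSup_le fun x ↦ Measure.le_iff.2 fun B hB ↦ ?_
    rw [← measure_inter_add_sdiff B hs, Measure.add_apply, Measure.restrict_apply hB]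
    refine add_le_add ?_ ((le_iSup (chartVolume g) x) _)
    rw [← chartVolume_inter_source g x (hB.inter hs), chartVolume_eq g x₀ x
      ((hB.inter hs).inter (isOpen_extChartAt_source x).measurableSet)
      (fun p hp ↦ hp.1.2) (fun p hp ↦ hp.2)]
    exact measure_mono fun p hp ↦ hp.1.1
  refine (key A).trans ?_
  rw [Measure.add_apply, Measure.restrict_apply hA]
  have : A ∩ sᶜ = ∅ := by
    rw [← Set.sdiff_eq, Set.sdiff_eq_empty]
    exact h₀
  simp [this]

lemma riemannianVolume_restrict_source (x₀ : M) :
    (riemannianVolume g).restrict (extChartAt (𝓡 n) x₀).source = chartVolume g x₀ := by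
  refine Measure.ext fun A hA ↦ ?_
  rw [Measure.restrict_apply hA, riemannianVolume_apply g x₀
    (hA.inter (isOpen_extChartAt_source x₀).measurableSet) Set.inter_subset_right,
    chartVolume_inter_source g x₀ hA]

/-- The density is bounded on a closed coordinate ball inside the chart target. Integrability of
continuous functions on compact sets rests on this. -/
instance : IsLocallyFiniteMeasure (riemannianVolume g) := by
  refine ⟨fun x ↦ ?_⟩
  have hu := mem_extChartAt_target (I := 𝓡 n) x
  obtain ⟨r, hr, hrt⟩ := Metric.nhds_basis_closedBall.mem_iff.1
    ((isOpen_extChartAt_target (I := 𝓡 n) x).mem_nhds hu)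
  set A := (extChartAt (𝓡 n) x).source ∩ extChartAt (𝓡 n) x ⁻¹'
    Metric.ball (extChartAt (𝓡 n) x x) r with hA_def
  have hA : IsOpen A := (continuousOn_extChartAt x).isOpen_inter_preimage
    (isOpen_extChartAt_source x) Metric.isOpen_ball
  refine ⟨A, hA.mem_nhds ⟨mem_extChartAt_source x, Metric.mem_ball_self hr⟩, ?_⟩
  rw [riemannianVolume_apply g x hA.measurableSet Set.inter_subset_left,
    chartVolume_apply g x hA.measurableSet]
  obtain ⟨C, hC⟩ := (isCompact_closedBall (extChartAt (𝓡 n) x x) r).bddAbove_image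
    ((Real.continuous_sqrt.comp_continuousOn (continuousOn_gram_det g x)).mono hrt)
  have hsub : (extChartAt (𝓡 n) x).symm ⁻¹' A ∩ (extChartAt (𝓡 n) x).target
      ⊆ Metric.closedBall (extChartAt (𝓡 n) x x) r := fun u hu ↦ by
    have := hu.1.2
    rw [Set.mem_preimage, (extChartAt (𝓡 n) x).right_inv hu.2] at this
    exact Metric.ball_subset_closedBall this
  calc _ ≤ ∫⁻ u in Metric.closedBall (extChartAt (𝓡 n) x x) r,
        ENNReal.ofReal (Real.sqrt (gram g x u).det) := lintegral_mono_set hsub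
    _ ≤ ∫⁻ _ in Metric.closedBall (extChartAt (𝓡 n) x x) r, ENNReal.ofReal C :=
        setLIntegral_mono' measurableSet_closedBall fun u hu ↦
          ENNReal.ofReal_le_ofReal (hC (Set.mem_image_of_mem _ hu))
    _ < ⊤ := by
      rw [setLIntegral_const]
      exact ENNReal.mul_lt_top ENNReal.ofReal_lt_top measure_closedBall_lt_top

/-- Integration in a chart. -/
lemma integral_riemannianVolume (x₀ : M) {f : M → ℝ} (hf : AEStronglyMeasurable f
    (riemannianVolume g)) (h₀ : ∀ x ∉ (extChartAt (𝓡 n) x₀).source, f x = 0) :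
    ∫ x, f x ∂(riemannianVolume g) = ∫ u in (extChartAt (𝓡 n) x₀).target,
      Real.sqrt (gram g x₀ u).det * f ((extChartAt (𝓡 n) x₀).symm u) := by
  rw [← setIntegral_eq_integral_of_forall_compl_eq_zero h₀]
  have hf' := hf.restrict (s := (extChartAt (𝓡 n) x₀).source)
  rw [riemannianVolume_restrict_source] at hf' ⊢
  have hd : AEMeasurable (fun u ↦ ENNReal.ofReal (Real.sqrt (gram g x₀ u).det))
      ((volume : Measure (EuclideanSpace ℝ (Fin n))).restrict (extChartAt (𝓡 n) x₀).target) :=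
    (continuousOn_density g x₀).aemeasurable (isOpen_extChartAt_target x₀).measurableSet
  rw [chartVolume, integral_map (aemeasurable_extChartAt_symm g x₀) hf',
    integral_withDensity_eq_integral_toReal_smul₀ hd (by simp)]
  simp [ENNReal.toReal_ofReal, Real.sqrt_nonneg]

/-- The frame makes the Gram determinant positive, since its product with a square is 1. An open set
therefore carries a positive density in a chart. -/
lemma riemannianVolume_pos {U O : Set M} {e : Fin n → (p : M) → TangentSpace (𝓡 n) p}
    (hU : IsOpen U) (he : IsOrthonormalOn g U e) (hO : IsOpen O) {x : M} (hxO : x ∈ O)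
    (hxU : x ∈ U) : 0 < riemannianVolume g O := by
  set A := (O ∩ U) ∩ (extChartAt (𝓡 n) x).source with hA_def
  have hA : IsOpen A := (hO.inter hU).inter (isOpen_extChartAt_source x)
  refine lt_of_lt_of_le ?_ (measure_mono (s := A) fun p hp ↦ hp.1.1)
  rw [riemannianVolume_apply g x hA.measurableSet Set.inter_subset_right,
    chartVolume_apply g x hA.measurableSet]
  set B := (extChartAt (𝓡 n) x).symm ⁻¹' A ∩ (extChartAt (𝓡 n) x).target with hB_def
  have hB : IsOpen B := by
    rw [hB_def, Set.inter_comm]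
    exact (continuousOn_extChartAt_symm x).isOpen_inter_preimage (isOpen_extChartAt_target x) hA
  have hBx : extChartAt (𝓡 n) x x ∈ B := by
    refine ⟨?_, mem_extChartAt_target x⟩
    rw [Set.mem_preimage, extChartAt_to_inv]
    exact ⟨⟨hxO, hxU⟩, mem_extChartAt_source x⟩
  have hpos : ∀ u ∈ B, 0 < (gram g x u).det := fun u hu ↦ by
    have hl := isLocalFrame_rep g hU he hu.2 hu.1.1.2
    have h1 := hl.det_mul_sq
    by_contra hneg
    nlinarith [sq_nonneg (IsLocalFrame.mat (fun a ↦ rep x (e a)) u).det]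
  rw [pos_iff_ne_zero]
  intro h0
  have hd : AEMeasurable (fun u ↦ ENNReal.ofReal (Real.sqrt (gram g x u).det))
      ((volume : Measure (EuclideanSpace ℝ (Fin n))).restrict B) :=
    ((continuousOn_density g x).mono Set.inter_subset_right).aemeasurable hB.measurableSet
  rw [lintegral_eq_zero_iff' hd, Filter.EventuallyEq, ae_restrict_iff' hB.measurableSet] at h0
  have h1 : volume B = 0 := by
    refine measure_mono_null (fun u hu ↦ ?_) h0
    simp only [Set.mem_compl_iff, Set.mem_ofPred_eq, not_forall]
    refine ⟨hu, ?_⟩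
    simpa using Real.sqrt_pos.2 (hpos u hu)
  exact (hB.measure_pos volume ⟨_, hBx⟩).ne' h1

end ChartVolume

end BiharmonicSubmersion
end

open scoped Manifold ContDiff
noncomputable section
namespace BiharmonicSubmersion

/-! ### The divergence theorem -/

section EuclideanDivergence

open VectorField MeasureTheory

variable {G : EuclideanSpace ℝ (Fin 3) → Matrix (Fin 3) (Fin 3) ℝ}
    {E : Fin 3 → EuclideanSpace ℝ (Fin 3) → EuclideanSpace ℝ (Fin 3)}
    {u : EuclideanSpace ℝ (Fin 3)}

/-- Along `E i` each column `E j` changes by `[E i, E j]` plus the image of `E j` under the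
derivative of `E i`. The latter contributes the trace of that derivative to the determinant, the
former the diagonal bracket coefficients. -/
lemma IsLocalFrame.fderiv_det_mat (hE : IsLocalFrame G E u) (i : Fin 3) :
    DifferentiableAt ℝ (fun v ↦ (mat E v).det) u ∧
    fderiv ℝ (fun v ↦ (mat E v).det) u (E i u) = (mat E u).det
      * (∑ k, partialDeriv k (fun v ↦ E i v k) u
        + ∑ j, bil (G u) (lieBracket ℝ (E i) (E j) u) (E j u)) := by
  have hd : ∀ j, HasFDerivAt (E j) (fderiv ℝ (E j) u) u := fun j ↦
    ((hE.frame j).differentiableAt (by simp)).hasFDerivAt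
  have hc : ∀ j k, HasFDerivAt (fun v ↦ E j v k)
      ((EuclideanSpace.proj k : EuclideanSpace ℝ (Fin 3) →L[ℝ] ℝ).comp (fderiv ℝ (E j) u)) u :=
    fun j k ↦ (EuclideanSpace.proj k : EuclideanSpace ℝ (Fin 3) →L[ℝ] ℝ).hasFDerivAt.comp u (hd j)
  have hp : ∀ j k l, partialDeriv l (fun v ↦ E j v k) u
      = (fderiv ℝ (E j) u (EuclideanSpace.single l 1)) k := fun j k l ↦ by
    rw [partialDeriv, (hc j k).fderiv]
    rfl
  have h0 := (((((((hc 0 0).fun_mul (hc 1 1)).fun_mul (hc 2 2)).fun_sub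
    (((hc 0 0).fun_mul (hc 2 1)).fun_mul (hc 1 2))).fun_sub
    (((hc 1 0).fun_mul (hc 0 1)).fun_mul (hc 2 2))).fun_add
    (((hc 1 0).fun_mul (hc 2 1)).fun_mul (hc 0 2))).fun_add
    (((hc 2 0).fun_mul (hc 0 1)).fun_mul (hc 1 2))).fun_sub
    (((hc 2 0).fun_mul (hc 1 1)).fun_mul (hc 0 2))
  have hdet : HasFDerivAt (fun v ↦ (mat E v).det) _ u :=
    h0.congr_of_eventuallyEq (Filter.Eventually.of_forall fun v ↦ Matrix.det_fin_three (mat E v))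
  refine ⟨hdet.differentiableAt, ?_⟩
  rw [hdet.fderiv]
  have hbr : ∀ j, fderiv ℝ (E j) u (E i u) = (∑ k, bil (G u) (lieBracket ℝ (E i) (E j) u) (E k u)
      • E k u) + ∑ l, E j u l • fderiv ℝ (E i) u (EuclideanSpace.single l 1) := fun j ↦ by
    rw [← hE.eq_sum, lieBracket]
    have := fderiv_apply_eq_sum (E i) u (E j u)
    simp only [partialDeriv] at this
    rw [← this]
    abel
  have hbc : ∀ j k, (EuclideanSpace.proj k : EuclideanSpace ℝ (Fin 3) →L[ℝ] ℝ)
      (fderiv ℝ (E j) u (E i u)) = (∑ l, bil (G u) (lieBracket ℝ (E i) (E j) u) (E l u)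
      * E l u k) + ∑ l, E j u l * fderiv ℝ (E i) u (EuclideanSpace.single l 1) k := fun j k ↦ by
    rw [hbr]
    simp
  simp only [_root_.add_apply, _root_.sub_apply, _root_.smul_apply, smul_eq_mul,
    ContinuousLinearMap.comp_apply, hbc, hp, Matrix.det_fin_three, Fin.sum_univ_three]
  simp only [mat, Matrix.of_apply]
  generalize fderiv ℝ (E i) u (EuclideanSpace.single 0 1) = L0
  generalize fderiv ℝ (E i) u (EuclideanSpace.single 1 1) = L1
  generalize fderiv ℝ (E i) u (EuclideanSpace.single 2 1) = L2
  ring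

/-- Near `u` the squares of `√(det G)` and of the determinant of the frame matrix multiply to 1, so
the logarithmic derivatives of the two factors are opposite. -/
lemma IsLocalFrame.fderiv_sqrt_det (hE : IsLocalFrame G E u) (i : Fin 3) :
    DifferentiableAt ℝ (fun v ↦ Real.sqrt (G v).det) u ∧
    fderiv ℝ (fun v ↦ Real.sqrt (G v).det) u (E i u) = -(Real.sqrt (G u).det
      * (∑ k, partialDeriv k (fun v ↦ E i v k) u
        + ∑ j, bil (G u) (lieBracket ℝ (E i) (E j) u) (E j u))) := by
  obtain ⟨hD, hD'⟩ := hE.fderiv_det_mat i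
  have hpos : ∀ v, IsLocalFrame G E v → 0 < (G v).det ∧ (mat E v).det ≠ 0 := fun v hv ↦ by
    have h1 := hv.det_mul_sq
    refine ⟨?_, fun h0 ↦ by simp [h0] at h1⟩
    by_contra hneg
    nlinarith [sq_nonneg (mat E v).det]
  have hG : DifferentiableAt ℝ (fun v ↦ (G v).det) u := by
    simp only [Matrix.det_fin_three]
    have := fun i j ↦ (hE.metric i j).differentiableAt (by simp)
    fun_prop
  have hS : DifferentiableAt ℝ (fun v ↦ Real.sqrt (G v).det) u := hG.sqrt (hpos u hE).1.ne'
  refine ⟨hS, ?_⟩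
  have h1 : (fun v ↦ Real.sqrt (G v).det * Real.sqrt (G v).det
      * ((mat E v).det * (mat E v).det)) =ᶠ[nhds u] fun _ ↦ (1 : ℝ) := by
    filter_upwards [hE.eventually] with v hv
    rw [Real.mul_self_sqrt (hpos v hv).1.le, ← pow_two, hv.det_mul_sq]
  have h2 : HasFDerivAt (fun v ↦ Real.sqrt (G v).det * Real.sqrt (G v).det
      * ((mat E v).det * (mat E v).det)) _ u :=
    (hS.hasFDerivAt.fun_mul hS.hasFDerivAt).fun_mul (hD.hasFDerivAt.fun_mul hD.hasFDerivAt)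
  have h3 := h1.fderiv_eq (𝕜 := ℝ)
  rw [h2.fderiv] at h3
  have h4 := DFunLike.congr_fun h3 (E i u)
  simp [hD'] at h4
  have hSpos := Real.sqrt_pos.2 (hpos u hE).1
  have hDne := (hpos u hE).2
  have h5 : 2 * Real.sqrt (G u).det * (mat E u).det ^ 2 ≠ 0 := by positivity
  apply mul_left_cancel₀ h5
  linear_combination h4

/-- Integration by parts against the constant function 1. -/
lemma integral_partialDeriv {Z : EuclideanSpace ℝ (Fin 3) → ℝ} (hZ : ContDiff ℝ 1 Z)
    (hc : HasCompactSupport Z) (j : Fin 3) :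
    Integrable (partialDeriv j Z) ∧ ∫ u, partialDeriv j Z u = 0 := by
  have hcont : Continuous (partialDeriv j Z) :=
    (hZ.continuous_fderiv (by simp)).clm_apply continuous_const
  have hint : Integrable (partialDeriv j Z) := hcont.integrable_of_hasCompactSupport
    (hc.fderiv_apply (𝕜 := ℝ) (EuclideanSpace.single j 1))
  refine ⟨hint, ?_⟩
  have := integral_mul_fderiv_eq_neg_fderiv_mul_of_integrable (μ := volume) (f := fun _ ↦ (1 : ℝ))
    (g := Z) (v := EuclideanSpace.single j 1) (by simp)
    (by simp only [one_mul]; exact hint)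
    (by simpa using hZ.continuous.integrable_of_hasCompactSupport hc)
    (fun x _ ↦ differentiableAt_const _) (fun x _ ↦ hZ.differentiable (by simp) x)
  simpa [partialDeriv] using this

end EuclideanDivergence

section Divergence

open MeasureTheory

lemma contMDiff_of_support {EM HM M : Type*} [NormedAddCommGroup EM] [NormedSpace ℝ EM]
    [TopologicalSpace HM] [TopologicalSpace M] [ChartedSpace HM M] [T2Space M]
    {I : ModelWithCorners ℝ EM HM} {n : WithTop ℕ∞} {U K : Set M} {F : M → ℝ}
    (hF : ∀ x ∈ U, ContMDiffAt I 𝓘(ℝ, ℝ) n F x)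
    (hK : IsCompact K) (hKU : K ⊆ U) (hFK : ∀ x ∉ K, F x = 0) :
    ContMDiff I 𝓘(ℝ, ℝ) n F := fun x ↦ by
  by_cases hx : x ∈ K
  · exact hF x (hKU hx)
  · exact contMDiffAt_const.congr_of_eventuallyEq
      (Filter.eventually_of_mem (hK.isClosed.isOpen_compl.mem_nhds hx) fun y hy ↦ hFK y hy)

variable {M : Type*} [TopologicalSpace M] [ChartedSpace (EuclideanSpace ℝ (Fin 3)) M]
  [IsManifold (𝓡 3) ∞ M] [T2Space M] {g : SmoothMetric 3 M} {U K : Set M}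
  {e : Fin 3 → (p : M) → TangentSpace (𝓡 3) p} {w : M → ℝ}

lemma dirDeriv_sub_eq_zero (hK : IsCompact K) (hwK : ∀ x ∉ K, w x = 0) (i : Fin 3) {x : M}
    (hx : x ∉ K) : dirDeriv (e i) w x - frameDiv g e i x * w x = 0 := by
  rw [dirDeriv_congr (f' := fun _ ↦ 0) (Filter.eventually_of_mem
    (hK.isClosed.isOpen_compl.mem_nhds hx) fun y hy ↦ hwK y hy), dirDeriv_const, hwK x hx]
  ring

lemma contMDiff_dirDeriv_sub (hU : IsOpen U) (he : IsOrthonormalOn g U e)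
    (hw : ContMDiff (𝓡 3) 𝓘(ℝ, ℝ) ∞ w) (hK : IsCompact K) (hKU : K ⊆ U)
    (hwK : ∀ x ∉ K, w x = 0) (i : Fin 3) :
    ContMDiff (𝓡 3) 𝓘(ℝ, ℝ) ∞ (fun x ↦ dirDeriv (e i) w x - frameDiv g e i x * w x) :=
  contMDiff_of_support (fun x hx ↦ (contMDiffAt_dirDeriv (hw x) (he.contMDiffAt hU hx i)).sub
    ((contMDiffAt_frameDiv g hU he hx i).mul (hw x))) hK hKU
    (fun _ hx ↦ dirDeriv_sub_eq_zero hK hwK i hx)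

variable [MeasurableSpace M] [BorelSpace M]

/-- In coordinates `√(det g)` times the integrand is `∑ⱼ ∂ⱼ (√(det g) w eᵢʲ)`, by `fderiv_sqrt_det`,
and each summand integrates to zero by compact support. -/
lemma integral_divergence_chart (hU : IsOpen U) (he : IsOrthonormalOn g U e)
    (hw : ContMDiff (𝓡 3) 𝓘(ℝ, ℝ) ∞ w) (hK : IsCompact K) (hKU : K ⊆ U)
    (hwK : ∀ x ∉ K, w x = 0) (i : Fin 3) (x₀ : M) (hKs : K ⊆ (extChartAt (𝓡 3) x₀).source) :
    ∫ x, (dirDeriv (e i) w x - frameDiv g e i x * w x) ∂(riemannianVolume g) = 0 := by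
  have hcont := (contMDiff_dirDeriv_sub hU he hw hK hKU hwK i).continuous
  rw [integral_riemannianVolume g x₀ hcont.aestronglyMeasurable
    (fun x hx ↦ dirDeriv_sub_eq_zero hK hwK i fun h ↦ hx (hKs h))]
  set T := (extChartAt (𝓡 3) x₀).target with hT
  have hTo : IsOpen T := isOpen_extChartAt_target x₀
  set K' := extChartAt (𝓡 3) x₀ '' K with hK'
  have hK'c : IsCompact K' := hK.image_of_continuousOn ((continuousOn_extChartAt x₀).mono hKs)
  have hK'T : ∀ u ∈ T, u ∉ K' → (extChartAt (𝓡 3) x₀).symm u ∉ K := fun u hu huK h ↦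
    huK ⟨_, h, (extChartAt (𝓡 3) x₀).right_inv hu⟩
  have hK'B : ∀ u ∈ K', u ∈ T ∧ (extChartAt (𝓡 3) x₀).symm u ∈ K := by
    rintro _ ⟨p, hp, rfl⟩
    refine ⟨(extChartAt (𝓡 3) x₀).map_source (hKs hp), ?_⟩
    rwa [(extChartAt (𝓡 3) x₀).left_inv (hKs hp)]
  set E : Fin 3 → EuclideanSpace ℝ (Fin 3) → EuclideanSpace ℝ (Fin 3) :=
    fun j ↦ rep x₀ (e j) with hE
  set S : EuclideanSpace ℝ (Fin 3) → ℝ := fun u ↦ Real.sqrt (gram g x₀ u).det with hS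
  set wc : EuclideanSpace ℝ (Fin 3) → ℝ := fun u ↦ w ((extChartAt (𝓡 3) x₀).symm u) with hwc
  -- Metric and frame are controlled only on part of the chart target. Cutting off by the indicator
  -- of the image of `K` keeps the function smooth there, because `w` already vanishes off `K`, and
  -- extends it by zero to all of `ℝ³`.
  set Z : Fin 3 → EuclideanSpace ℝ (Fin 3) → ℝ :=
    fun j ↦ K'.indicator (fun u ↦ S u * wc u * E i u j) with hZ
  have hZT : ∀ j, ∀ u ∈ T, Z j u = S u * wc u * E i u j := fun j u hu ↦ by
    by_cases h : u ∈ K'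
    · simp [hZ, h]
    · rw [show wc u = 0 from hwK _ (hK'T u hu h)]
      simp [hZ, h]
  have hZ0 : ∀ j, ∀ u ∉ K', Z j =ᶠ[nhds u] fun _ ↦ 0 := fun j u hu ↦
    Filter.eventually_of_mem (hK'c.isClosed.isOpen_compl.mem_nhds hu) fun v hv ↦
      Set.indicator_of_notMem hv _
  have hframe : ∀ u ∈ T, (extChartAt (𝓡 3) x₀).symm u ∈ U → IsLocalFrame (gram g x₀) E u :=
    fun u hu huU ↦ isLocalFrame_rep g hU he hu huU
  have hwcs : ∀ u ∈ T, ContDiffAt ℝ ∞ wc u := fun u hu ↦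
    (ContMDiffAt.comp u (hw _) (contMDiffAt_extChartAt_symm hu)).contDiffAt
  have hSs : ∀ u ∈ T, (extChartAt (𝓡 3) x₀).symm u ∈ U → ContDiffAt ℝ ∞ S u := fun u hu huU ↦ by
    have h1 := (hframe u hu huU).metric
    refine ContDiffAt.sqrt ?_ (hframe u hu huU).det_ne_zero
    simp only [Matrix.det_fin_three]
    fun_prop
  have hEj : ∀ u ∈ T, (extChartAt (𝓡 3) x₀).symm u ∈ U → ∀ j,
      ContDiffAt ℝ ∞ (fun v ↦ E i v j) u := fun u hu huU j ↦
    (EuclideanSpace.proj j : EuclideanSpace ℝ (Fin 3) →L[ℝ] ℝ).contDiff.contDiffAt.comp u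
      ((hframe u hu huU).frame i)
  have hZev : ∀ j, ∀ u ∈ T, Z j =ᶠ[nhds u] fun v ↦ S v * wc v * E i v j := fun j u hu ↦
    Filter.eventually_of_mem (hTo.mem_nhds hu) fun v hv ↦ hZT j v hv
  have hZs : ∀ j, ContDiff ℝ 1 (Z j) := fun j ↦ contDiff_iff_contDiffAt.2 fun u ↦ by
    by_cases h : u ∈ K'
    · obtain ⟨hu, huK⟩ := hK'B u h
      exact ((((hSs u hu (hKU huK)).mul (hwcs u hu)).mul (hEj u hu (hKU huK) j)).of_le
        (by simp)).congr_of_eventuallyEq (hZev j u hu)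
    · exact contDiffAt_const.congr_of_eventuallyEq (hZ0 j u h)
  have hZc : ∀ j, HasCompactSupport (Z j) := fun j ↦
    HasCompactSupport.intro hK'c fun u hu ↦ Set.indicator_of_notMem hu _
  rw [← integral_indicator hTo.measurableSet]
  have key : ∀ u, T.indicator (fun u ↦ S u * (dirDeriv (e i) w ((extChartAt (𝓡 3) x₀).symm u)
      - frameDiv g e i ((extChartAt (𝓡 3) x₀).symm u) * wc u)) u = ∑ j, partialDeriv j (Z j) u :=
    fun u ↦ by
    by_cases h : u ∈ K'
    · obtain ⟨hu, huK⟩ := hK'B u h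
      have huU := hKU huK
      have hf := hframe u hu huU
      rw [Set.indicator_of_mem hu, frameDiv_eq g hU he hu huU,
        dirDeriv_eq_fderiv (e i) hu ((hw _).mdifferentiableAt (by simp))]
      obtain ⟨dS, dS'⟩ := hf.fderiv_sqrt_det i
      have hpd : ∀ j, partialDeriv j (Z j) u = S u * wc u * partialDeriv j (fun v ↦ E i v j) u
          + E i u j * (S u * partialDeriv j wc u + wc u * partialDeriv j S u) := fun j ↦ by
        have h1 : HasFDerivAt (fun v ↦ S v * wc v * E i v j) _ u :=
          (dS.hasFDerivAt.fun_mul ((hwcs u hu).differentiableAt (by simp)).hasFDerivAt).fun_mul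
            ((hEj u hu huU j).differentiableAt (by simp)).hasFDerivAt
        rw [partialDeriv, (hZev j u hu).fderiv_eq, h1.fderiv]
        simp only [partialDeriv, _root_.add_apply, _root_.smul_apply, smul_eq_mul]
        rfl
      have hS' : fderiv ℝ S u (E i u) = _ := dS'
      have hw' := fderiv_apply_eq_sum wc u (E i u)
      rw [fderiv_apply_eq_sum S] at hS'
      simp only [smul_eq_mul] at hS' hw'
      simp only [hpd, Finset.sum_add_distrib, mul_add, ← Finset.mul_sum]
      have r1 : ∑ j, E i u j * (S u * partialDeriv j wc u)
          = S u * ∑ j, E i u j * partialDeriv j wc u := by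
        rw [Finset.mul_sum]
        exact Finset.sum_congr rfl fun j _ ↦ by ring
      have r2 : ∑ j, E i u j * (wc u * partialDeriv j S u)
          = wc u * ∑ j, E i u j * partialDeriv j S u := by
        rw [Finset.mul_sum]
        exact Finset.sum_congr rfl fun j _ ↦ by ring
      rw [r1, r2, hS']
      change S u * (fderiv ℝ wc u (E i u) - _ * wc u) = _
      rw [hw']
      simp only [hE, hS]
      ring
    · have h0 : ∑ j, partialDeriv j (Z j) u = 0 := Finset.sum_eq_zero fun j _ ↦ by
        rw [partialDeriv, (hZ0 j u h).fderiv_eq]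
        simp
      rw [h0]
      by_cases hu : u ∈ T
      · rw [Set.indicator_of_mem hu]
        simp only [hwc]
        rw [dirDeriv_sub_eq_zero hK hwK i (hK'T u hu h), mul_zero]
      · exact Set.indicator_of_notMem hu _
  rw [integral_congr_ae (Filter.Eventually.of_forall key), integral_finsetSum _ fun j _ ↦
    (integral_partialDeriv (hZs j) (hZc j) j).1]
  exact Finset.sum_eq_zero fun j _ ↦ (integral_partialDeriv (hZs j) (hZc j) j).2

variable [SecondCountableTopology M]

/-- The integral of a divergence vanishes. -/
theorem integral_divergence (hU : IsOpen U) (he : IsOrthonormalOn g U e)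
    (hw : ContMDiff (𝓡 3) 𝓘(ℝ, ℝ) ∞ w) (hK : IsCompact K) (hKU : K ⊆ U)
    (hwK : ∀ x ∉ K, w x = 0) (i : Fin 3) :
    Integrable (fun x ↦ dirDeriv (e i) w x - frameDiv g e i x * w x) (riemannianVolume g) ∧
    ∫ x, (dirDeriv (e i) w x - frameDiv g e i x * w x) ∂(riemannianVolume g) = 0 := by
  have := ChartedSpace.locallyCompactSpace (EuclideanSpace ℝ (Fin 3)) M
  have hint : ∀ w : M → ℝ, ContMDiff (𝓡 3) 𝓘(ℝ, ℝ) ∞ w → (∀ x ∉ K, w x = 0) →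
      Integrable (fun x ↦ dirDeriv (e i) w x - frameDiv g e i x * w x) (riemannianVolume g) :=
    fun w hw hwK ↦
    (contMDiff_dirDeriv_sub hU he hw hK hKU hwK i).continuous.integrable_of_hasCompactSupport
      (HasCompactSupport.intro hK fun x hx ↦ dirDeriv_sub_eq_zero hK hwK i hx)
  refine ⟨hint w hw hwK, ?_⟩
  -- Compactness gives a finite cover by chart domains, so the sums over the partition of unity are
  -- finite and commute with derivative and integral.
  obtain ⟨t, ht⟩ := hK.elim_finite_subcover (fun x : M ↦ (extChartAt (𝓡 3) x).source)
    (fun x ↦ isOpen_extChartAt_source x) fun x _ ↦ Set.mem_iUnion.2 ⟨x, mem_extChartAt_source x⟩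
  obtain ⟨ρ, hρ⟩ := SmoothPartitionOfUnity.exists_isSubordinate (𝓡 3) hK.isClosed
    (fun x : t ↦ (extChartAt (𝓡 3) (x : M)).source) (fun x ↦ isOpen_extChartAt_source _)
    (fun x hx ↦ by
      obtain ⟨y, hy, hxy⟩ := Set.mem_iUnion₂.1 (ht hx)
      exact Set.mem_iUnion.2 ⟨⟨y, hy⟩, hxy⟩)
  have hsum : w = fun x ↦ ∑ j, ρ j x * w x := funext fun x ↦ by
    by_cases hx : x ∈ K
    · rw [← Finset.sum_mul, ← finsum_eq_sum_of_fintype, ρ.sum_eq_one hx, one_mul]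
    · simp [hwK x hx]
  have hρw : ∀ j, ContMDiff (𝓡 3) 𝓘(ℝ, ℝ) ∞ (fun x ↦ ρ j x * w x) := fun j ↦
    (ρ j).contMDiff.mul hw
  have hρK : ∀ j, ∀ x ∉ K, ρ j x * w x = 0 := fun j x hx ↦ by rw [hwK x hx, mul_zero]
  have hD : ∀ x, dirDeriv (e i) w x - frameDiv g e i x * w x = ∑ j,
      (dirDeriv (e i) (fun x ↦ ρ j x * w x) x - frameDiv g e i x * (ρ j x * w x)) := fun x ↦ by
    have h1 : dirDeriv (e i) (fun x ↦ ∑ j, ρ j x * w x) x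
        = ∑ j, dirDeriv (e i) (fun x ↦ ρ j x * w x) x := by
      have : ∀ s : Finset t, HasDirDeriv (e i) (fun x ↦ ∑ j ∈ s, ρ j x * w x) x
          (∑ j ∈ s, dirDeriv (e i) (fun x ↦ ρ j x * w x) x) := fun s ↦ by
        classical
        induction s using Finset.induction_on with
        | empty => simpa using HasDirDeriv.const 0
        | insert a s ha ih =>
          simp only [Finset.sum_insert ha]
          exact ((hρw a) x).hasDirDeriv.add ih
      exact (this Finset.univ).2
    rw [Finset.sum_sub_distrib, ← Finset.mul_sum, ← h1, ← hsum]
    rw [← congrFun hsum x]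
  simp only [hD]
  rw [integral_finsetSum _ fun j _ ↦ hint _ (hρw j) (hρK j)]
  refine Finset.sum_eq_zero fun j _ ↦ ?_
  refine integral_divergence_chart hU he (hρw j) (K := K ∩ tsupport (ρ j))
    (hK.inter_right (isClosed_tsupport _)) (fun x hx ↦ hKU hx.1) (fun x hx ↦ ?_) i (j : M)
    (fun x hx ↦ hρ j hx.2)
  by_cases h : x ∈ K
  · rw [image_eq_zero_of_notMem_tsupport fun h' ↦ hx ⟨h, h'⟩, zero_mul]
  · exact hρK j x h

end Divergence

end BiharmonicSubmersion
end

open scoped Manifold ContDiff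
noncomputable section
namespace BiharmonicSubmersion

/-! ### The first variation of the bienergy -/

section ParametricIntegral

open MeasureTheory

/-- By the tube lemma the integrand is smooth on an interval around 0 times `K`, and by compactness
its time derivative is bounded there, so differentiation under the integral is dominated by a
constant. -/
lemma hasDerivAt_setIntegral {m : ℕ} {M : Type*} [TopologicalSpace M]
    [ChartedSpace (EuclideanSpace ℝ (Fin m)) M] [IsManifold (𝓡 m) ∞ M] [T2Space M]
    [MeasurableSpace M] [BorelSpace M] {μ : Measure M} [IsFiniteMeasureOnCompacts μ] {K : Set M}
    (hK : IsCompact K) {W : Set (ℝ × M)} (hW : IsOpen W) (hKW : ∀ x ∈ K, ((0 : ℝ), x) ∈ W)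
    {S : ℝ → M → ℝ} (hS : ∀ q ∈ W, ContMDiffAt (𝓘(ℝ, ℝ).prod (𝓡 m)) 𝓘(ℝ, ℝ) ∞
      (fun q : ℝ × M ↦ S q.1 q.2) q) :
    HasDerivAt (fun t ↦ ∫ x in K, S t x ∂μ) (∫ x in K, deriv (fun t ↦ S t x) 0 ∂μ) 0 := by
  obtain ⟨u, v, huo, -, h0u, hKv, huv⟩ := generalized_tube_lemma (isCompact_singleton (x := (0 : ℝ)))
    hK hW (by rintro ⟨t, x⟩ ⟨ht, hx⟩; obtain rfl : t = 0 := ht; exact hKW x hx)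
  obtain ⟨δ, hδ, hδu⟩ := Metric.nhds_basis_closedBall.mem_iff.1 (huo.mem_nhds (h0u rfl))
  have hmem : ∀ t ∈ Metric.closedBall (0 : ℝ) δ, ∀ x ∈ K, (t, x) ∈ W := fun t ht x hx ↦
    huv ⟨hδu ht, hKv hx⟩
  have hder : ContinuousOn (fun q : ℝ × M ↦ deriv (fun t ↦ S t q.2) q.1) W := fun q hq ↦
    (contMDiffAt_deriv_family (J := 𝓘(ℝ, ℝ).prod (𝓡 m)) (S := fun (q : ℝ × M) t ↦ S t q.2)
      (c := Prod.fst) (ContMDiffAt.comp (q, q.1) (g := fun q : ℝ × M ↦ S q.1 q.2) (hS q hq)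
        (contMDiffAt_snd.prodMk (contMDiffAt_snd.comp (q, q.1) contMDiffAt_fst)))
      contMDiffAt_fst).continuousAt.continuousWithinAt
  obtain ⟨C, hC⟩ := ((isCompact_closedBall (0 : ℝ) δ).prod hK).exists_bound_of_continuousOn
    (hder.mono fun q hq ↦ hmem q.1 hq.1 q.2 hq.2)
  have hcS : ∀ t ∈ Metric.closedBall (0 : ℝ) δ, ContinuousOn (S t) K := fun t ht x hx ↦
    (ContinuousAt.comp (f := fun x : M ↦ (t, x)) (g := fun q : ℝ × M ↦ S q.1 q.2)
      (hS _ (hmem t ht x hx)).continuousAt (by fun_prop)).continuousWithinAt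
  have h0 : (0 : ℝ) ∈ Metric.closedBall (0 : ℝ) δ := Metric.mem_closedBall_self hδ.le
  have hcD : ContinuousOn (fun x ↦ deriv (fun t ↦ S t x) 0) K := fun x hx ↦
    (ContinuousAt.comp (f := fun x : M ↦ ((0 : ℝ), x))
      (g := fun q : ℝ × M ↦ deriv (fun t ↦ S t q.2) q.1)
      (hder.continuousAt (hW.mem_nhds (hmem 0 h0 x hx))) (by fun_prop)).continuousWithinAt
  have hball : Metric.closedBall (0 : ℝ) δ ∈ nhds (0 : ℝ) := Metric.closedBall_mem_nhds _ hδ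
  refine (hasDerivAt_integral_of_dominated_loc_of_deriv_le
    (F' := fun t x ↦ deriv (fun t ↦ S t x) t) (bound := fun _ ↦ C) hball ?_
    ((hcS 0 h0).integrableOn_compact hK) (hcD.aestronglyMeasurable hK.measurableSet) ?_
    (continuousOn_const.integrableOn_compact hK) ?_).2
  · filter_upwards [hball] with t ht using (hcS t ht).aestronglyMeasurable hK.measurableSet
  · exact ae_restrict_of_forall_mem hK.measurableSet fun x hx t ht ↦ hC (t, x) ⟨ht, hx⟩
  · refine ae_restrict_of_forall_mem hK.measurableSet fun x hx t ht ↦ ?_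
    have h1 : ContMDiffAt 𝓘(ℝ, ℝ) 𝓘(ℝ, ℝ) ∞ (fun t ↦ S t x) t :=
      ContMDiffAt.comp t (g := fun q : ℝ × M ↦ S q.1 q.2) (hS _ (hmem t ht x hx))
        (contMDiffAt_id.prodMk contMDiffAt_const)
    exact (h1.contDiffAt.differentiableAt (by simp)).hasDerivAt

end ParametricIntegral

section FirstVariation

open VectorField MeasureTheory

variable {M N : Type*}
  [TopologicalSpace M] [ChartedSpace (EuclideanSpace ℝ (Fin 3)) M] [IsManifold (𝓡 3) ∞ M]
  [TopologicalSpace N] [ChartedSpace (EuclideanSpace ℝ (Fin 2)) N] [IsManifold (𝓡 2) ∞ N]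
  {g : SmoothMetric 3 M} {h : SmoothMetric 2 N} {π : M → N} {U : Set M} {V : Set N}
  {e₁ e₂ e₃ : (p : M) → TangentSpace (𝓡 3) p} {ε₁ ε₂ : (y : N) → TangentSpace (𝓡 2) y}
  {f₁ f₂ κ₁ κ₂ σ : M → ℝ}

lemma varCoeff_eq_zero {Φ : ℝ → M → N} {x : M} (hx : ∀ t, Φ t x = Φ 0 x)
    (Y : (y : N) → TangentSpace (𝓡 2) y) : varCoeff h Φ Y x = 0 := by
  have h1 : mfderiv 𝓘(ℝ, ℝ) (𝓡 2) (fun t ↦ Φ t x) 0 = 0 := by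
    rw [show (fun t ↦ Φ t x) = fun _ ↦ Φ 0 x from funext hx]
    exact mfderiv_const
  rw [varCoeff]
  have h2 : mfderiv 𝓘(ℝ, ℝ) (𝓡 2) (fun t ↦ Φ t x) 0 (1 : ℝ)
      = (0 : TangentSpace (𝓡 2) (Φ 0 x)) := DFunLike.congr_fun h1 (1 : ℝ)
  rw [h2, map_zero]
  rfl

namespace IsAdaptedFrame

/-- Pairing the two expansions of the tension field with `ε_a` compares coefficients. In the first
variation this turns the undifferentiated tension factor into `-κ_a`. -/
lemma tensionCoeff_eq (hπ : ContMDiff (𝓡 3) (𝓡 2) ∞ π)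
    (hf : IsAdaptedFrame g h π U V e₁ e₂ e₃ ε₁ ε₂)
    (hd : IsIntegrabilityData π U V e₁ e₂ e₃ ε₁ ε₂ f₁ f₂ κ₁ κ₂ σ) {p : M} (hp : p ∈ U)
    (a : Fin 2) : tensionCoeff g h ![e₁, e₂, e₃] ![ε₁, ε₂] π a p = -(![κ₁, κ₂] a p) := by
  have h1 := tension_eq_frame g h hf.isOpen_source hf.frame hf.isOpen_target hf.baseFrame hp
    (hf.mapsTo hp) (Filter.Eventually.of_forall fun q ↦ hπ q)
  change tension g h π p = ∑ a, tensionCoeff g h ![e₁, e₂, e₃] ![ε₁, ε₂] π a p •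
    ![ε₁, ε₂] a (π p) at h1
  rw [hf.tension_eq hπ hd hp, Fin.sum_univ_two] at h1
  change -κ₁ p • ε₁ (π p) - κ₂ p • ε₂ (π p) = _ • ε₁ (π p) + _ • ε₂ (π p) at h1
  obtain ⟨h11, h12, h21, h22⟩ := hf.base_inner_eq (hf.mapsTo hp)
  have h2 := fun z ↦ DFunLike.congr_fun (congrArg (h.inner (π p)) h1) z
  have h3 := h2 (ε₁ (π p))
  have h4 := h2 (ε₂ (π p))
  simp [h11, h12, h21, h22] at h3 h4
  fin_cases a
  · exact h3.symm
  · exact h4.symm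

lemma contMDiffAt_data (hπ : ContMDiff (𝓡 3) (𝓡 2) ∞ π)
    (hf : IsAdaptedFrame g h π U V e₁ e₂ e₃ ε₁ ε₂)
    (hd : IsIntegrabilityData π U V e₁ e₂ e₃ ε₁ ε₂ f₁ f₂ κ₁ κ₂ σ) {p : M} (hp : p ∈ U)
    (a : Fin 2) : ContMDiffAt (𝓡 3) 𝓘(ℝ, ℝ) ∞ (![f₁, f₂] a) p ∧
      ContMDiffAt (𝓡 3) 𝓘(ℝ, ℝ) ∞ (![κ₁, κ₂] a) p := by
  obtain ⟨F₁, F₂, hF, hf₁, hf₂⟩ := hd.base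
  have h1 := hf.contMDiffAt_kappa hd hp
  have h2 := (hf.dirDeriv_pullback hπ (fun y hy ↦ (hf.contMDiffAt_base hF hy).1) hf₁ hp).1
  have h3 := (hf.dirDeriv_pullback hπ (fun y hy ↦ (hf.contMDiffAt_base hF hy).2) hf₂ hp).1
  fin_cases a
  · exact ⟨h2, h1.1⟩
  · exact ⟨h3, h1.2⟩

/-- The Laplacian and the Gauss curvature are defined in a chart that changes with the point, so
smoothness is not visible from the definition; on `U` they are replaced by their frame expressions.
-/
lemma contMDiffAt_bitension (hπ : ContMDiff (𝓡 3) (𝓡 2) ∞ π)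
    (hf : IsAdaptedFrame g h π U V e₁ e₂ e₃ ε₁ ε₂)
    (hd : IsIntegrabilityData π U V e₁ e₂ e₃ ε₁ ε₂ f₁ f₂ κ₁ κ₂ σ) {p : M} (hp : p ∈ U)
    (a : Fin 2) : ContMDiffAt (𝓡 3) 𝓘(ℝ, ℝ) ∞ (bitension ![e₁, e₂, e₃] (laplacian g) ![f₁, f₂]
      ![κ₁, κ₂] (fun q ↦ gaussCurvature h (π q)) a) p := by
  have hU := hf.isOpen_source
  have he := fun i ↦ hf.frame.contMDiffAt hU hp i
  have hfs := fun a ↦ (hf.contMDiffAt_data hπ hd hp a).1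
  have hκ := fun a ↦ (hf.contMDiffAt_data hπ hd hp a).2
  have hΔ : ∀ a, ContMDiffAt (𝓡 3) 𝓘(ℝ, ℝ) ∞ (laplacian g (![κ₁, κ₂] a)) p := fun a ↦ by
    refine ContMDiffAt.congr_of_eventuallyEq (f := fun q ↦ ∑ i,
      (dirDeriv (![e₁, e₂, e₃] i) (dirDeriv (![e₁, e₂, e₃] i) (![κ₁, κ₂] a)) q
        - frameDiv g ![e₁, e₂, e₃] i q * dirDeriv (![e₁, e₂, e₃] i) (![κ₁, κ₂] a) q)) ?_ ?_
    · exact contMDiffAt_finsetSum fun i _ ↦ (contMDiffAt_dirDeriv (contMDiffAt_dirDeriv (hκ a)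
        (he i)) (he i)).sub ((contMDiffAt_frameDiv g hU hf.frame hp i).mul
          (contMDiffAt_dirDeriv (hκ a) (he i)))
    · filter_upwards [hU.mem_nhds hp] with q hq
      exact laplacian_eq_frame g hU hf.frame hq (Filter.eventually_of_mem (hU.mem_nhds hq)
        fun y hy ↦ (hf.contMDiffAt_data hπ hd hy a).2)
  have hK : ContMDiffAt (𝓡 3) 𝓘(ℝ, ℝ) ∞ (fun q ↦ gaussCurvature h (π q)) p := by
    refine ContMDiffAt.congr_of_eventuallyEq (f := fun q ↦
      -(dirDeriv (![e₁, e₂, e₃] 1) (![f₁, f₂] 0) q - dirDeriv (![e₁, e₂, e₃] 0) (![f₁, f₂] 1) q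
        + ![f₁, f₂] 0 q ^ 2 + ![f₁, f₂] 1 q ^ 2)) ?_ ?_
    · exact ((((contMDiffAt_dirDeriv (hfs 0) (he 1)).sub (contMDiffAt_dirDeriv (hfs 1)
        (he 0))).add ((hfs 0).pow 2)).add ((hfs 1).pow 2)).neg
    · filter_upwards [hU.mem_nhds hp] with q hq using hf.gaussCurvature_eq hπ hd hq
  have d1 := fun i a ↦ contMDiffAt_dirDeriv (hκ a) (he i)
  have d2 := fun i a b ↦ contMDiffAt_dirDeriv ((hκ a).mul (hfs b)) (he i)
  have d3 := (hK.neg.add ((hfs 0).pow 2)).add ((hfs 1).pow 2)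
  fin_cases a
  · exact ((((((((hΔ 0).neg.sub ((hfs 0).mul (d1 0 1))).sub (d2 0 1 0)).sub
      ((hfs 1).mul (d1 1 1))).sub (d2 1 1 1)).add (((hκ 0).mul (hκ 1)).mul (hfs 0))).add
      (((hκ 1).pow 2).mul (hfs 1))).add ((hκ 0).mul d3))
  · exact ((((((((hΔ 1).neg.add ((hfs 0).mul (d1 0 0))).add (d2 0 0 0)).add
      ((hfs 1).mul (d1 1 0))).add (d2 1 0 1)).sub (((hκ 0).mul (hκ 1)).mul (hfs 1))).sub
      (((hκ 0).pow 2).mul (hfs 0))).add ((hκ 1).mul d3))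

variable [T2Space M] [SecondCountableTopology M] [MeasurableSpace M] [BorelSpace M]

/-- The first variation formula for the bienergy. -/
theorem hasDerivAt_bienergy (hπ : ContMDiff (𝓡 3) (𝓡 2) ∞ π)
    (hf : IsAdaptedFrame g h π U V e₁ e₂ e₃ ε₁ ε₂)
    (hd : IsIntegrabilityData π U V e₁ e₂ e₃ ε₁ ε₂ f₁ f₂ κ₁ κ₂ σ) {Ω : Set M} (hΩ : IsCompact Ω)
    (hΩU : Ω ⊆ U) {Φ : ℝ → M → N}
    (hΦ : ContMDiff (𝓘(ℝ, ℝ).prod (𝓡 3)) (𝓡 2) ∞ (fun q : ℝ × M ↦ Φ q.1 q.2)) (hΦ0 : Φ 0 = π)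
    (hΦΩ : ∀ t, ∀ x ∉ Ω, Φ t x = π x) :
    HasDerivAt (fun t ↦ bienergy g h Ω (Φ t)) (∫ x in Ω, ∑ a,
      bitension ![e₁, e₂, e₃] (laplacian g) ![f₁, f₂] ![κ₁, κ₂] (fun q ↦ gaussCurvature h (π q)) a x
        * varCoeff h Φ (![ε₁, ε₂] a) x ∂(riemannianVolume g)) 0 := by
  obtain ⟨F₁, F₂, hF, hf₁, hf₂⟩ := hd.base
  have hU := hf.isOpen_source
  have hV := hf.isOpen_target
  set e := ![e₁, e₂, e₃]
  set ε := ![ε₁, ε₂]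
  set f := ![f₁, f₂]
  set κ := ![κ₁, κ₂]
  set E := bitension e (laplacian g) f κ (fun q ↦ gaussCurvature h (π q)) with hE
  set W : Fin 2 → M → ℝ := fun a ↦ varCoeff h Φ (ε a) with hW
  have he : IsOrthonormalOn g U e := hf.frame
  have hε : IsOrthonormalOn h V ε := hf.baseFrame
  have hUV : ∀ y ∈ U, Φ 0 y ∈ V := fun y hy ↦ by rw [hΦ0]; exact hf.mapsTo hy
  have hslice : ∀ t, ContMDiff (𝓡 3) (𝓡 2) ∞ (Φ t) := fun t y ↦
    ContMDiffAt.comp y (g := fun q : ℝ × M ↦ Φ q.1 q.2) (f := fun y ↦ (t, y)) (hΦ (t, y))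
      (contMDiffAt_const.prodMk contMDiffAt_id)
  set O : Set (ℝ × M) := {q | q.2 ∈ U ∧ Φ q.1 q.2 ∈ V} with hO_def
  have hO : IsOpen O := (hU.preimage continuous_snd).inter (hV.preimage hΦ.continuous)
  have hΩO : ∀ x ∈ Ω, ((0 : ℝ), x) ∈ O := fun x hx ↦ ⟨hΩU hx, hUV x (hΩU hx)⟩
  have hτs : ∀ q ∈ O, ∀ a, ContMDiffAt (𝓘(ℝ, ℝ).prod (𝓡 3)) 𝓘(ℝ, ℝ) ∞
      (fun q : ℝ × M ↦ tensionCoeff g h e ε (Φ q.1) a q.2) q := fun q hq a ↦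
    contMDiffAt_tensionCoeff_variation g h hU he hV hε hΦ hq.1 hq.2 a
  have hWs : ∀ x ∈ U, ∀ a, ContMDiffAt (𝓡 3) 𝓘(ℝ, ℝ) ∞ (W a) x := fun x hx a ↦
    contMDiffAt_varCoeff h hΦ (hε.contMDiffAt hV (hUV x hx) a)
  have hW0 : ∀ x ∉ Ω, ∀ a, W a x = 0 := fun x hx a ↦
    varCoeff_eq_zero (fun t ↦ by rw [hΦΩ t x hx, hΦΩ 0 x hx]) _
  have hWd : ∀ x ∉ Ω, ∀ a i, dirDeriv (e i) (W a) x = 0 := fun x hx a i ↦ by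
    rw [dirDeriv_congr (f' := fun _ ↦ 0) (Filter.eventually_of_mem
      (hΩ.isClosed.isOpen_compl.mem_nhds hx) fun y hy ↦ hW0 y hy a), dirDeriv_const]
  -- The variation field vanishes on the open complement of `Ω`, hence so do its derivatives and
  -- every term of the flux.
  have hfl0 : ∀ x ∉ Ω, ∀ i, bienergyFlux e f κ W i x = 0 := fun x hx i ↦ by
    have hl : lowerFlux f κ W i x = 0 := by
      fin_cases i
      · change -(κ 0 x * (f 0 x * W 1 x)) + 2 * (κ 1 x * (f 0 x * W 0 x))
          + κ 1 x * (f 1 x * W 1 x) = 0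
        rw [hW0 x hx, hW0 x hx]; ring
      · change -(κ 0 x * (f 0 x * W 0 x)) - 2 * (κ 0 x * (f 1 x * W 1 x))
          + κ 1 x * (f 1 x * W 0 x) = 0
        rw [hW0 x hx, hW0 x hx]; ring
      · rfl
    simp only [bienergyFlux, diffVariation, hWd x hx, hW0 x hx, hl]
    ring
  have hfl : ∀ i, ContMDiff (𝓡 3) 𝓘(ℝ, ℝ) ∞ (bienergyFlux e f κ W i) := fun i ↦
    contMDiff_of_support (fun x hx ↦ contMDiffAt_bienergyFlux
      (fun i ↦ he.contMDiffAt hU hx i) (fun a ↦ (hf.contMDiffAt_data hπ hd hx a).1)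
      (fun a ↦ (hf.contMDiffAt_data hπ hd hx a).2) (hWs x hx) i) hΩ hΩU fun x hx ↦ hfl0 x hx i
  have hdiv := fun i ↦ integral_divergence hU he (hfl i) hΩ hΩU (fun x hx ↦ hfl0 x hx i) i
  have hder : ∀ x ∈ U, HasDerivAt (fun t ↦ (1 / 2) * ∑ a, tensionCoeff g h e ε (Φ t) a x ^ 2)
      ((∑ a, E a x * W a x) + ∑ i, (dirDeriv (e i) (bienergyFlux e f κ W i) x
        - frameDiv g e i x * bienergyFlux e f κ W i x)) 0 := fun x hx ↦ by
    have hA : ∀ y ∈ U, ∀ i a, frameDiff h (Φ 0) (e i) (ε a) y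
        = if i.val = a.val then 1 else 0 := fun y hy i a ↦ by
      rw [hΦ0]
      exact hf.frameDiff_eq hy i a
    have hfF : ∀ y ∈ U, ∀ a, f a y = ![F₁, F₂] a (Φ 0 y) := fun y hy a ↦ by
      rw [hΦ0]
      fin_cases a
      · exact hf₁ y hy
      · exact hf₂ y hy
    obtain ⟨t0, t1⟩ := hasDerivAt_tensionCoeff hU he hV hε (F := ![F₁, F₂]) hF
      (fun y hy A ↦ hf.sum_connCoeff hy (hF y hy) A) hΦ hUV hA hfF hx
    have hκ0 : ∀ a, tensionCoeff g h e ε (Φ 0) a x = -(κ a x) := fun a ↦ by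
      rw [hΦ0]
      exact hf.tensionCoeff_eq hπ hd hx a
    have p1 := hf.dirDeriv_pullback hπ (fun y hy ↦ (hf.contMDiffAt_base hF hy).1) hf₁ hx
    have p2 := hf.dirDeriv_pullback hπ (fun y hy ↦ (hf.contMDiffAt_base hF hy).2) hf₂ hx
    have main := first_variation_density (fun i ↦ he.contMDiffAt hU hx i)
      (fun a ↦ (hf.contMDiffAt_data hπ hd hx a).1) (fun a ↦ (hf.contMDiffAt_data hπ hd hx a).2)
      (hWs x hx) (hf.frameDiv_eq hd hx) (K := fun q ↦ gaussCurvature h (π q))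
      (hf.gaussCurvature_eq hπ hd hx) (Δ := laplacian g) (fun a ↦ laplacian_eq_frame g hU he hx
        (Filter.eventually_of_mem (hU.mem_nhds hx) fun y hy ↦ (hf.contMDiffAt_data hπ hd hy a).2))
    have q1 : ∀ a b, dirDeriv (ε a) (![F₁, F₂] b) (Φ 0 x)
        = dirDeriv (![e 0, e 1] a) (f b) x := fun a b ↦ by
      rw [hΦ0]
      fin_cases a <;> fin_cases b
      · exact p1.2.1.symm
      · exact p2.2.1.symm
      · exact p1.2.2.symm
      · exact p2.2.2.symm
    have h1 : HasDerivAt (fun t ↦ (1 / 2) * (tensionCoeff g h e ε (Φ t) 0 x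
        * tensionCoeff g h e ε (Φ t) 0 x + tensionCoeff g h e ε (Φ t) 1 x
        * tensionCoeff g h e ε (Φ t) 1 x)) _ 0 :=
      ((t0.fun_mul t0).fun_add (t1.fun_mul t1)).const_mul (1 / 2)
    refine (h1.congr_of_eventuallyEq (Filter.Eventually.of_forall fun t ↦ ?_)).congr_deriv ?_
    · simp only [Fin.sum_univ_two, pow_two]
    · rw [hκ0, hκ0, Fin.sum_univ_two (f := fun a ↦ E a x * W a x), hE, ← main]
      rw [Fin.sum_univ_two (f := fun a ↦ varCoeff h Φ (ε a) x
        * dirDeriv (ε a) (![F₁, F₂] 1) (Φ 0 x)), Fin.sum_univ_two (f := fun a ↦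
        varCoeff h Φ (ε a) x * dirDeriv (ε a) (![F₁, F₂] 0) (Φ 0 x)), q1, q1, q1, q1]
      change _ = -κ 0 x * (_ + (varCoeff h Φ (ε 0) x * dirDeriv (![e 0, e 1] 0) (f 1) x
        + varCoeff h Φ (ε 1) x * dirDeriv (![e 0, e 1] 1) (f 1) x))
        + -κ 1 x * (_ - (varCoeff h Φ (ε 0) x * dirDeriv (![e 0, e 1] 0) (f 0) x
        + varCoeff h Φ (ε 1) x * dirDeriv (![e 0, e 1] 1) (f 0) x))
      ring
  have hint : ∀ a, IntegrableOn (fun x ↦ E a x * W a x) Ω (riemannianVolume g) := fun a ↦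
    ContinuousOn.integrableOn_compact hΩ fun x hx ↦
      ((hf.contMDiffAt_bitension hπ hd (hΩU hx) a).mul
        (hWs x (hΩU hx) a)).continuousAt.continuousWithinAt
  have h1 := hasDerivAt_setIntegral (μ := riemannianVolume g) hΩ hO hΩO
    (S := fun t x ↦ (1 / 2) * ∑ a, tensionCoeff g h e ε (Φ t) a x ^ 2) (fun q hq ↦
      contMDiffAt_const.mul (contMDiffAt_finsetSum fun a _ ↦ (hτs q hq a).pow 2))
  have h2 : ∫ x in Ω, deriv (fun t ↦ (1 / 2) * ∑ a, tensionCoeff g h e ε (Φ t) a x ^ 2) 0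
      ∂(riemannianVolume g) = ∫ x in Ω, ∑ a, E a x * W a x ∂(riemannianVolume g) := by
    rw [setIntegral_congr_fun hΩ.measurableSet fun x hx ↦ (hder x (hΩU hx)).deriv,
      integral_add (integrable_finsetSum _ fun a _ ↦ hint a)
        (integrable_finsetSum _ fun i _ ↦ (hdiv i).1.integrableOn),
      integral_finsetSum _ fun i _ ↦ (hdiv i).1.integrableOn]
    rw [Finset.sum_eq_zero fun i _ ↦ ?_, add_zero]
    -- The divergence vanishes outside `Ω`, so its integral over `Ω` is the integral over `M`.
    rw [setIntegral_eq_integral_of_forall_compl_eq_zero fun x hx ↦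
      dirDeriv_sub_eq_zero hΩ (fun y hy ↦ hfl0 y hy i) i hx]
    exact (hdiv i).2
  rw [h2] at h1
  refine h1.congr_of_eventuallyEq ?_
  -- For small times all of `Ω` is mapped into `V`, where the frame expression of the bienergy
  -- density is valid; at other times no formula is needed.
  obtain ⟨u, v, huo, -, h0u, hKv, huv⟩ := generalized_tube_lemma
    (isCompact_singleton (x := (0 : ℝ))) hΩ hO
    (by rintro ⟨t, x⟩ ⟨ht, hx⟩; obtain rfl : t = 0 := ht; exact hΩO x hx)
  filter_upwards [huo.mem_nhds (h0u rfl)] with t ht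
  rw [bienergy, ← integral_const_mul]
  refine setIntegral_congr_fun hΩ.measurableSet fun x hx ↦ ?_
  have hq := huv (show (t, x) ∈ u ×ˢ v from ⟨ht, hKv hx⟩)
  exact congrArg ((1 / 2 : ℝ) * ·) (inner_tension_self g h hU he hV hε hq.1 hq.2 (hslice t))

end IsAdaptedFrame

end FirstVariation

end BiharmonicSubmersion
end

open scoped Manifold ContDiff
noncomputable section
namespace BiharmonicSubmersion

/-! ### The Euler–Lagrange equations of the bienergy -/

section Converse

open MeasureTheory

/-- Component of a chart-constant vector field on `Y`; its continuity keeps the integrand positive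
near the centre of the bump. -/
lemma continuousAt_bil_rep {n : ℕ} {N : Type*} [TopologicalSpace N]
    [ChartedSpace (EuclideanSpace ℝ (Fin n)) N] [IsManifold (𝓡 n) ∞ N] (h : SmoothMetric n N)
    (y₀ : N) (v : EuclideanSpace ℝ (Fin n)) {Y : (y : N) → TangentSpace (𝓡 n) y}
    (hY : ContMDiffAt (𝓡 n) (𝓡 n).tangent ∞ (fun y ↦ (⟨y, Y y⟩ : TangentBundle (𝓡 n) N)) y₀) :
    ContinuousAt (fun y ↦ bil (gram h y₀ (extChartAt (𝓡 n) y₀ y)) v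
      (rep y₀ Y (extChartAt (𝓡 n) y₀ y))) y₀ := by
  have hu := mem_extChartAt_target (I := 𝓡 n) y₀
  have h1 : ContinuousAt (fun u ↦ bil (gram h y₀ u) v (rep y₀ Y u)) (extChartAt (𝓡 n) y₀ y₀) := by
    simp only [bil_apply]
    have hr : ContinuousAt (rep y₀ Y) (extChartAt (𝓡 n) y₀ y₀) :=
      (contDiffAt_rep hu (by rwa [extChartAt_to_inv])).continuousAt
    refine tendsto_finsetSum _ fun i _ ↦ tendsto_finsetSum _ fun j _ ↦ ?_
    exact ((contDiffAt_gram h hu i j).continuousAt.mul continuousAt_const).mul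
      ((EuclideanSpace.proj (𝕜 := ℝ) j).continuous.continuousAt.comp hr)
  exact ContinuousAt.comp (f := extChartAt (𝓡 n) y₀) h1 (continuousAt_extChartAt y₀)

/-- Near a point, a map admits a smooth variation whose variation field is a bump function times a
vector field that is constant in the chart of the target. -/
theorem exists_variation {m n : ℕ} {M N : Type*}
    [TopologicalSpace M] [ChartedSpace (EuclideanSpace ℝ (Fin m)) M] [IsManifold (𝓡 m) ∞ M]
    [T2Space M] [TopologicalSpace N] [ChartedSpace (EuclideanSpace ℝ (Fin n)) N]
    [IsManifold (𝓡 n) ∞ N] (h : SmoothMetric n N) {φ : M → N} (hφ : ContMDiff (𝓡 m) (𝓡 n) ∞ φ)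
    (p : M) (v : EuclideanSpace ℝ (Fin n)) {O : Set M} (hO : O ∈ nhds p) :
    ∃ (Ω : Set M) (χ : M → ℝ) (Φ : ℝ → M → N), IsCompact Ω ∧ Ω ⊆ O ∧ Continuous χ ∧
      (∀ x, 0 ≤ χ x) ∧ 0 < χ p ∧ (∀ x ∉ Ω, χ x = 0) ∧
      ContMDiff (𝓘(ℝ, ℝ).prod (𝓡 m)) (𝓡 n) ∞ (fun q : ℝ × M ↦ Φ q.1 q.2) ∧ Φ 0 = φ ∧
      (∀ t, ∀ x ∉ Ω, Φ t x = φ x) ∧ ∀ x ∈ Ω, ∀ Y, varCoeff h Φ Y x = χ x *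
        bil (gram h (φ p) (extChartAt (𝓡 n) (φ p) (φ x))) v
          (rep (φ p) Y (extChartAt (𝓡 n) (φ p) (φ x))) := by
  classical
  set ψ := extChartAt (𝓡 n) (φ p) with hψ
  have htop : ψ.target ∈ nhds (ψ (φ p)) :=
    (isOpen_extChartAt_target (I := 𝓡 n) (φ p)).mem_nhds (mem_extChartAt_target (φ p))
  obtain ⟨r, hr, hball⟩ := Metric.mem_nhds_iff.1 htop
  -- The displacement is shorter than half the radius of a coordinate ball; adding 1 to the norm
  -- allows `v = 0`.
  set ρ : ℝ := (r / 2) / (1 + ‖v‖) with hρ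
  have hρ0 : 0 < ρ := by positivity
  have hρv : ρ * ‖v‖ < r / 2 := by
    rw [hρ, div_mul_eq_mul_div, div_lt_iff₀ (by positivity)]
    nlinarith [norm_nonneg v]
  have hsrc : IsOpen ψ.source := isOpen_extChartAt_source (I := 𝓡 n) (φ p)
  have hO' : {x | x ∈ O ∧ φ x ∈ ψ.source ∧ ψ (φ x) ∈ Metric.ball (ψ (φ p)) (r / 2)}
      ∈ nhds p := by
    refine Filter.inter_mem hO (Filter.inter_mem
      (hφ.continuous.continuousAt (hsrc.mem_nhds (mem_extChartAt_source (φ p)))) ?_)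
    exact ContinuousAt.comp (f := φ) (continuousAt_extChartAt (I := 𝓡 n) (φ p))
      hφ.continuous.continuousAt (Metric.ball_mem_nhds _ (by positivity))
  obtain ⟨b, -, hb⟩ := (SmoothBumpFunction.nhds_basis_tsupport (I := 𝓡 m) p).mem_iff.1 hO'
  have hb0 : ∀ x ∉ tsupport b, b x = 0 := fun x hx ↦ image_eq_zero_of_notMem_tsupport hx
  -- The sine is bounded, so the displaced point stays in the chart for all times, and its
  -- derivative at 0 is 1, which gives the prescribed velocity.
  set c : ℝ → M → EuclideanSpace ℝ (Fin n) := fun t x ↦ ψ (φ x) + (ρ * Real.sin t * b x) • v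
    with hc
  have hct : ∀ t, ∀ x ∈ tsupport b, c t x ∈ ψ.target := fun t x hx ↦ by
    apply hball
    have h1 := (hb hx).2.2
    rw [Metric.mem_ball, dist_eq_norm] at h1 ⊢
    have h2 : ‖(ρ * Real.sin t * b x) • v‖ ≤ ρ * ‖v‖ := by
      rw [norm_smul, norm_mul, norm_mul, Real.norm_of_nonneg hρ0.le, Real.norm_of_nonneg b.nonneg]
      have : |Real.sin t| * b x ≤ 1 := mul_le_one₀ (Real.abs_sin_le_one t) b.nonneg b.le_one
      rw [Real.norm_eq_abs, mul_assoc ρ]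
      exact mul_le_mul_of_nonneg_right (mul_le_of_le_one_right hρ0.le this) (norm_nonneg v)
    calc ‖ψ (φ x) + (ρ * Real.sin t * b x) • v - ψ (φ p)‖
        = ‖(ψ (φ x) - ψ (φ p)) + (ρ * Real.sin t * b x) • v‖ := by congr 1; abel
      _ < r / 2 + r / 2 := (norm_add_le _ _).trans_lt (add_lt_add h1 (h2.trans_lt hρv))
      _ = r := by ring
  -- Where `φ x` leaves the chart domain the bump vanishes, so the default value `φ x` fits
  -- smoothly.
  set Φ : ℝ → M → N := fun t x ↦ if φ x ∈ ψ.source then ψ.symm (c t x) else φ x with hΦ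
  have hΦout : ∀ t, ∀ x ∉ tsupport b, Φ t x = φ x := fun t x hx ↦ by
    simp only [hΦ, hc, hb0 x hx, mul_zero, zero_smul, add_zero]
    split_ifs with h1
    · exact ψ.left_inv h1
    · rfl
  have hΦin : ∀ t, ∀ x, φ x ∈ ψ.source → Φ t x = ψ.symm (c t x) := fun t x hx ↦ if_pos hx
  have hΦ0 : Φ 0 = φ := by
    funext x
    simp only [hΦ, hc, Real.sin_zero, mul_zero, zero_mul, zero_smul, add_zero]
    split_ifs with h1
    · exact ψ.left_inv h1
    · rfl
  have hsm : ContMDiff (𝓘(ℝ, ℝ).prod (𝓡 m)) (𝓡 n) ∞ (fun q : ℝ × M ↦ Φ q.1 q.2) := by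
    rintro ⟨t, x⟩
    by_cases hx : x ∈ tsupport b
    · have hcs : ContMDiffAt (𝓘(ℝ, ℝ).prod (𝓡 m)) 𝓘(ℝ, EuclideanSpace ℝ (Fin n)) ∞
          (fun q : ℝ × M ↦ c q.1 q.2) (t, x) := by
        have k1 : ContMDiffAt (𝓘(ℝ, ℝ).prod (𝓡 m)) 𝓘(ℝ, EuclideanSpace ℝ (Fin n)) ∞
            (fun q : ℝ × M ↦ ψ (φ q.2)) (t, x) :=
          ContMDiffAt.comp (t, x) (g := ψ) (f := fun q : ℝ × M ↦ φ q.2)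
            (contMDiffAt_extChartAt' (by simpa [hψ] using (hb hx).2.1))
            (ContMDiffAt.comp (t, x) (g := φ) (hφ x) contMDiffAt_snd)
        have k2 : ContMDiffAt (𝓘(ℝ, ℝ).prod (𝓡 m)) 𝓘(ℝ, ℝ) ∞
            (fun q : ℝ × M ↦ ρ * Real.sin q.1 * b q.2) (t, x) :=
          (contMDiffAt_const.mul (ContMDiffAt.comp (t, x) (g := Real.sin)
            Real.contDiff_sin.contDiffAt.contMDiffAt contMDiffAt_fst)).mul
            (ContMDiffAt.comp (t, x) (g := b) b.contMDiffAt contMDiffAt_snd)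
        exact k1.add (k2.smul contMDiffAt_const)
      refine (ContMDiffAt.comp (t, x) (g := ψ.symm)
        (contMDiffAt_extChartAt_symm (hct t x hx)) hcs).congr_of_eventuallyEq ?_
      filter_upwards [((hsrc.preimage hφ.continuous).preimage
        (continuous_snd (X := ℝ))).mem_nhds (hb hx).2.1] with q hq using hΦin q.1 q.2 hq
    · refine (ContMDiffAt.comp (t, x) (g := φ) (hφ x) contMDiffAt_snd).congr_of_eventuallyEq ?_
      filter_upwards [((isClosed_tsupport b).isOpen_compl.preimage
        (continuous_snd (X := ℝ))).mem_nhds hx] with q hq using hΦout q.1 q.2 hq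
  refine ⟨tsupport b, fun x ↦ ρ * b x, Φ, b.hasCompactSupport, fun x hx ↦ (hb hx).1,
    b.continuous.const_mul ρ, fun x ↦ mul_nonneg hρ0.le b.nonneg, by simpa [b.eq_one] using hρ0,
    fun x hx ↦ by simp only [hb0 x hx, mul_zero], hsm, hΦ0, hΦout, fun x hx Y ↦ ?_⟩
  have hx' := (hb hx).2.1
  have hd : MDifferentiableAt 𝓘(ℝ, ℝ) (𝓡 n) (fun t ↦ Φ t x) 0 :=
    (ContMDiffAt.comp (0 : ℝ) (g := fun q : ℝ × M ↦ Φ q.1 q.2) (f := fun t ↦ (t, x)) (hsm (0, x))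
      (contMDiffAt_id.prodMk contMDiffAt_const)).mdifferentiableAt (by simp)
  have hΦx : Φ 0 x = φ x := congrFun hΦ0 x
  have key := inner_mfderiv_eq_bil h (φ := fun t ↦ Φ t x) (p := (0 : ℝ)) (1 : ℝ) (φ p) Y hd
    (by simpa only [hΦx] using hx')
  refine key.trans ?_
  have hder : HasDerivAt (fun t ↦ ψ (Φ t x)) ((ρ * b x) • v) 0 := by
    have e1 : (fun t ↦ ψ (Φ t x)) = fun t ↦ ψ (φ x) + (ρ * Real.sin t * b x) • v := by
      funext t
      rw [hΦin t x hx', ψ.right_inv (hct t x hx)]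
    rw [e1]
    have h2 : HasDerivAt (fun t ↦ ρ * Real.sin t * b x) (ρ * b x) 0 := by
      simpa using ((Real.hasDerivAt_sin 0).const_mul ρ).mul_const (b x)
    exact (h2.smul_const v).const_add _
  have h3 : mfderiv 𝓘(ℝ, ℝ) 𝓘(ℝ, EuclideanSpace ℝ (Fin n)) (fun t ↦ ψ (Φ t x)) 0 (1 : ℝ)
      = (ρ * b x) • v := by
    rw [mfderiv_eq_fderiv]
    exact hder.deriv
  simp only [hΦx]
  rw [← hψ]
  refine (congrArg (fun w ↦ bil (gram h (φ p) (ψ (φ x))) w (rep (φ p) Y (ψ (φ x)))) h3).trans ?_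
  simp only [map_smul, LinearMap.smul_apply, smul_eq_mul]

namespace IsAdaptedFrame

variable {M N : Type*}
  [TopologicalSpace M] [ChartedSpace (EuclideanSpace ℝ (Fin 3)) M] [IsManifold (𝓡 3) ∞ M]
  [T2Space M] [SecondCountableTopology M] [MeasurableSpace M] [BorelSpace M]
  [TopologicalSpace N] [ChartedSpace (EuclideanSpace ℝ (Fin 2)) N] [IsManifold (𝓡 2) ∞ N]
  {g : SmoothMetric 3 M} {h : SmoothMetric 2 N} {π : M → N} {U : Set M} {V : Set N}
  {e₁ e₂ e₃ : (p : M) → TangentSpace (𝓡 3) p} {ε₁ ε₂ : (y : N) → TangentSpace (𝓡 2) y}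
  {f₁ f₂ κ₁ κ₂ σ : M → ℝ}

/-- Biharmonicity is the vanishing of the bitension field. -/
theorem isBiharmonicOn_iff (hπ : ContMDiff (𝓡 3) (𝓡 2) ∞ π)
    (hf : IsAdaptedFrame g h π U V e₁ e₂ e₃ ε₁ ε₂)
    (hd : IsIntegrabilityData π U V e₁ e₂ e₃ ε₁ ε₂ f₁ f₂ κ₁ κ₂ σ) :
    IsBiharmonicOn g h π U ↔ ∀ p ∈ U, ∀ a, bitension ![e₁, e₂, e₃] (laplacian g) ![f₁, f₂]
      ![κ₁, κ₂] (fun q ↦ gaussCurvature h (π q)) a p = 0 := by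
  set E := bitension ![e₁, e₂, e₃] (laplacian g) ![f₁, f₂] ![κ₁, κ₂]
    (fun q ↦ gaussCurvature h (π q)) with hE
  refine ⟨fun hbi ↦ ?_, fun hz Ω hΩ hΩU Φ hΦ hΦ0 hΦΩ ↦ ?_⟩
  · by_contra! hne
    obtain ⟨p, hp, a₀, ha₀⟩ := hne
    have hU := hf.isOpen_source
    have hy := hf.mapsTo hp
    have hyt := mem_extChartAt_target (I := 𝓡 2) (π p)
    set ε := ![ε₁, ε₂]
    have hε : IsOrthonormalOn h V ε := hf.baseFrame
    -- The direction is the chart expression at `π p` of the Euler-Lagrange vector, so that at `p`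
    -- the pairing becomes the sum of squares of its components.
    set v : EuclideanSpace ℝ (Fin 2) :=
      ∑ b, E b p • rep (π p) (ε b) (extChartAt (𝓡 2) (π p) (π p)) with hv
    set q : Fin 2 → M → ℝ := fun a x ↦ bil (gram h (π p) (extChartAt (𝓡 2) (π p) (π x))) v
      (rep (π p) (ε a) (extChartAt (𝓡 2) (π p) (π x))) with hq
    have hqp : ∀ a, q a p = E a p := fun a ↦ by
      have h1 : ∀ b, bil (gram h (π p) (extChartAt (𝓡 2) (π p) (π p)))
          (rep (π p) (ε b) (extChartAt (𝓡 2) (π p) (π p)))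
          (rep (π p) (ε a) (extChartAt (𝓡 2) (π p) (π p))) = if b = a then 1 else 0 := fun b ↦ by
        rw [← inner_eq_bil h hyt, extChartAt_to_inv, hε.orthonormal _ hy]
      simp only [hq, hv, map_sum, map_smul, LinearMap.sum_apply, LinearMap.smul_apply, h1,
        smul_eq_mul, mul_ite, mul_one, mul_zero, Finset.sum_ite_eq', Finset.mem_univ, if_true]
    have hEc : ∀ x ∈ U, ∀ a, ContinuousAt (E a) x := fun x hx a ↦
      (hf.contMDiffAt_bitension hπ hd hx a).continuousAt
    have hqc : ∀ a, ContinuousAt (q a) p := fun a ↦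
      ContinuousAt.comp (f := π) (continuousAt_bil_rep h (π p) v
        ((hε.smooth a).contMDiffAt (hf.isOpen_target.mem_nhds hy))) hπ.continuous.continuousAt
    have hQc : ContinuousAt (fun x ↦ ∑ a, E a x * q a x) p :=
      tendsto_finsetSum _ fun a _ ↦ (hEc p hp a).mul (hqc a)
    have hQp : 0 < ∑ a, E a p * q a p := by
      simp only [hqp]
      exact Finset.sum_pos' (fun a _ ↦ mul_self_nonneg _)
        ⟨a₀, Finset.mem_univ _, mul_self_pos.2 ha₀⟩
    obtain ⟨Ω, χ, Φ, hΩ, hΩO, hχc, hχ0, hχp, hχΩ, hΦ, hΦ0, hΦΩ, hvar⟩ := exists_variation h hπ p v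
      (Filter.inter_mem (hU.mem_nhds hp) (hQc.eventually (lt_mem_nhds hQp)))
    have hΩU : Ω ⊆ U := fun x hx ↦ (hΩO hx).1
    have hzero := (hf.hasDerivAt_bienergy hπ hd hΩ hΩU hΦ hΦ0 hΦΩ).unique
      (hbi Ω hΩ hΩU Φ hΦ hΦ0 hΦΩ)
    have heq : ∀ x ∈ Ω, ∑ a, E a x * varCoeff h Φ (ε a) x = χ x * ∑ a, E a x * q a x :=
      fun x hx ↦ by
        rw [Finset.mul_sum]
        exact Finset.sum_congr rfl fun a _ ↦ by rw [hvar x hx]; ring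
    have hnn : 0 ≤ᵐ[(riemannianVolume g).restrict Ω]
        fun x ↦ ∑ a, E a x * varCoeff h Φ (ε a) x := by
      refine (ae_restrict_iff' hΩ.measurableSet).2 (Filter.Eventually.of_forall fun x hx ↦ ?_)
      change 0 ≤ ∑ a, E a x * varCoeff h Φ (ε a) x
      rw [heq x hx]
      exact mul_nonneg (hχ0 x) (hΩO hx).2.le
    have hint : IntegrableOn (fun x ↦ ∑ a, E a x * varCoeff h Φ (ε a) x) Ω
        (riemannianVolume g) := by
      refine ContinuousOn.integrableOn_compact hΩ fun x hx ↦ ContinuousAt.continuousWithinAt ?_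
      refine tendsto_finsetSum _ fun a _ ↦ (hEc x (hΩU hx) a).mul
        (contMDiffAt_varCoeff h hΦ ?_).continuousAt
      rw [hΦ0]
      exact (hε.smooth a).contMDiffAt (hf.isOpen_target.mem_nhds (hf.mapsTo (hΩU hx)))
    refine (ne_of_gt ?_) hzero
    -- The integrand is nonnegative on `Ω` and positive where the bump is, an open neighbourhood of
    -- `p` of positive volume. So the first variation cannot be zero.
    rw [setIntegral_pos_iff_support_of_nonneg_ae hnn hint]
    refine (riemannianVolume_pos g hU hf.frame (isOpen_lt continuous_const hχc) hχp hp).trans_le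
      (measure_mono fun x hx ↦ ?_)
    have hxΩ : x ∈ Ω := by
      by_contra hcon
      exact (ne_of_gt hx) (hχΩ x hcon)
    refine ⟨?_, hxΩ⟩
    rw [Function.mem_support, heq x hxΩ]
    exact (mul_pos hx (hΩO hxΩ).2).ne'
  · have h1 := hf.hasDerivAt_bienergy hπ hd hΩ hΩU hΦ hΦ0 hΦΩ
    rwa [setIntegral_eq_zero_of_forall_eq_zero fun x hx ↦
      Finset.sum_eq_zero fun a _ ↦ by
        rw [show bitension _ _ _ _ _ a x = 0 from hz x (hΩU hx) a, zero_mul]] at h1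

end IsAdaptedFrame

end Converse

end BiharmonicSubmersion
end

/-! ### Assembly of the theorem. -/

open BiharmonicSubmersion in
theorem theorem2p1 {M N : Type*}
    [TopologicalSpace M] [ChartedSpace (EuclideanSpace ℝ (Fin 3)) M] [IsManifold (𝓡 3) ∞ M]
    [T2Space M] [SecondCountableTopology M] [MeasurableSpace M] [BorelSpace M]
    [TopologicalSpace N] [ChartedSpace (EuclideanSpace ℝ (Fin 2)) N] [IsManifold (𝓡 2) ∞ N]
    [T2Space N] [SecondCountableTopology N]
    (g : SmoothMetric 3 M) (h : SmoothMetric 2 N) (π : M → N)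
    (hπ : IsRiemannianSubmersion g h π)
    (U : Set M) (V : Set N) (e₁ e₂ e₃ : (p : M) → TangentSpace (𝓡 3) p)
    (ε₁ ε₂ : (y : N) → TangentSpace (𝓡 2) y)
    (hframe : IsAdaptedFrame g h π U V e₁ e₂ e₃ ε₁ ε₂) :
    (∃ f₁ f₂ κ₁ κ₂ σ : M → ℝ,
      IsIntegrabilityData π U V e₁ e₂ e₃ ε₁ ε₂ f₁ f₂ κ₁ κ₂ σ) ∧
    ∀ f₁ f₂ κ₁ κ₂ σ : M → ℝ,
      IsIntegrabilityData π U V e₁ e₂ e₃ ε₁ ε₂ f₁ f₂ κ₁ κ₂ σ →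
      (∀ p ∈ U, tension g h π p = -κ₁ p • ε₁ (π p) - κ₂ p • ε₂ (π p)) ∧
      (∀ p ∈ U, gaussCurvature h (π p)
        = -(dirDeriv e₂ f₁ p - dirDeriv e₁ f₂ p + f₁ p ^ 2 + f₂ p ^ 2)) ∧
      (IsBiharmonicOn g h π U ↔
        ∀ p ∈ U,
          -laplacian g κ₁ p
              - f₁ p * dirDeriv e₁ κ₂ p - dirDeriv e₁ (fun q ↦ κ₂ q * f₁ q) p
              - f₂ p * dirDeriv e₂ κ₂ p - dirDeriv e₂ (fun q ↦ κ₂ q * f₂ q) p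
              + κ₁ p * κ₂ p * f₁ p + κ₂ p ^ 2 * f₂ p
              + κ₁ p * (-gaussCurvature h (π p) + f₁ p ^ 2 + f₂ p ^ 2) = 0 ∧
          -laplacian g κ₂ p
              + f₁ p * dirDeriv e₁ κ₁ p + dirDeriv e₁ (fun q ↦ κ₁ q * f₁ q) p
              + f₂ p * dirDeriv e₂ κ₁ p + dirDeriv e₂ (fun q ↦ κ₁ q * f₂ q) p
              - κ₁ p * κ₂ p * f₂ p - κ₁ p ^ 2 * f₁ p
              + κ₂ p * (-gaussCurvature h (π p) + f₁ p ^ 2 + f₂ p ^ 2) = 0) := by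
  refine ⟨hframe.exists_integrabilityData hπ.smooth, fun f₁ f₂ κ₁ κ₂ σ hd ↦
    ⟨fun p hp ↦ hframe.tension_eq hπ.smooth hd hp,
      fun p hp ↦ hframe.gaussCurvature_eq hπ.smooth hd hp,
      (hframe.isBiharmonicOn_iff hπ.smooth hd).trans (forall₂_congr fun p _ ↦ ?_)⟩⟩
  -- The two components of `bitension` unfold to the two displayed equations.
  rw [Fin.forall_fin_two]
  exact Iff.rfl
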